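/- **Functional composition.** For any two modules $M,M'$ that can be linked, $[\![M\cdot M']\!]\sim[\![M]\!]\otimes[\![M']\!]$, where the language, the system-level semantics $[\![-]\!]$, the compositions $\cdot$ and $\otimes$, and the bisimilarity $\sim$ are as follows. *Names, values, modules.* There are countably many location names, function names and continuation names, all distinct. Values $v$ are tuples (up to associativity and unit) of integers, location names and function names. Terms are $$e::= x\mid v\mid e\star e\mid e=e\mid e;e\mid \mathtt{if}(e)\{e\}\{e\}\mid *e\mid \mathtt{return}\,e\mid\mathtt{new}()\mid \mathtt{local}\,x;e\mid e(e)\mid(e,e)$$ with bound variables $x$ (parameters, locals) and the usual binary arithmetic and logical operators $\star$. A module consists of a finite set of exported names, a finite set of imported names (location and function names), and a list of declarations $\mathtt{decl}\,a=n$ (with $a$ a location name, $n\in\mathbb Z$) and $\mathtt{decl}\,f(\bar x)\{\mathtt{local}\,\bar y;\,e;\ \mathtt{return}\,e'\}$; no name is declared twice, and bodies only use names that are declared, exported or imported. $f@M$ denotes the definition of $f$ in $M$. Header names are the exported and the imported ones; hidden names are the declared names that are not header names. $M,M'$ can be linked if no name that is a header name of both is declared in both. $M\cdot M'$ is obtained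 by renaming hidden names of $M$ and of $M'$ (by sort-preserving permutations that fix the header names) so that no hidden name of one is a declared or header name of the other, and then concatenating (uniting exports and imports, appending the declarations); such renamings exist, the claim holds for every choice of them, and $[\![M]\!]\otimes[\![M']\!]$ is formed from the same renamed modules. *Configurations.* A store $s$ is a pair of finite partial functions, $s_\lambda$ from locations to integers, locations and function names, and $s_\kappa$ from continuation names to pairs of a frame stack and a continuation name. $\nu(-)$ is the set of names occurring, $\mathcal X_\lambda,\mathcal X_\kappa$ are the locations and the continuation names in $\mathcal X$, $s[s']$ is $s$ overridden by $s'$, $s\upharpoonright\mathcal X$ is $s$ restricted to domain $\mathcal X$, and $Cl(s,\mathcal X)$ is the set of names reachable from $\mathcal X$ through $s_\lambda$. States of $[\![M]\!]$ are system configurations $\langle\!\langle N\mid P\vdash s\rangle\!\rangle$ and program configurations $\langle N\mid P\vdash s,t,e,k\rangle$ with used names $N$, public names $P$, frame stack $t$, term $e$ and continuation name $k$. *Transitions of $[\![M]\!]$.* Internal transitions $\to$ between program configurations are those of the standard left-to-right call-by-value frame-stack machine: assignment and dereferencing act on $s_\lambda$; $\mathtt{new}()$ and $\mathtt{local}$ add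 to $N$ a location outside $N$, initialised to $0$; a call of $f$ with $f@M$ defined is replaced by the body with the argument components substituted for the parameters (if their numbers agree); $\mathtt{return}\,e$ yields the value of $e$. Besides, with $P'=Cl(s,P\cup\nu(v))$, - $\langle N|P\vdash s,t\circ f(\square),v,k\rangle\xrightarrow[s\upharpoonright P'_\lambda]{\mathtt{call}\,f,v,k'}\langle\!\langle N\cup\{k'\}|P'\cup\{k'\}\vdash s[k'\mapsto(t,k)]\rangle\!\rangle$ if $f@M$ is undefined and $k'\notin N$; - $\langle N|P\vdash s,\varepsilon,v,k\rangle\xrightarrow[s\upharpoonright P'_\lambda]{\mathtt{ret}\,v,k}\langle\!\langle N|P'\vdash s\rangle\!\rangle$; - $\langle\!\langle N|P\vdash s\rangle\!\rangle\xrightarrow[s']{\mathtt{call}\,f,v,k}\langle N\cup\{k\}\cup\nu(v,s')|P\cup\{k\}\cup\nu(v,s')\vdash s[s'],f(\square),v,k\rangle$ if $f@M$ is defined, $k\notin\mathrm{dom}(s_\kappa)$, $\nu(f,v,s')\cap N\subseteq P$ and $(P\cup\nu(v,s'))_\lambda\subseteq\mathrm{dom}(s')$; - $\langle\!\langle N|P\vdash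 s\rangle\!\rangle\xrightarrow[s']{\mathtt{ret}\,v,k'}\langle N\cup\nu(v,s')|P\cup\nu(v,s')\vdash s[s'],t,v,k\rangle$ if $s(k')=(t,k)$, $\nu(v,s')\cap N\subseteq P$ and $(P\cup\nu(v,s'))_\lambda\subseteq\mathrm{dom}(s')$. Here the stores $s'$ are defined on locations only, and labels record the direction (Program-to-System for the first two kinds, System-to-Program for the last two). The initial state has as $N$ all declared and header names, as $P$ the header names, and as store the declared variables with their initial values. *Semantic composition.* States of $[\![M]\!]\otimes[\![M']\!]$ are $X\otimes^{\Pi}_{s}X'$ with $X,X'$ states of $[\![M]\!],[\![M']\!]$, a set $\Pi$ of names whose continuation names carry Program or System polarity ($\Pi_S$: those with System polarity), and a store $s$ of locations. Let $p,p'$ range over program and $q,q'$ over system configurations. Together with their symmetric counterparts, the rules are: 1. $p\otimes^\Pi_s q\to p'\otimes^\Pi_s q$ if $p\to p'$ and $\nu(p')\cap\nu(q)\subseteq\nu(p)$. 2. $p\otimes^\Pi_{s'}q\xrightarrow{\tau}q'\otimes^\Pi_{s'[s]}p'$ if $p\xrightarrow[s]{\alpha}q'$ and $q\xrightarrow[s]{\alpha}p'$,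 where $\alpha$ is $\mathtt{ret}\,v,k$, or $\alpha$ is $\mathtt{call}\,f,v,k$ with $k\notin\nu(q)$. 3. $p\otimes^\Pi_{s'}q\xrightarrow[s''\upharpoonright\Pi']{\alpha}q'\otimes^{\Pi'}_{s''}q$ if $p\xrightarrow[s]{\alpha}q'$ and $q$ has no transition labelled $\alpha$ with store $s$, where $s''=s'[s]$ and $\Pi'=Cl(s'',\nu(v)\cup\Pi)$ for $\alpha=\mathtt{ret}\,v,k$; for $\alpha=\mathtt{call}\,f,v,k$, moreover $k\notin\nu(q)$ and $k$ is added to $\Pi'$ with Program polarity. 4. $q\otimes^\Pi_{s'}q'\xrightarrow[s\upharpoonright\Pi']{\alpha}p\otimes^{\Pi'}_{s'[s]}q'$ if $q\xrightarrow[s]{\alpha}p$, where, with $pr=\nu(q,q')\setminus\Pi$ and $s\setminus pr$ the restriction of $s$ to locations outside $pr$: $\Pi_\lambda\subseteq\mathrm{dom}(s)$, $s'\setminus\Pi\subseteq s$, $\mathrm{dom}(s)\cap pr\subseteq\mathrm{dom}(s')$, and $\nu(v,s\setminus pr)\cap pr=\emptyset$. For $\alpha=\mathtt{ret}\,v,k$: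 $k\notin\nu(q')$ and $\Pi'=\Pi\cup\nu(v,s\setminus pr)$. For $\alpha=\mathtt{call}\,f,v,k$: $f\notin pr$, $k\notin\nu(q')\setminus\Pi_S$ and $\Pi'=\Pi\cup\nu(v,s\setminus pr)\cup\{k\}$, with $k$ of System polarity. The initial state consists of the initial states of $[\![M]\!]$ and $[\![M']\!]$, the set $\Pi$ of all header names of both, and the store of the initial values of all declared variables that are header names of the declaring module. *Bisimilarity.* The public names are $P$ for states of $[\![M\cdot M']\!]$ and $\Pi$ for composite states. The bound names of a composite state are $(P_1\cap P_2)_\kappa\setminus\Pi_S$, with $P_1,P_2$ the public names of its two components; states of $[\![M\cdot M']\!]$ have none. A relation is a simulation if related states $X,Y$ have the same public names; $X\xrightarrow{\tau}X'$ implies $Y\xrightarrow{\tau}{}^{*}Y'$ with $X',Y'$ related; and each other transition $X\xrightarrow{\ell}X'$ (internal, or labelled with an action and a store) whose label contains no bound name of $Y$ implies $Y\xrightarrow{\tau}{}^{*}\xrightarrow{\ell}\xrightarrow{\tau}{}^{*}Y'$ with $X',Y'$ related. A bisimulation is a simulation whose inverse is one, and $\sim$ means that some bisimulation relates the initial states.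 -/

import Mathlib

namespace SLS

/-! ## Names and values -/

/-- Identifiers: location names (variables) and function names. -/
inductive Ident where
  | loc (n : ℕ)
  | fn (n : ℕ)
  deriving DecidableEq

/-- Names: location names, function names and continuation names. -/
inductive Name where
  | ident (i : Ident)
  | cont (k : ℕ)
  deriving DecidableEq

/-- The name of a location. -/
abbrev Name.loc (n : ℕ) : Name := .ident (.loc n)

/-- The name of a function. -/
abbrev Name.fn (n : ℕ) : Name := .ident (.fn n)

/-- The data that a location can hold: integers, location names and function names. -/
inductive Atom where
  | int (z : ℤ)
  | ident (i : Ident)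
  deriving DecidableEq

/-- Values are tuples of atoms, up to associativity and unit of tupling, i.e. lists of atoms;
the unit value is `[]` and a one-component tuple is its component. -/
abbrev Value := List Atom

def Atom.names : Atom → Set Name
  | .int _ => ∅
  | .ident i => {Name.ident i}

def Value.names (v : Value) : Set Name := {n | ∃ a ∈ v, n ∈ a.names}

/-! ## Syntax -/

/-- Binary arithmetic and logical operators. -/
inductive BinOp where
  | plus | minus | times | quot | rem | eq | ne | lt | le | conj | disj
  deriving DecidableEq

def ofBool (b : Bool) : Atom := .int (if b then 1 else 0)

/-- Evaluation of operators. Equality tests compare integers and names; the other operators act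
on integers only, and division by zero is undefined. -/
def BinOp.eval : BinOp → Atom → Atom → Option Atom
  | .eq, a, b => some (ofBool (decide (a = b)))
  | .ne, a, b => some (ofBool (decide (a ≠ b)))
  | .plus, .int x, .int y => some (.int (x + y))
  | .minus, .int x, .int y => some (.int (x - y))
  | .times, .int x, .int y => some (.int (x * y))
  | .quot, .int x, .int y => if y = 0 then none else some (.int (x.tdiv y))
  | .rem, .int x, .int y => if y = 0 then none else some (.int (x.tmod y))
  | .lt, .int x, .int y => some (ofBool (decide (x < y)))
  | .le, .int x, .int y => some (ofBool (decide (x ≤ y)))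
  | .conj, .int x, .int y => some (ofBool (decide (x ≠ 0 ∧ y ≠ 0)))
  | .disj, .int x, .int y => some (ofBool (decide (x ≠ 0 ∨ y ≠ 0)))
  | _, _, _ => none

/-- Terms: statements and expressions of the language together with the expressions of the
abstract machine. Formal parameters and local variables of functions are bound and are kept
apart from names: they are the variables `var x`; `localVar x e` is `local x; e`. The empty
statement is the unit value. -/
inductive Term where
  | var (x : ℕ)
  | val (v : Value)
  | binop (op : BinOp) (e e' : Term)
  | assign (e e' : Term)
  | seq (e e' : Term)
  | ite (e e₁ e₂ : Term)
  | deref (e : Term)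
  | ret (e : Term)
  | new
  | localVar (x : ℕ) (e : Term)
  | app (e e' : Term)
  | pair (e e' : Term)

def Term.names : Term → Set Name
  | .var _ => ∅
  | .val v => v.names
  | .binop _ e e' => e.names ∪ e'.names
  | .assign e e' => e.names ∪ e'.names
  | .seq e e' => e.names ∪ e'.names
  | .ite e e₁ e₂ => e.names ∪ e₁.names ∪ e₂.names
  | .deref e => e.names
  | .ret e => e.names
  | .new => ∅
  | .localVar _ e => e.names
  | .app e e' => e.names ∪ e'.names
  | .pair e e' => e.names ∪ e'.names

/-- `e.subst x a` is `e[a/x]`. -/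
def Term.subst (x : ℕ) (a : Atom) : Term → Term
  | .var y => if y = x then .val [a] else .var y
  | .val v => .val v
  | .binop op e e' => .binop op (e.subst x a) (e'.subst x a)
  | .assign e e' => .assign (e.subst x a) (e'.subst x a)
  | .seq e e' => .seq (e.subst x a) (e'.subst x a)
  | .ite e e₁ e₂ => .ite (e.subst x a) (e₁.subst x a) (e₂.subst x a)
  | .deref e => .deref (e.subst x a)
  | .ret e => .ret (e.subst x a)
  | .new => .new
  | .localVar y e => if y = x then .localVar y e else .localVar y (e.subst x a)
  | .app e e' => .app (e.subst x a) (e'.subst x a)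
  | .pair e e' => .pair (e.subst x a) (e'.subst x a)

/-- A function declaration without its name: `(params){local locals; body return result;}`. -/
structure Func where
  params : List ℕ
  locals : List ℕ
  body : Term
  result : Term

/-- The term `local locals; body; return result`. -/
def Func.term (d : Func) : Term :=
  d.locals.foldr Term.localVar (.seq d.body (.ret d.result))

/-- The body of a function with its formal parameters replaced pointwise by the components of
the argument tuple; undefined if the number of arguments is wrong. -/
def Func.inst (d : Func) (v : Value) : Option Term :=
  if d.params.length = v.length then
    some ((d.params.zip v).foldl (fun e p => e.subst p.1 p.2) d.term)
  else none

/-- Declarations `decl x = n` and `decl f(..){..}`. -/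
inductive Dcl where
  | var (x : ℕ) (n : ℤ)
  | func (f : ℕ) (d : Func)

def Dcl.ident : Dcl → Ident
  | .var x _ => .loc x
  | .func f _ => .fn f

/-- A module: a header with exported and imported names, and a list of declarations. -/
structure Mod where
  exports : Finset Ident
  imports : Finset Ident
  decls : List Dcl

namespace Mod

/-- The exported and imported names. -/
def header (M : Mod) : Set Ident := {i | i ∈ M.exports ∨ i ∈ M.imports}

/-- The declared names. -/
def declared (M : Mod) : Set Ident := {i | ∃ D ∈ M.decls, D.ident = i}

/-- All names in the scope of the module. -/
def scope (M : Mod) : Set Ident := M.header ∪ M.declared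

/-- The names whose scope is the module only. -/
def hidden (M : Mod) : Set Ident := M.declared \ M.header

/-- No name is declared twice, and the function bodies only use names that are declared,
exported or imported. -/
def WellFormed (M : Mod) : Prop :=
  (M.decls.map Dcl.ident).Nodup ∧
  ∀ f d, Dcl.func f d ∈ M.decls → d.term.names ⊆ Name.ident '' M.scope

/-- `f @ M`. -/
def fun? (M : Mod) (f : ℕ) : Option Func :=
  M.decls.findSome? fun
    | .func g d => if g = f then some d else none
    | .var _ _ => none

/-- The declared initial value of a variable. -/
def var? (M : Mod) (x : ℕ) : Option ℤ :=
  M.decls.findSome? fun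
    | .var y n => if y = x then some n else none
    | .func _ _ => none

/-- Concatenation of modules. -/
def append (M M' : Mod) : Mod where
  exports := M.exports ∪ M'.exports
  imports := M.imports ∪ M'.imports
  decls := M.decls ++ M'.decls

end Mod

/-! ## Renaming of hidden names -/

/-- A sort-preserving permutation of location and function names. -/
structure Ren where
  loc : Equiv.Perm ℕ
  fn : Equiv.Perm ℕ

def Ren.ident (ρ : Ren) : Ident → Ident
  | .loc n => .loc (ρ.loc n)
  | .fn n => .fn (ρ.fn n)

def Atom.rename (ρ : Ren) : Atom → Atom
  | .int z => .int z
  | .ident i => .ident (ρ.ident i)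

def Term.rename (ρ : Ren) : Term → Term
  | .var x => .var x
  | .val v => .val (v.map (Atom.rename ρ))
  | .binop op e e' => .binop op (e.rename ρ) (e'.rename ρ)
  | .assign e e' => .assign (e.rename ρ) (e'.rename ρ)
  | .seq e e' => .seq (e.rename ρ) (e'.rename ρ)
  | .ite e e₁ e₂ => .ite (e.rename ρ) (e₁.rename ρ) (e₂.rename ρ)
  | .deref e => .deref (e.rename ρ)
  | .ret e => .ret (e.rename ρ)
  | .new => .new
  | .localVar x e => .localVar x (e.rename ρ)
  | .app e e' => .app (e.rename ρ) (e'.rename ρ)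
  | .pair e e' => .pair (e.rename ρ) (e'.rename ρ)

def Func.rename (ρ : Ren) (d : Func) : Func where
  params := d.params
  locals := d.locals
  body := d.body.rename ρ
  result := d.result.rename ρ

def Dcl.rename (ρ : Ren) : Dcl → Dcl
  | .var x n => .var (ρ.loc x) n
  | .func f d => .func (ρ.fn f) (d.rename ρ)

def Mod.rename (ρ : Ren) (M : Mod) : Mod where
  exports := M.exports.image ρ.ident
  imports := M.imports.image ρ.ident
  decls := M.decls.map (Dcl.rename ρ)

/-- The renamings `ρ` of `M` and `ρ'` of `M'` leave exported and imported names unchanged and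
prevent all clashes of hidden names of one module with names of the other one. -/
def PreventsClashes (M M' : Mod) (ρ ρ' : Ren) : Prop :=
  (∀ i ∈ M.header, ρ.ident i = i) ∧ (∀ i ∈ M'.header, ρ'.ident i = i) ∧
  Disjoint (M.rename ρ).hidden (M'.rename ρ').scope ∧
  Disjoint (M'.rename ρ').hidden (M.rename ρ).scope

/-- No name in the header of both modules is declared in both of them: linking them does not
produce a multiply defined symbol. -/
def Linkable (M M' : Mod) : Prop :=
  ∀ i ∈ M.header ∩ M'.header, ¬ (i ∈ M.declared ∧ i ∈ M'.declared)

/-! ## Stores and configurations -/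

/-- Frames, with the hole left implicit. -/
inductive Frame where
  | ite (e₁ e₂ : Term)
  | binopL (op : BinOp) (e : Term)
  | binopR (op : BinOp) (v : Value)
  | assignL (e : Term)
  | assignR (v : Value)
  | seqL (e : Term)
  | seqR (v : Value)
  | deref
  | ret
  | appL (e : Term)
  | appR (v : Value)
  | pairL (e : Term)
  | pairR (v : Value)

def Frame.names : Frame → Set Name
  | .ite e₁ e₂ => e₁.names ∪ e₂.names
  | .binopL _ e => e.names
  | .binopR _ v => v.names
  | .assignL e => e.names
  | .assignR v => v.names
  | .seqL e => e.names
  | .seqR v => v.names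
  | .deref => ∅
  | .ret => ∅
  | .appL e => e.names
  | .appR v => v.names
  | .pairL e => e.names
  | .pairR v => v.names

/-- Frame stacks; the head of the list is the innermost frame, so `F :: t` is `t ∘ F`. -/
abbrev Stack := List Frame

def Stack.names (t : Stack) : Set Name := {n | ∃ F ∈ t, n ∈ F.names}

/-- Partial functions on `ℕ` with finite domain. -/
@[ext] structure FinPMap (β : Type) where
  get : ℕ → Option β
  finite_dom : {n | get n ≠ none}.Finite

namespace FinPMap

variable {β : Type}

def dom (s : FinPMap β) : Set ℕ := {n | s.get n ≠ none}

/-- The everywhere undefined function. -/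
def empty : FinPMap β where
  get _ := none
  finite_dom := by simp

/-- `s[n ↦ b]`. -/
def set (s : FinPMap β) (n : ℕ) (b : β) : FinPMap β where
  get m := if m = n then some b else s.get m
  finite_dom := by
    refine (s.finite_dom.insert n).subset ?_
    intro m hm
    by_cases h : m = n
    · exact Or.inl h
    · exact Or.inr (by simpa [h] using hm)

/-- `s[s']`. -/
def override (s s' : FinPMap β) : FinPMap β where
  get m := (s'.get m).or (s.get m)
  finite_dom := by
    refine (s.finite_dom.union s'.finite_dom).subset ?_
    intro m hm
    by_cases h : s'.get m = none
    · exact Or.inl (by simpa [h] using hm)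
    · exact Or.inr h

open Classical in
/-- `s ↾ X`. -/
noncomputable def restrict (s : FinPMap β) (X : Set ℕ) : FinPMap β where
  get m := if m ∈ X then s.get m else none
  finite_dom := by
    refine s.finite_dom.subset ?_
    intro m hm
    by_cases h : m ∈ X
    · simpa [h] using hm
    · simp [h] at hm

end FinPMap

/-- The location component of a store. -/
abbrev LStore := FinPMap Atom

def LStore.names (s : LStore) : Set Name :=
  {n | ∃ a b, s.get a = some b ∧ (n = .loc a ∨ n ∈ b.names)}

/-- Stores: locations hold atoms, continuation names hold a frame stack and a continuation. -/
structure Store where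
  loc : LStore
  cont : FinPMap (Stack × ℕ)

def Store.names (s : Store) : Set Name :=
  s.loc.names ∪
    {n | ∃ k t k', s.cont.get k = some (t, k') ∧ (n = .cont k ∨ n ∈ Stack.names t ∨ n = .cont k')}

/-- `s[a ↦ b]` for a location `a`. -/
def Store.setLoc (s : Store) (a : ℕ) (b : Atom) : Store := { s with loc := s.loc.set a b }

/-- `s[k ↦ (t, k')]` for a continuation name `k`. -/
def Store.setCont (s : Store) (k : ℕ) (c : Stack × ℕ) : Store := { s with cont := s.cont.set k c }

/-- `s[s']` for a store `s'` of locations. -/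
def Store.override (s : Store) (s' : LStore) : Store := { s with loc := s.loc.override s' }

/-- The closure `Cl(s, X)`: all names reachable from `X` through the locations of `s`. -/
inductive Cl (s : LStore) (X : Set Name) : Name → Prop where
  | base {n : Name} (h : n ∈ X) : Cl s X n
  | step {a : ℕ} {b : Atom} {n : Name} (h : Cl s X (.loc a)) (hs : s.get a = some b)
      (hn : n ∈ b.names) : Cl s X n

/-- The locations in a set of names. -/
def locs (X : Set Name) : Set ℕ := {a | Name.loc a ∈ X}

/-- System configurations `⟪N | P ⊢ s⟫`. -/
structure SysCfg where
  N : Set Name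
  P : Set Name
  s : Store

/-- Program configurations `⟨N | P ⊢ s, t, e, k⟩`. -/
structure ProgCfg where
  N : Set Name
  P : Set Name
  s : Store
  t : Stack
  e : Term
  k : ℕ

/-- States of the system-level semantics of a module. -/
inductive Cfg where
  | sys (σ : SysCfg)
  | prog (p : ProgCfg)

def Cfg.pub : Cfg → Set Name
  | .sys σ => σ.P
  | .prog p => p.P

def SysCfg.names (σ : SysCfg) : Set Name := σ.N ∪ σ.P ∪ σ.s.names

def ProgCfg.names (p : ProgCfg) : Set Name :=
  p.N ∪ p.P ∪ p.s.names ∪ Stack.names p.t ∪ p.e.names ∪ {Name.cont p.k}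

/-! ## System-level semantics of modules -/

/-- Transitions of the abstract machine. -/
inductive Red (M : Mod) : ProgCfg → ProgCfg → Prop where
  -- the term is a value
  | iteTrue {N P s t e₁ e₂ k} {z : ℤ} (h : z ≠ 0) :
      Red M ⟨N, P, s, .ite e₁ e₂ :: t, .val [.int z], k⟩ ⟨N, P, s, t, e₁, k⟩
  | iteFalse {N P s t e₁ e₂ k} :
      Red M ⟨N, P, s, .ite e₁ e₂ :: t, .val [.int 0], k⟩ ⟨N, P, s, t, e₂, k⟩
  | binopSwap {N P s t op e v k} :
      Red M ⟨N, P, s, .binopL op e :: t, .val v, k⟩ ⟨N, P, s, .binopR op v :: t, e, k⟩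
  | assignSwap {N P s t e v k} :
      Red M ⟨N, P, s, .assignL e :: t, .val v, k⟩ ⟨N, P, s, .assignR v :: t, e, k⟩
  | seqSwap {N P s t e v k} :
      Red M ⟨N, P, s, .seqL e :: t, .val v, k⟩ ⟨N, P, s, .seqR v :: t, e, k⟩
  | binopEval {N P s t op a b c k} (h : BinOp.eval op a b = some c) :
      Red M ⟨N, P, s, .binopR op [a] :: t, .val [b], k⟩ ⟨N, P, s, t, .val [c], k⟩
  | seqEval {N P s t v v' k} :
      Red M ⟨N, P, s, .seqR v :: t, .val v', k⟩ ⟨N, P, s, t, .val v', k⟩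
  | assignEval {N P s t a b k} :
      Red M ⟨N, P, s, .assignR [.ident (.loc a)] :: t, .val [b], k⟩
        ⟨N, P, s.setLoc a b, t, .val [], k⟩
  | derefEval {N P s t a b k} (h : s.loc.get a = some b) :
      Red M ⟨N, P, s, .deref :: t, .val [.ident (.loc a)], k⟩ ⟨N, P, s, t, .val [b], k⟩
  | retEval {N P s t v k} :
      Red M ⟨N, P, s, .ret :: t, .val v, k⟩ ⟨N, P, s, t, .val v, k⟩
  | appSwap {N P s t e v k} :
      Red M ⟨N, P, s, .appL e :: t, .val v, k⟩ ⟨N, P, s, .appR v :: t, e, k⟩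
  | pairSwap {N P s t e v k} :
      Red M ⟨N, P, s, .pairL e :: t, .val v, k⟩ ⟨N, P, s, .pairR v :: t, e, k⟩
  | pairEval {N P s t v v' k} :
      Red M ⟨N, P, s, .pairR v :: t, .val v', k⟩ ⟨N, P, s, t, .val (v ++ v'), k⟩
  | appEval {N P s t f v k d e} (hf : M.fun? f = some d) (he : d.inst v = some e) :
      Red M ⟨N, P, s, .appR [.ident (.fn f)] :: t, .val v, k⟩ ⟨N, P, s, t, e, k⟩
  -- the term is not a canonical form
  | itePush {N P s t e e₁ e₂ k} :
      Red M ⟨N, P, s, t, .ite e e₁ e₂, k⟩ ⟨N, P, s, .ite e₁ e₂ :: t, e, k⟩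
  | binopPush {N P s t op e e' k} :
      Red M ⟨N, P, s, t, .binop op e e', k⟩ ⟨N, P, s, .binopL op e' :: t, e, k⟩
  | assignPush {N P s t e e' k} :
      Red M ⟨N, P, s, t, .assign e e', k⟩ ⟨N, P, s, .assignL e' :: t, e, k⟩
  | seqPush {N P s t e e' k} :
      Red M ⟨N, P, s, t, .seq e e', k⟩ ⟨N, P, s, .seqL e' :: t, e, k⟩
  | derefPush {N P s t e k} :
      Red M ⟨N, P, s, t, .deref e, k⟩ ⟨N, P, s, .deref :: t, e, k⟩
  | retPush {N P s t e k} :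
      Red M ⟨N, P, s, t, .ret e, k⟩ ⟨N, P, s, .ret :: t, e, k⟩
  | appPush {N P s t e e' k} :
      Red M ⟨N, P, s, t, .app e e', k⟩ ⟨N, P, s, .appL e' :: t, e, k⟩
  | pairPush {N P s t e e' k} :
      Red M ⟨N, P, s, t, .pair e e', k⟩ ⟨N, P, s, .pairL e' :: t, e, k⟩
  | new {N P s t k} {a : ℕ} (ha : Name.loc a ∉ N) :
      Red M ⟨N, P, s, t, .new, k⟩
        ⟨N ∪ {.loc a}, P, s.setLoc a (.int 0), t, .val [.ident (.loc a)], k⟩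
  | localVar {N P s t x e k} {a : ℕ} (ha : Name.loc a ∉ N) :
      Red M ⟨N, P, s, t, .localVar x e, k⟩
        ⟨N ∪ {.loc a}, P, s.setLoc a (.int 0), t, e.subst x (.ident (.loc a)), k⟩

/-- Calls `call f, v, k` and returns `ret v, k`. -/
inductive Act where
  | call (f : ℕ) (v : Value) (k : ℕ)
  | ret (v : Value) (k : ℕ)

def Act.names : Act → Set Name
  | .call f v k => {Name.fn f, Name.cont k} ∪ v.names
  | .ret v k => {Name.cont k} ∪ v.names

/-- Transition labels: internal moves of the abstract machine, synchronisations `τ`, actions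
from Program to System and actions from System to Program, with the observable store. -/
inductive Label where
  | int
  | tau
  | ps (α : Act) (s : LStore)
  | sp (α : Act) (s : LStore)

def Label.names : Label → Set Name
  | .int => ∅
  | .tau => ∅
  | .ps α s => α.names ∪ s.names
  | .sp α s => α.names ∪ s.names

/-- The System, knowing the public names `P` of the used names `N`, may supply the value `v` and
the store `s'`: it uses public or fresh names only, and its store is defined at every location
that is public or that occurs in `v` or `s'`. -/
def SysMay (N P : Set Name) (v : Value) (s' : LStore) : Prop :=
  (v.names ∪ s'.names) ∩ N ⊆ P ∧ locs (P ∪ v.names ∪ s'.names) ⊆ s'.dom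

/-- The transitions of the system-level semantics of `M`. -/
inductive Step (M : Mod) : Cfg → Label → Cfg → Prop where
  | int {p p'} (h : Red M p p') : Step M (.prog p) .int (.prog p')
  | psCall {N P s t f v k k'} {P' : Set Name} (hf : M.fun? f = none) (hk : Name.cont k' ∉ N)
      (hP : P' = {n | Cl s.loc (P ∪ v.names) n}) :
      Step M (.prog ⟨N, P, s, .appR [.ident (.fn f)] :: t, .val v, k⟩)
        (.ps (.call f v k') (s.loc.restrict (locs P')))
        (.sys ⟨N ∪ {.cont k'}, P' ∪ {.cont k'}, s.setCont k' (t, k)⟩)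
  | psRet {N P s v k} {P' : Set Name} (hP : P' = {n | Cl s.loc (P ∪ v.names) n}) :
      Step M (.prog ⟨N, P, s, [], .val v, k⟩)
        (.ps (.ret v k) (s.loc.restrict (locs P')))
        (.sys ⟨N, P', s⟩)
  | spCall {N P s f v k s'} (hf : M.fun? f ≠ none) (hfP : Name.fn f ∈ N → Name.fn f ∈ P)
      (hk : k ∉ s.cont.dom) (h : SysMay N P v s') :
      Step M (.sys ⟨N, P, s⟩) (.sp (.call f v k) s')
        (.prog ⟨N ∪ {.cont k} ∪ (v.names ∪ s'.names), P ∪ {.cont k} ∪ (v.names ∪ s'.names),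
          s.override s', [.appR [.ident (.fn f)]], .val v, k⟩)
  | spRet {N P s v k k' t s'} (hk : s.cont.get k' = some (t, k)) (h : SysMay N P v s') :
      Step M (.sys ⟨N, P, s⟩) (.sp (.ret v k') s')
        (.prog ⟨N ∪ (v.names ∪ s'.names), P ∪ (v.names ∪ s'.names),
          s.override s', t, .val v, k⟩)

/-- The store that gives the declared variables with identifier in `X` their initial values. -/
noncomputable def Mod.initStore (M : Mod) (X : Set Ident) : LStore :=
  FinPMap.restrict
    { get := fun x => (M.var? x).map Atom.int
      finite_dom := by
        have hfin : {x | ∃ n, Dcl.var x n ∈ M.decls}.Finite := by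
          refine ((M.decls.map Dcl.ident).toFinset.finite_toSet.preimage
            (f := Ident.loc) (fun a _ b _ h => by injection h)).subset ?_
          rintro x ⟨n, hn⟩
          simpa using ⟨_, hn, rfl⟩
        refine hfin.subset ?_
        intro x hx
        simp only [Mod.var?, ne_eq, Option.map_eq_none_iff, List.findSome?_eq_none_iff,
          Set.mem_ofPred_eq] at hx
        push Not at hx
        obtain ⟨D, hD, hne⟩ := hx
        cases D with
        | var y n =>
          by_cases h : y = x
          · exact ⟨n, h ▸ hD⟩
          · simp [h] at hne
        | func f d => simp at hne }
    {x | Ident.loc x ∈ X}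

/-- The initial configuration of the system-level semantics of `M`. -/
noncomputable def Mod.init (M : Mod) : SysCfg where
  N := Name.ident '' M.scope
  P := Name.ident '' M.header
  s := ⟨M.initStore Set.univ, FinPMap.empty⟩

/-! ## Semantic composition -/

/-- The names communicated to the outside, with the polarities of the continuation names. -/
structure Pub where
  names : Set Name
  polP : Set ℕ
  polS : Set ℕ

/-- States of the semantic composition. -/
structure Comp where
  left : Cfg
  right : Cfg
  pub : Pub
  aux : LStore

def Comp.swap (C : Comp) : Comp := ⟨C.right, C.left, C.pub, C.aux⟩

/-- The set of continuation names introduced by an action: `{k}` for calls, `∅` for returns. -/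
def Act.newCont : Act → Set ℕ
  | .call _ _ k => {k}
  | .ret _ _ => ∅

def Act.value : Act → Value
  | .call _ v _ => v
  | .ret v _ => v

def Act.cont : Act → ℕ
  | .call _ _ k => k
  | .ret _ k => k

/-- Names of an action apart from its continuation name. -/
def Act.dataNames : Act → Set Name
  | .call f v _ => {Name.fn f} ∪ v.names
  | .ret v _ => v.names

/-- The public names after an action of the Program, where `s` is the updated auxiliary store. -/
def Pub.updP (Q : Pub) (α : Act) (s : LStore) : Pub where
  names := {n | Cl s (α.value.names ∪ Q.names) n} ∪ Name.cont '' α.newCont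
  polP := Q.polP ∪ α.newCont
  polS := Q.polS

/-- The public names after an action of the System that supplies the store `s`, where `pr` is the
set of private names. -/
def Pub.updS (Q : Pub) (pr : Set Name) (α : Act) (s : LStore) : Pub where
  names := Q.names ∪ (α.value.names ∪ LStore.names (s.restrict (locs prᶜ))) ∪ Name.cont '' α.newCont
  polP := Q.polP
  polS := Q.polS ∪ α.newCont

/-- The conditions on an action of the System in a composite with public names `Q`, private names
`pr` and auxiliary store `s'`, where `s` is the store supplied: all public locations are in the
domain of `s`; the private locations have in `s` precisely the values that they have in `s'`; and
the action and the public part of `s` contain no private names. -/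
def SysUpd (Q : Pub) (pr : Set Name) (s' : LStore) (α : Act) (s : LStore) : Prop :=
  locs Q.names ⊆ s.dom ∧ (s'.restrict (locs Q.names)).dom ⊆ s.dom ∧
  (∀ a, Name.loc a ∉ Q.names → s'.get a ≠ none → s.get a = s'.get a) ∧
  (∀ a, Name.loc a ∈ pr → s.get a ≠ none → s'.get a ≠ none) ∧
  Disjoint (α.dataNames ∪ LStore.names (s.restrict (locs prᶜ))) pr

/-- The rules of semantic composition in which the left component moves first. -/
inductive StepL (M M' : Mod) : Comp → Label → Comp → Prop where
  | int {p p' σ Q s} (h : Step M (.prog p) .int (.prog p'))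
      (hn : p'.names ∩ σ.names ⊆ p.names) :
      StepL M M' ⟨.prog p, .sys σ, Q, s⟩ .int ⟨.prog p', .sys σ, Q, s⟩
  | crossCall {p σ σ' p' Q s' s f v k}
      (h : Step M (.prog p) (.ps (.call f v k) s) (.sys σ'))
      (h' : Step M' (.sys σ) (.sp (.call f v k) s) (.prog p'))
      (hk : Name.cont k ∉ σ.names) :
      StepL M M' ⟨.prog p, .sys σ, Q, s'⟩ .tau ⟨.sys σ', .prog p', Q, s'.override s⟩
  | crossRet {p σ σ' p' Q s' s v k}
      (h : Step M (.prog p) (.ps (.ret v k) s) (.sys σ'))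
      (h' : Step M' (.sys σ) (.sp (.ret v k) s) (.prog p')) :
      StepL M M' ⟨.prog p, .sys σ, Q, s'⟩ .tau ⟨.sys σ', .prog p', Q, s'.override s⟩
  | progCall {p σ σ' Q Q' s' s'' s f v k}
      (h : Step M (.prog p) (.ps (.call f v k) s) (.sys σ'))
      (h' : ∀ X, ¬ Step M' (.sys σ) (.sp (.call f v k) s) X)
      (hs : s'' = s'.override s) (hQ : Q' = Q.updP (.call f v k) s'')
      (hk : Name.cont k ∉ σ.names) :
      StepL M M' ⟨.prog p, .sys σ, Q, s'⟩
        (.ps (.call f v k) (s''.restrict (locs Q'.names))) ⟨.sys σ', .sys σ, Q', s''⟩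
  | progRet {p σ σ' Q Q' s' s'' s v k}
      (h : Step M (.prog p) (.ps (.ret v k) s) (.sys σ'))
      (h' : ∀ X, ¬ Step M' (.sys σ) (.sp (.ret v k) s) X)
      (hs : s'' = s'.override s) (hQ : Q' = Q.updP (.ret v k) s'') :
      StepL M M' ⟨.prog p, .sys σ, Q, s'⟩
        (.ps (.ret v k) (s''.restrict (locs Q'.names))) ⟨.sys σ', .sys σ, Q', s''⟩
  | sysCall {σ σ' p Q Q' s' s f v k} {pr : Set Name}
      (h : Step M (.sys σ) (.sp (.call f v k) s) (.prog p))
      (hpr : pr = (σ.names ∪ σ'.names) \ Q.names)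
      (hs : SysUpd Q pr s' (.call f v k) s) (hQ : Q' = Q.updS pr (.call f v k) s)
      (hk : Name.cont k ∉ σ'.names \ Name.cont '' Q.polS) :
      StepL M M' ⟨.sys σ, .sys σ', Q, s'⟩
        (.sp (.call f v k) (s.restrict (locs Q'.names))) ⟨.prog p, .sys σ', Q', s'.override s⟩
  | sysRet {σ σ' p Q Q' s' s v k} {pr : Set Name}
      (h : Step M (.sys σ) (.sp (.ret v k) s) (.prog p))
      (hpr : pr = (σ.names ∪ σ'.names) \ Q.names)
      (hs : SysUpd Q pr s' (.ret v k) s) (hQ : Q' = Q.updS pr (.ret v k) s)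
      (hk : Name.cont k ∉ σ'.names) :
      StepL M M' ⟨.sys σ, .sys σ', Q, s'⟩
        (.sp (.ret v k) (s.restrict (locs Q'.names))) ⟨.prog p, .sys σ', Q', s'.override s⟩

/-- The transitions of the semantic composition: the above rules and their symmetric
counterparts. -/
def CompStep (M M' : Mod) (C : Comp) (ℓ : Label) (C' : Comp) : Prop :=
  StepL M M' C ℓ C' ∨ StepL M' M C.swap ℓ C'.swap

/-- The initial state of the semantic composition. -/
noncomputable def compInit (M M' : Mod) : Comp where
  left := .sys M.init
  right := .sys M'.init
  pub := ⟨Name.ident '' (M.header ∪ M'.header), ∅, ∅⟩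
  aux := (M.initStore M.header).override (M'.initStore M'.header)

/-- The continuation names bound in a composite state: those that the two modules exchanged
between them for their mutual calls. -/
def Comp.bound (C : Comp) : Set Name :=
  {n | ∃ k, n = .cont k ∧ n ∈ C.left.pub ∩ C.right.pub ∧ k ∉ C.pub.polS}

/-! ## Bisimilarity -/

/-- Labelled transition systems whose states have public names and bound names, with an initial
state. -/
structure NLTS where
  State : Type
  step : State → Label → State → Prop
  pub : State → Set Name
  bound : State → Set Name
  init : State

namespace NLTS

/-- Sequences of `τ`-transitions. -/
def TauStar (L : NLTS) : L.State → L.State → Prop :=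
  Relation.ReflTransGen fun x y => L.step x .tau y

/-- Weak transitions `⇒ ℓ ⇒`. -/
def Weak (L : NLTS) (x : L.State) (ℓ : Label) (y : L.State) : Prop :=
  ∃ x₁ y₁, L.TauStar x x₁ ∧ L.step x₁ ℓ y₁ ∧ L.TauStar y₁ y

/-- `R` is a simulation: related states have the same public names, `τ`-transitions are matched
by sequences of `τ`-transitions, and other transitions by weak transitions with the same label,
except for those that capture a bound name of the other state. -/
def IsSimulation (L L' : NLTS) (R : L.State → L'.State → Prop) : Prop :=
  ∀ x y, R x y →
    L.pub x = L'.pub y ∧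
    (∀ x', L.step x .tau x' → ∃ y', L'.TauStar y y' ∧ R x' y') ∧
    (∀ ℓ x', ℓ ≠ .tau → L.step x ℓ x' → Disjoint ℓ.names (L'.bound y) →
      ∃ y', L'.Weak y ℓ y' ∧ R x' y')

/-- A bisimulation is a simulation whose inverse is a simulation. -/
def IsBisimulation (L L' : NLTS) (R : L.State → L'.State → Prop) : Prop :=
  IsSimulation L L' R ∧ IsSimulation L' L (fun y x => R x y)

/-- Bisimilarity of the initial states. -/
def Bisimilar (L L' : NLTS) : Prop := ∃ R, IsBisimulation L L' R ∧ R L.init L'.init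

end NLTS

/-- The system-level semantics `⟦M⟧` of a module. -/
noncomputable def sem (M : Mod) : NLTS where
  State := Cfg
  step := Step M
  pub := Cfg.pub
  bound _ := ∅
  init := .sys M.init

/-- The semantic composition `⟦M⟧ ⊗ ⟦M'⟧`. -/
noncomputable def semComp (M M' : Mod) : NLTS where
  State := Comp
  step := CompStep M M'
  pub C := C.pub.names
  bound := Comp.bound
  init := compInit M M'

end SLS

namespace SLS

/-! ## Names -/

/-! A composite state can be glued into a state of the linked machine, and the calls and returns
between the two components leave the glued state unchanged. The relation `Rel` formed in this way is
the bisimulation.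

Control: at most one component is a program configuration `p`, and its term is the term of the
linked machine. The linked stack is `p.t ++ T`, where `T` is found by following the continuation
`p.k` alternately through the continuation stores of the two components until a continuation `K` of
the System is reached (`Unf`). A call between components moves frames from `p.t` into the unfolding
and a return moves them back, so `p.t ++ T` and `K` stay the same (`Ctl.crossCall`, `Ctl.crossRet`).

Store: the component in control holds current values for all locations that it knows, so the linked
store is its store, completed by that of the other component (`CtlLoc`). When control leaves a
component, the closure of its public names is emitted. This updates the other component, or, when
the System takes over, the auxiliary store, which then keeps the shared locations that are private
to the pair (`IdleLoc`). Locations public to the System need not be tracked meanwhile, since its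
next move supplies them all.

Names: a name known to both components is public in both, and the linked machine knows exactly the
identifiers known to one of them. It does not know the continuation names that the components
exchanged with each other; all other continuation names belong to the System or are saved by the
linked machine with their unfolding (`Half`, `Core`).

In one direction, a `τ` of the composite is answered by no move and every other transition by one
transition (`Rel.compStep`). In the other, the component in control may be about to return to or
call its partner, while the linked machine already makes the next visible or internal move. The
pending synchronisations are carried out first (`Ctl.normalize`): returns terminate by induction on
the unfolding, and a call is made at most once, since the callee defines the function. The
restriction on bound names is needed because the linked machine may choose a continuation name that
the components have already exchanged (`Ctl.weak_step`, `Rel.idle_call_left`).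

The bisimulation uses only the facts collected in `Linked`, which hold once hidden names do not
clash (`Mod.linked_append`). Renamings that achieve this exist by shifting hidden names out of range
(`exists_preventsClashes`). -/

@[simp] theorem Value.cont_notMem_names (v : Value) (k : ℕ) : Name.cont k ∉ Value.names v := by
  rintro ⟨a, -, h⟩
  cases a <;> simp [Atom.names] at h

@[simp] theorem LStore.cont_notMem_names (s : LStore) (k : ℕ) : Name.cont k ∉ LStore.names s := by
  rintro ⟨a, b, -, h | h⟩
  · simp at h
  · cases b <;> simp [Atom.names] at h

theorem Value.names_singleton (b : Atom) : Value.names [b] = b.names := by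
  ext n; simp [Value.names]

@[simp] theorem Value.names_nil : Value.names [] = ∅ := by
  ext n; simp [Value.names]

theorem Value.names_append (v w : Value) :
    Value.names (v ++ w) = Value.names v ∪ Value.names w := by
  ext n; simp only [Value.names, List.mem_append, Set.mem_ofPred_eq, Set.mem_union]
  constructor
  · rintro ⟨a, h | h, ha⟩
    · exact Or.inl ⟨a, h, ha⟩
    · exact Or.inr ⟨a, h, ha⟩
  · rintro (⟨a, h, ha⟩ | ⟨a, h, ha⟩)
    · exact ⟨a, Or.inl h, ha⟩
    · exact ⟨a, Or.inr h, ha⟩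

@[simp] theorem Stack.names_nil : Stack.names [] = ∅ := by
  ext n; simp [Stack.names]

theorem Stack.names_cons (F : Frame) (t : Stack) :
    Stack.names (F :: t) = F.names ∪ Stack.names t := by
  ext n; simp [Stack.names]

theorem BinOp.names_eval {op : BinOp} {a b c : Atom} (h : BinOp.eval op a b = some c) :
    c.names = ∅ := by
  cases op <;> cases a <;> cases b <;> simp [BinOp.eval, ofBool] at h <;>
    first
    | (subst h; rfl)
    | (obtain ⟨-, h⟩ := h; subst h; rfl)

theorem Term.names_subst (x : ℕ) (a : Atom) (e : Term) :
    (e.subst x a).names ⊆ e.names ∪ a.names := by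
  induction e with
  | var y =>
    unfold Term.subst
    split <;> simp [Term.names, Value.names_singleton]
  | val v => simp [Term.subst, Term.names]
  | new => simp [Term.subst, Term.names]
  | localVar y e ih =>
    unfold Term.subst
    split
    · exact Set.subset_union_left
    · exact ih
  | deref e ih => exact ih
  | ret e ih => exact ih
  | binop op e e' ih ih' =>
    simp only [Term.subst, Term.names]
    grind
  | assign e e' ih ih' => simp only [Term.subst, Term.names]; grind
  | seq e e' ih ih' => simp only [Term.subst, Term.names]; grind
  | app e e' ih ih' => simp only [Term.subst, Term.names]; grind
  | pair e e' ih ih' => simp only [Term.subst, Term.names]; grind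
  | ite e e' e'' ih ih' ih'' => simp only [Term.subst, Term.names]; grind

theorem Term.names_foldl_subst (l : List (ℕ × Atom)) (e : Term) (X : Set Name) (he : e.names ⊆ X)
    (hl : ∀ p ∈ l, p.2.names ⊆ X) :
    (l.foldl (fun e p => e.subst p.1 p.2) e).names ⊆ X := by
  induction l generalizing e with
  | nil => exact he
  | cons p l ih =>
    refine ih _ ((Term.names_subst _ _ _).trans (Set.union_subset he (hl p (by simp)))) ?_
    exact fun q hq => hl q (by simp [hq])

theorem Func.names_inst {d : Func} {v : Value} {e : Term} (h : d.inst v = some e) :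
    e.names ⊆ d.term.names ∪ v.names := by
  unfold Func.inst at h
  split at h
  · cases h
    refine Term.names_foldl_subst _ _ _ Set.subset_union_left ?_
    intro p hp n hn
    exact Or.inr ⟨p.2, (List.of_mem_zip hp).2, hn⟩
  · cases h

/-! ## Finite partial maps -/

namespace FinPMap

variable {β : Type}

@[simp] theorem get_override (s s' : FinPMap β) (n : ℕ) :
    (s.override s').get n = (s'.get n).or (s.get n) := rfl

theorem get_set (s : FinPMap β) (n m : ℕ) (b : β) :
    (s.set n b).get m = if m = n then some b else s.get m := rfl

open Classical in
theorem get_restrict (s : FinPMap β) (X : Set ℕ) (n : ℕ) :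
    (s.restrict X).get n = if n ∈ X then s.get n else none := rfl

theorem get_restrict_of_mem (s : FinPMap β) {X : Set ℕ} {n : ℕ} (h : n ∈ X) :
    (s.restrict X).get n = s.get n := if_pos h

theorem get_restrict_of_notMem (s : FinPMap β) {X : Set ℕ} {n : ℕ} (h : n ∉ X) :
    (s.restrict X).get n = none := if_neg h

@[simp] theorem mem_dom (s : FinPMap β) (n : ℕ) : n ∈ s.dom ↔ s.get n ≠ none := Iff.rfl

end FinPMap

@[simp] theorem mem_locs (X : Set Name) (a : ℕ) : a ∈ locs X ↔ Name.loc a ∈ X := Iff.rfl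

theorem LStore.loc_mem_names {s : LStore} {a : ℕ} (h : s.get a ≠ none) :
    Name.loc a ∈ LStore.names s := by
  obtain ⟨b, hb⟩ := Option.ne_none_iff_exists'.1 h
  exact ⟨a, b, hb, Or.inl rfl⟩

theorem LStore.names_override (s s' : LStore) :
    LStore.names (s.override s') ⊆ LStore.names s ∪ LStore.names s' := by
  rintro n ⟨a, b, h, hn⟩
  rw [FinPMap.get_override] at h
  cases h' : s'.get a with
  | none => rw [h'] at h; exact Or.inl ⟨a, b, h, hn⟩
  | some c => rw [h'] at h; cases h; exact Or.inr ⟨a, _, h', hn⟩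

theorem LStore.names_restrict (s : LStore) (X : Set ℕ) :
    LStore.names (s.restrict X) ⊆ LStore.names s := by
  rintro n ⟨a, b, h, hn⟩
  rw [FinPMap.get_restrict] at h
  split at h
  · exact ⟨a, b, h, hn⟩
  · cases h

theorem LStore.names_set (s : LStore) (a : ℕ) (b : Atom) :
    LStore.names (s.set a b) ⊆ LStore.names s ∪ ({Name.loc a} ∪ b.names) := by
  rintro n ⟨c, d, h, hn⟩
  rw [FinPMap.get_set] at h
  split at h
  · cases h
    subst c
    exact Or.inr hn
  · exact Or.inl ⟨c, d, h, hn⟩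

theorem Store.names_setLoc (s : Store) (a : ℕ) (b : Atom) :
    (s.setLoc a b).names ⊆ s.names ∪ ({Name.loc a} ∪ b.names) := by
  rintro n (h | h)
  · rcases LStore.names_set _ _ _ h with h | h
    · exact Or.inl (Or.inl h)
    · exact Or.inr h
  · exact Or.inl (Or.inr h)

theorem Store.names_override (s : Store) (s' : LStore) :
    (s.override s').names ⊆ s.names ∪ LStore.names s' := by
  rintro n (h | h)
  · rcases LStore.names_override _ _ h with h | h
    · exact Or.inl (Or.inl h)
    · exact Or.inr h
  · exact Or.inl (Or.inr h)

theorem Store.names_setCont (s : Store) (k : ℕ) (c : Stack × ℕ) :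
    (s.setCont k c).names ⊆ s.names ∪ ({Name.cont k, Name.cont c.2} ∪ Stack.names c.1) := by
  rintro n (h | ⟨k', t, k₁, h, hn⟩)
  · exact Or.inl (Or.inl h)
  · simp only [Store.setCont, FinPMap.get_set] at h
    split at h
    · cases h
      subst k'
      grind
    · exact Or.inl (Or.inr ⟨k', t, k₁, h, hn⟩)

theorem Store.cont_mem_names {s : Store} {k : ℕ} (h : s.cont.get k ≠ none) :
    Name.cont k ∈ s.names := by
  obtain ⟨⟨t, k'⟩, hb⟩ := Option.ne_none_iff_exists'.1 h
  exact Or.inr ⟨k, t, k', hb, Or.inl rfl⟩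

/-! ## Closures -/

theorem Cl.subset_of_closed {s : LStore} {X Y : Set Name} (hX : X ⊆ Y)
    (hY : ∀ a b, Name.loc a ∈ Y → s.get a = some b → b.names ⊆ Y) {n : Name} (hn : Cl s X n) :
    n ∈ Y := by
  induction hn with
  | base h' => exact hX h'
  | step _ hs hn ih => exact hY _ _ ih hs hn

theorem Cl.names_restrict_subset (s : LStore) (X : Set Name) :
    LStore.names (s.restrict (locs {n | Cl s X n})) ⊆ {n | Cl s X n} := by
  rintro n ⟨a, b, h, hn⟩
  rw [FinPMap.get_restrict] at h
  split at h
  · next ha =>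
    rcases hn with rfl | hn
    · exact ha
    · exact Cl.step ha h hn
  · cases h

/-- Stores that agree on a set containing the closure yield the same closure. -/
theorem Cl.congr {s s' : LStore} {X Y : Set Name} (hX : X ⊆ Y)
    (hY : ∀ a b, Name.loc a ∈ Y → s.get a = some b → b.names ⊆ Y)
    (hs : ∀ a, Name.loc a ∈ Y → s.get a = s'.get a) (n : Name) : Cl s X n ↔ Cl s' X n := by
  constructor
  · intro hn
    induction hn with
    | base h => exact .base h
    | step h h' hn ih => exact .step ih ((hs _ (Cl.subset_of_closed hX hY h)).symm.trans h') hn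
  · intro hn
    induction hn with
    | base h => exact .base h
    | step h h' hn ih => exact .step ih ((hs _ (Cl.subset_of_closed hX hY ih)).trans h') hn

/-! ## Unfolding of continuations -/

/-- `Unf κ κ' S k T K`: the continuation `k`, held by the module with continuation store `κ`,
stands for the frame stack `T` followed by the continuation `K ∈ S` of the System. Continuations
outside `S` are resolved in the continuation stores of the two modules in turn. -/
inductive Unf (S : Set ℕ) :
    (ℕ → Option (Stack × ℕ)) → (ℕ → Option (Stack × ℕ)) → ℕ → Stack → ℕ → Prop where
  | base {κ κ' k} (h : k ∈ S) : Unf S κ κ' k [] k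
  | step {κ κ' k t k₁ T K} (h : κ' k = some (t, k₁)) (h' : Unf S κ' κ k₁ T K) :
      Unf S κ κ' k (t ++ T) K

theorem Unf.cases' {S κ κ' k T K} (h : Unf S κ κ' k T K) :
    (k ∈ S ∧ T = [] ∧ K = k) ∨
      ∃ t k₁ T', κ' k = some (t, k₁) ∧ T = t ++ T' ∧ Unf S κ' κ k₁ T' K := by
  cases h with
  | base h => exact Or.inl ⟨h, rfl, rfl⟩
  | step h h' => exact Or.inr ⟨_, _, _, h, rfl, h'⟩

/-- Unfolding only looks continuations up, so it survives extensions of the stores and of `S`. The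
two extension hypotheses swap in the induction because the modules alternate. -/
theorem Unf.mono {S S' κ κ' k T K κ₁ κ₁'} (h : Unf S κ κ' k T K) (hS : S ⊆ S')
    (hκ : ∀ k c, κ k = some c → κ₁ k = some c) (hκ' : ∀ k c, κ' k = some c → κ₁' k = some c) :
    Unf S' κ₁ κ₁' k T K := by
  induction h generalizing κ₁ κ₁' with
  | base h => exact .base (hS h)
  | step h _ ih => exact .step (hκ' _ _ h) (ih hκ' hκ)

/-! ## Invariants of names and continuations -/

/-- Invariant of one component `σ` with scope `X` of a composite state whose other component
is `σ'`: `S` are the continuations of the System, `cA` is the continuation store of the linked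
module. -/
structure Half (X : Set Name) (S : Set ℕ) (cA : FinPMap (Stack × ℕ)) (σ σ' : SysCfg) : Prop where
  scope : X ⊆ σ.N
  pub : σ.P ⊆ σ.N
  store : σ.s.names ⊆ σ.N
  contPub : ∀ k, Name.cont k ∈ σ.N → Name.cont k ∈ σ.P
  -- Public locations are refreshed whenever control comes back; all others must already be stored.
  locDom : ∀ a, Name.loc a ∈ σ.N → Name.loc a ∈ σ.P ∨ σ.s.loc.get a ≠ none
  share : ∀ n ∈ σ.N, n ∈ σ'.N → n ∈ σ.P
  pol : ∀ k ∈ S, σ.s.cont.get k = none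
  fin : {k | Name.cont k ∈ σ.N}.Finite
  -- A continuation name is the System's, or saved by the linked machine, or exchanged between the
  -- components.
  split : ∀ k, Name.cont k ∈ σ.N → k ∈ S ∨ cA.get k ≠ none ∨ (Name.cont k ∈ σ'.N ∧ k ∉ S)
  -- Names that `σ'` also knows have no counterpart in the linked machine. The others are saved
  -- there, with the stack completed by the unfolding.
  conts : ∀ k t k₁, σ.s.cont.get k = some (t, k₁) → Name.cont k ∉ σ'.N →
    ∃ T K, cA.get k = some (t ++ T, K) ∧ Unf S σ.s.cont.get σ'.s.cont.get k₁ T K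

/-- Invariant relating the components `σ`, `σ'` of a composite state with public names `Q` to a
state of the linked module with used names `NA` and continuation store `cA`. -/
structure Core (X X' : Set Name) (S : Set ℕ) (NA : Set Name) (cA : FinPMap (Stack × ℕ))
    (Q : Set Name) (σ σ' : SysCfg) : Prop where
  left : Half X S cA σ σ'
  right : Half X' S cA σ' σ
  pubSub : Q ⊆ σ.P ∪ σ'.P
  ident : ∀ i, Name.ident i ∈ NA ↔ Name.ident i ∈ σ.N ∨ Name.ident i ∈ σ'.N
  contUsed : ∀ k, Name.cont k ∈ NA → Name.cont k ∈ σ.N ∨ Name.cont k ∈ σ'.N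
  -- Exchanged continuation names stay unknown to the linked machine.
  contNA : ∀ k, Name.cont k ∈ NA ↔ k ∈ S ∨ cA.get k ≠ none
  saved : ∀ k, cA.get k ≠ none → (σ.s.cont.get k ≠ none ∧ Name.cont k ∉ σ'.N) ∨
    (σ'.s.cont.get k ≠ none ∧ Name.cont k ∉ σ.N)

/-- Side conditions of the composition rules mention all names occurring in a configuration; this
reduces them to conditions on `N`. -/
theorem Half.names_eq {X S cA σ σ'} (h : Half X S cA σ σ') : σ.names = σ.N := by
  unfold SysCfg.names
  rw [Set.union_eq_left.2 h.pub, Set.union_eq_left.2 h.store]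

theorem Half.cont_mem {X S cA σ σ'} (h : Half X S cA σ σ') {k : ℕ}
    (hk : σ.s.cont.get k ≠ none) : Name.cont k ∈ σ.N :=
  h.store (Store.cont_mem_names hk)

theorem Half.loc_mem {X S cA σ σ'} (h : Half X S cA σ σ') {a : ℕ}
    (ha : σ.s.loc.get a ≠ none) : Name.loc a ∈ σ.N :=
  h.store (Or.inl (LStore.loc_mem_names ha))

theorem Half.atom_names {X S cA σ σ'} (h : Half X S cA σ σ') {a : ℕ} {b : Atom}
    (ha : σ.s.loc.get a = some b) : b.names ⊆ σ.N :=
  fun _ hn => h.store (Or.inl ⟨a, b, ha, Or.inr hn⟩)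

/-- The configuration `σ` with public names `P`. -/
def SysCfg.publish (σ : SysCfg) (P : Set Name) : SysCfg := ⟨σ.N, P, σ.s⟩

/-- The configuration `σ` after receiving the names `Z` and the store `s`. -/
def SysCfg.learn (σ : SysCfg) (Z : Set Name) (s : LStore) : SysCfg :=
  ⟨σ.N ∪ Z, σ.P ∪ Z, σ.s.override s⟩

/-- The configuration `σ` after receiving the continuation name `k`. -/
def SysCfg.addCont (σ : SysCfg) (k : ℕ) : SysCfg :=
  ⟨σ.N ∪ {Name.cont k}, σ.P ∪ {Name.cont k}, σ.s⟩

/-- The configuration `σ` after saving `c` under the continuation name `k`. -/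
def SysCfg.save (σ : SysCfg) (k : ℕ) (c : Stack × ℕ) : SysCfg :=
  ⟨σ.N ∪ {Name.cont k}, σ.P ∪ {Name.cont k}, σ.s.setCont k c⟩

namespace Core

variable {X X' : Set Name} {S : Set ℕ} {NA : Set Name} {cA : FinPMap (Stack × ℕ)}
  {Q : Set Name} {σ σ' : SysCfg}

theorem symm (h : Core X X' S NA cA Q σ σ') : Core X' X S NA cA Q σ' σ where
  left := h.right
  right := h.left
  pubSub := by rw [Set.union_comm]; exact h.pubSub
  ident i := by rw [or_comm]; exact h.ident i
  contUsed k hk := (h.contUsed k hk).symm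
  contNA := h.contNA
  saved k hk := (h.saved k hk).symm

theorem publish (h : Core X X' S NA cA Q σ σ') {P : Set Name} (hP : σ.P ⊆ P) (hN : P ⊆ σ.N) :
    Core X X' S NA cA Q (σ.publish P) σ' where
  left :=
    { h.left with
      pub := hN
      contPub := fun k hk => hP (h.left.contPub k hk)
      locDom := fun a ha => (h.left.locDom a ha).imp_left (@hP _)
      share := fun n hn hn' => hP (h.left.share n hn hn') }
  right := { h.right with }
  pubSub := h.pubSub.trans (Set.union_subset_union_left _ hP)
  ident := h.ident
  contUsed := h.contUsed
  contNA := h.contNA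
  saved := h.saved

theorem setPub (h : Core X X' S NA cA Q σ σ') {Q' : Set Name} (hQ : Q' ⊆ σ.P ∪ σ'.P) :
    Core X X' S NA cA Q' σ σ' :=
  { h with pubSub := hQ }

/-- Shared names stay public on both sides because `σ'` has already published those received names
that it knows. Values and location stores contain no continuation names, so the continuation
invariants are unaffected. -/
theorem learn (h : Core X X' S NA cA Q σ σ') {Z NA' : Set Name} {s : LStore}
    (hZ : ∀ k, Name.cont k ∉ Z) (hZP : ∀ n ∈ Z, n ∈ σ'.N → n ∈ σ'.P) (hs : LStore.names s ⊆ Z)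
    (hi : ∀ i, Name.ident i ∈ NA' ↔ Name.ident i ∈ NA ∨ Name.ident i ∈ Z)
    (hc : ∀ k, Name.cont k ∈ NA' ↔ Name.cont k ∈ NA) :
    Core X X' S NA' cA Q (σ.learn Z s) σ' where
  left :=
    { scope := h.left.scope.trans Set.subset_union_left
      pub := Set.union_subset_union_left _ h.left.pub
      store := (Store.names_override _ _).trans (Set.union_subset_union h.left.store hs)
      contPub := fun k hk => Or.inl (h.left.contPub k (hk.resolve_right (hZ k)))
      locDom := by
        rintro a (ha | ha)
        · rcases h.left.locDom a ha with h' | h'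
          · exact Or.inl (Or.inl h')
          · refine Or.inr ?_
            simp only [SysCfg.learn, Store.override, FinPMap.get_override]
            cases s.get a <;> simp [h']
        · exact Or.inl (Or.inr ha)
      share := by
        rintro n (hn | hn) hn'
        · exact Or.inl (h.left.share n hn hn')
        · exact Or.inr hn
      pol := h.left.pol
      fin := h.left.fin.subset fun k hk => hk.resolve_right (hZ k)
      split := fun k hk => h.left.split k (hk.resolve_right (hZ k))
      conts := h.left.conts }
  right :=
    { h.right with
      share := by
        rintro n hn (hn' | hn')
        · exact h.right.share n hn hn'
        · exact hZP n hn' hn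
      split := fun k hk => (h.right.split k hk).imp_right
        fun h' => h'.imp_right fun h'' => ⟨Or.inl h''.1, h''.2⟩
      conts := fun k t k₁ hk hk' => h.right.conts k t k₁ hk fun h' => hk' (Or.inl h') }
  pubSub := h.pubSub.trans (Set.union_subset_union_left _ Set.subset_union_left)
  ident i := by
    rw [hi, h.ident]
    simp only [SysCfg.learn, Set.mem_union]
    tauto
  contUsed k hk := ((h.contUsed k ((hc k).1 hk))).imp_left Or.inl
  contNA k := (hc k).trans (h.contNA k)
  saved k hk := (h.saved k hk).imp_right fun h' =>
    ⟨h'.1, fun h'' => h'.2 (h''.resolve_right (hZ k))⟩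

theorem get_cont_setCont {s : Store} {k : ℕ} (hk : s.cont.get k = none) (c : Stack × ℕ) :
    ∀ k' c', s.cont.get k' = some c' → (s.setCont k c).cont.get k' = some c' := by
  intro k' c' h
  simp only [Store.setCont, FinPMap.get_set]
  rw [if_neg]
  · exact h
  · rintro rfl
    simp [hk] at h

theorem fin_insert {N : Set Name} (h : {k | Name.cont k ∈ N}.Finite) (k : ℕ) :
    {k' | Name.cont k' ∈ N ∪ {Name.cont k}}.Finite := by
  refine (h.insert k).subset ?_
  rintro k' (hk | hk)
  · exact Or.inr hk
  · left; simpa using hk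

/-- The component `σ` saves its continuation and hands its name to `σ'`. -/
theorem exchange (h : Core X X' S NA cA Q σ σ') {k k₀ : ℕ} {t : Stack} (hk : Name.cont k ∉ σ.N)
    (hk' : Name.cont k ∉ σ'.N) (hk₀ : Name.cont k₀ ∈ σ.N) (ht : Stack.names t ⊆ σ.N) :
    Core X X' S NA cA Q (σ.save k (t, k₀)) (σ'.addCont k) := by
  -- A name new to both components is new to the linked machine too, so it is neither the System's
  -- nor saved there.
  have hS : k ∉ S := fun hS => (h.contUsed k ((h.contNA k).2 (Or.inl hS))).elim hk hk'
  have hA : cA.get k = none := by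
    by_contra hA
    exact (h.contUsed k ((h.contNA k).2 (Or.inr hA))).elim hk hk'
  have hσ : σ.s.cont.get k = none := by
    by_contra hc
    exact hk (h.left.cont_mem hc)
  have hext := get_cont_setCont hσ (t, k₀)
  refine ⟨?_, ?_, ?_, ?_, ?_, h.contNA, ?_⟩
  · refine ⟨h.left.scope.trans Set.subset_union_left, Set.union_subset_union_left _ h.left.pub,
      ?_, ?_, ?_, ?_, ?_, fin_insert h.left.fin k, ?_, ?_⟩
    · refine (Store.names_setCont _ _ _).trans ?_
      have := h.left.store
      simp only [SysCfg.save]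
      grind
    · rintro k' (h' | h')
      · exact Or.inl (h.left.contPub _ h')
      · exact Or.inr h'
    · rintro a (h' | h')
      · exact (h.left.locDom _ h').imp_left Or.inl
      · simp at h'
    · rintro n (h₁ | h₁) (h₂ | h₂)
      · exact Or.inl (h.left.share _ h₁ h₂)
      all_goals right; assumption
    · intro k' h'
      have : k' ≠ k := fun e => hS (e ▸ h')
      simp [SysCfg.save, Store.setCont, FinPMap.get_set, this, h.left.pol k' h']
    · rintro k' (h' | h')
      · exact (h.left.split k' h').imp_right fun a => a.imp_right fun b => ⟨Or.inl b.1, b.2⟩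
      · cases h'
        exact Or.inr (Or.inr ⟨Or.inr rfl, hS⟩)
    · intro k' t' k₁ h₁ h₂
      -- The new name is now shared, and `conts` concerns unshared names only.
      have hne : k' ≠ k := fun e => h₂ (Or.inr (by rw [e]; rfl))
      simp only [SysCfg.save, Store.setCont, FinPMap.get_set, hne, if_false] at h₁
      obtain ⟨T, K, h₃, h₄⟩ := h.left.conts k' t' k₁ h₁ fun h' => h₂ (Or.inl h')
      exact ⟨T, K, h₃, h₄.mono subset_rfl hext fun _ _ => id⟩
  · refine ⟨h.right.scope.trans Set.subset_union_left, Set.union_subset_union_left _ h.right.pub,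
      h.right.store.trans Set.subset_union_left, ?_, ?_, ?_, h.right.pol,
      fin_insert h.right.fin k, ?_, ?_⟩
    · rintro k' (h' | h')
      · exact Or.inl (h.right.contPub _ h')
      · exact Or.inr h'
    · rintro a (h' | h')
      · exact (h.right.locDom _ h').imp_left Or.inl
      · simp at h'
    · rintro n (h₁ | h₁) (h₂ | h₂)
      · exact Or.inl (h.right.share _ h₁ h₂)
      all_goals right; assumption
    · rintro k' (h' | h')
      · exact (h.right.split k' h').imp_right fun a => a.imp_right fun b => ⟨Or.inl b.1, b.2⟩
      · cases h'
        exact Or.inr (Or.inr ⟨Or.inr rfl, hS⟩)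
    · intro k' t' k₁ h₁ h₂
      obtain ⟨T, K, h₃, h₄⟩ := h.right.conts k' t' k₁ h₁ fun h' => h₂ (Or.inl h')
      exact ⟨T, K, h₃, h₄.mono subset_rfl (fun _ _ => id) hext⟩
  · exact h.pubSub.trans (Set.union_subset_union Set.subset_union_left Set.subset_union_left)
  · intro i
    simp [SysCfg.save, SysCfg.addCont, h.ident]
  · exact fun k' h' => (h.contUsed k' h').imp Or.inl Or.inl
  · intro k' h'
    have hne : k' ≠ k := fun e => h' (e ▸ hA)
    simpa [SysCfg.save, SysCfg.addCont, Store.setCont, FinPMap.get_set, hne] using h.saved k' h'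

/-- The component `σ` saves its continuation and hands its name to the System. -/
theorem release (h : Core X X' S NA cA Q σ σ') {k k₀ K : ℕ} {t T : Stack}
    (hk : Name.cont k ∉ σ.N)
    (hk' : Name.cont k ∉ σ'.N) (hk₀ : Name.cont k₀ ∈ σ.N) (ht : Stack.names t ⊆ σ.N)
    (hU : Unf S σ.s.cont.get σ'.s.cont.get k₀ T K) :
    Core X X' S (NA ∪ {Name.cont k}) (cA.set k (t ++ T, K)) (Q ∪ {Name.cont k})
      (σ.save k (t, k₀)) σ' := by
  have hS : k ∉ S := fun hS => (h.contUsed k ((h.contNA k).2 (Or.inl hS))).elim hk hk'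
  have hσ : σ.s.cont.get k = none := by
    by_contra hc
    exact hk (h.left.cont_mem hc)
  have hext := get_cont_setCont hσ (t, k₀)
  refine ⟨?_, ?_, ?_, ?_, ?_, ?_, ?_⟩
  · refine ⟨h.left.scope.trans Set.subset_union_left, Set.union_subset_union_left _ h.left.pub,
      ?_, ?_, ?_, ?_, ?_, fin_insert h.left.fin k, ?_, ?_⟩
    · refine (Store.names_setCont _ _ _).trans ?_
      have := h.left.store
      simp only [SysCfg.save]
      grind
    · rintro k' (h' | h')
      · exact Or.inl (h.left.contPub _ h')
      · exact Or.inr h'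
    · rintro a (h' | h')
      · exact (h.left.locDom _ h').imp_left Or.inl
      · simp at h'
    · rintro n (h₁ | h₁) h₂
      · exact Or.inl (h.left.share _ h₁ h₂)
      all_goals right; assumption
    · intro k' h'
      have : k' ≠ k := fun e => hS (e ▸ h')
      simp [SysCfg.save, Store.setCont, FinPMap.get_set, this, h.left.pol k' h']
    · intro k' h'
      by_cases hne : k' = k
      · subst hne; simp [FinPMap.get_set]
      · simp only [FinPMap.get_set, hne, if_false]
        exact h.left.split k' (h'.resolve_right (by simpa using hne))
    · intro k' t' k₁ h₁ h₂
      by_cases hne : k' = k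
      · subst hne
        simp only [SysCfg.save, Store.setCont, FinPMap.get_set, if_true] at h₁
        cases h₁
        -- The entry of the linked store was defined as `t` followed by the unfolding of `k₀`.
        exact ⟨T, K, by simp [FinPMap.get_set], hU.mono subset_rfl hext fun _ _ => id⟩
      · simp only [SysCfg.save, Store.setCont, FinPMap.get_set, hne, if_false] at h₁
        obtain ⟨T, K, h₃, h₄⟩ := h.left.conts k' t' k₁ h₁ h₂
        exact ⟨T, K, by simpa [FinPMap.get_set, hne] using h₃,
          h₄.mono subset_rfl hext fun _ _ => id⟩
  · refine { h.right with share := ?_, split := ?_, conts := ?_ }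
    · rintro n h₁ (h₂ | h₂)
      · exact h.right.share _ h₁ h₂
      · cases h₂; exact absurd h₁ hk'
    · intro k' h'
      have hne : k' ≠ k := fun e => hk' (e ▸ h')
      simp only [FinPMap.get_set, hne, if_false]
      exact (h.right.split k' h').imp_right fun a => a.imp_right fun b => ⟨Or.inl b.1, b.2⟩
    · intro k' t' k₁ h₁ h₂
      have hne : k' ≠ k := fun e => h₂ (Or.inr (by rw [e]; rfl))
      obtain ⟨T, K, h₃, h₄⟩ := h.right.conts k' t' k₁ h₁ fun h' => h₂ (Or.inl h')
      exact ⟨T, K, by simpa [FinPMap.get_set, hne] using h₃,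
        h₄.mono subset_rfl (fun _ _ => id) hext⟩
  · have := h.pubSub
    simp only [SysCfg.save]
    grind
  · intro i
    simp [SysCfg.save, h.ident]
  · rintro k' (h' | h')
    · exact (h.contUsed k' h').imp_left Or.inl
    · exact Or.inl (Or.inr h')
  · intro k'
    have := h.contNA k'
    by_cases hne : k' = k
    · simp [hne, FinPMap.get_set]
    · simpa [hne, FinPMap.get_set] using this
  · intro k' h'
    by_cases hne : k' = k
    · subst hne
      exact Or.inl ⟨by simp [SysCfg.save, Store.setCont, FinPMap.get_set], hk'⟩
    · simp only [FinPMap.get_set, hne, if_false] at h'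
      simpa [SysCfg.save, Store.setCont, FinPMap.get_set, hne] using h.saved k' h'

/-- The component `σ` receives a continuation name from the System. -/
theorem receive (h : Core X X' S NA cA Q σ σ') {k : ℕ} (hk : σ.s.cont.get k = none)
    (hk' : Name.cont k ∈ σ'.N → k ∈ S) :
    Core X X' (S ∪ {k}) (NA ∪ {Name.cont k}) cA (Q ∪ {Name.cont k}) (σ.addCont k) σ' := by
  -- The System may reuse one of its own continuation names, and such names are saved by no
  -- component.
  have hσ' : σ'.s.cont.get k = none := by
    by_contra hc
    exact hc (h.right.pol k (hk' (h.right.cont_mem hc)))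
  have hA : cA.get k = none := by
    by_contra hc
    rcases h.saved k hc with h' | h'
    · exact h'.1 hk
    · exact h'.1 hσ'
  have hb : Name.cont k ∈ σ.N → Name.cont k ∈ σ'.N → k ∈ S := fun _ h' => hk' h'
  refine ⟨?_, ?_, ?_, ?_, ?_, ?_, ?_⟩
  · refine ⟨h.left.scope.trans Set.subset_union_left, Set.union_subset_union_left _ h.left.pub,
      h.left.store.trans Set.subset_union_left, ?_, ?_, ?_, ?_, fin_insert h.left.fin k, ?_, ?_⟩
    · rintro k' (h' | h')
      · exact Or.inl (h.left.contPub _ h')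
      · exact Or.inr h'
    · rintro a (h' | h')
      · exact (h.left.locDom _ h').imp_left Or.inl
      · simp at h'
    · rintro n (h₁ | h₁) h₂
      · exact Or.inl (h.left.share _ h₁ h₂)
      all_goals right; assumption
    · rintro k' (h' | rfl)
      · exact h.left.pol k' h'
      · exact hk
    · intro k' h'
      by_cases hne : k' = k
      · exact Or.inl (Or.inr hne)
      · have := h.left.split k' (h'.resolve_right (by simpa using hne))
        simpa [hne] using this
    · intro k' t' k₁ h₁ h₂
      obtain ⟨T, K, h₃, h₄⟩ := h.left.conts k' t' k₁ h₁ h₂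
      exact ⟨T, K, h₃, h₄.mono Set.subset_union_left (fun _ _ => id) fun _ _ => id⟩
  · refine { h.right with share := ?_, pol := ?_, split := ?_, conts := ?_ }
    · rintro n h₁ (h₂ | h₂)
      · exact h.right.share _ h₁ h₂
      · cases h₂; exact h.right.contPub _ h₁
    · rintro k' (h' | rfl)
      · exact h.right.pol k' h'
      · exact hσ'
    · intro k' h'
      by_cases hne : k' = k
      · exact Or.inl (Or.inr hne)
      · have := h.right.split k' h'
        simpa [hne, SysCfg.addCont] using this
    · intro k' t' k₁ h₁ h₂
      obtain ⟨T, K, h₃, h₄⟩ := h.right.conts k' t' k₁ h₁ fun h' => h₂ (Or.inl h')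
      exact ⟨T, K, h₃, h₄.mono Set.subset_union_left (fun _ _ => id) fun _ _ => id⟩
  · have := h.pubSub
    simp only [SysCfg.addCont]
    grind
  · intro i
    simp [SysCfg.addCont, h.ident]
  · rintro k' (h' | h')
    · exact (h.contUsed k' h').imp_left Or.inl
    · exact Or.inl (Or.inr h')
  · intro k'
    have := h.contNA k'
    by_cases hne : k' = k
    · simp [hne]
    · simpa [hne] using this
  · intro k' h'
    have hne : k' ≠ k := fun e => h' (e ▸ hA)
    simpa [SysCfg.addCont, hne] using h.saved k' h'

end Core

/-! ## Invariants of stores -/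

/-- The component `σ` has control; `lA` is the store of the linked module. -/
structure CtlLoc (σ σ' : SysCfg) (lA : LStore) (Q : Set Name) (aux : LStore) : Prop where
  -- Ensures that emitted stores are defined on the whole closure and that the values of `σ` take
  -- precedence in `loc`.
  dom : ∀ a, Name.loc a ∈ σ.N → σ.s.loc.get a ≠ none
  pub : ∀ a, Name.loc a ∈ σ'.P → Name.loc a ∈ σ.P
  auxPub : ∀ a, aux.get a ≠ none → Name.loc a ∈ σ.P
  pubQ : ∀ a, Name.loc a ∈ Q → Name.loc a ∈ σ.P
  loc : ∀ a, lA.get a = (σ.s.loc.get a).or (σ'.s.loc.get a)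

/-- The System has control; `lA` is the store of the linked module. -/
structure IdleLoc (σ σ' : SysCfg) (lA : LStore) (Q : Set Name) (aux : LStore) : Prop where
  auxN : LStore.names aux ⊆ σ.N ∪ σ'.N
  auxL : ∀ n ∈ LStore.names aux, n ∈ σ.N → n ∈ σ.P
  auxR : ∀ n ∈ LStore.names aux, n ∈ σ'.N → n ∈ σ'.P
  pubL : ∀ a, Name.loc a ∈ σ.P → Name.loc a ∈ Q ∨ aux.get a ≠ none
  pubR : ∀ a, Name.loc a ∈ σ'.P → Name.loc a ∈ Q ∨ aux.get a ≠ none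
  closed : ∀ a, Name.loc a ∈ LStore.names aux → Name.loc a ∈ Q ∨ aux.get a ≠ none
  -- Nothing is required on `Q`, because the next move of the System overwrites all of its
  -- locations.
  loc : ∀ a, Name.loc a ∉ Q →
    lA.get a = (aux.get a).or ((σ.s.loc.get a).or (σ'.s.loc.get a))

section

variable {X X' : Set Name} {S : Set ℕ} {NA : Set Name} {cA : FinPMap (Stack × ℕ)}
  {Q : Set Name} {σ σ' : SysCfg} {lA aux : LStore}

/-- The order of the two stores matters only at locations stored by both. These are shared, hence
public, so outside `Q` the auxiliary store decides their value. -/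
theorem IdleLoc.symm (hc : Core X X' S NA cA Q σ σ') (h : IdleLoc σ σ' lA Q aux) :
    IdleLoc σ' σ lA Q aux where
  auxN := by rw [Set.union_comm]; exact h.auxN
  auxL := h.auxR
  auxR := h.auxL
  pubL := h.pubR
  pubR := h.pubL
  closed := h.closed
  loc a ha := by
    rw [h.loc a ha]
    cases h₀ : aux.get a with
    | some b => rfl
    | none =>
      by_cases h₁ : σ.s.loc.get a = none
      · simp [h₁]
      · by_cases h₂ : σ'.s.loc.get a = none
        · simp [h₂]
        · have := h.pubL a (hc.left.share _ (hc.left.loc_mem h₁) (hc.right.loc_mem h₂))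
          simp [ha, h₀] at this

theorem CtlLoc.congr {σ₁ σ₁' : SysCfg} {Q' : Set Name} (h : CtlLoc σ σ' lA Q aux)
    (hN : ∀ a, Name.loc a ∈ σ₁.N → Name.loc a ∈ σ.N)
    (hP : ∀ a, Name.loc a ∈ σ₁.P ↔ Name.loc a ∈ σ.P)
    (hP' : ∀ a, Name.loc a ∈ σ₁'.P → Name.loc a ∈ σ'.P) (hs : σ₁.s.loc = σ.s.loc)
    (hs' : σ₁'.s.loc = σ'.s.loc) (hQ : ∀ a, Name.loc a ∈ Q' → Name.loc a ∈ Q) :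
    CtlLoc σ₁ σ₁' lA Q' aux where
  dom a ha := by rw [hs]; exact h.dom a (hN a ha)
  pub a ha := (hP a).2 (h.pub a (hP' a ha))
  auxPub a ha := (hP a).2 (h.auxPub a ha)
  pubQ a ha := (hP a).2 (h.pubQ a (hQ a ha))
  loc a := by rw [hs, hs']; exact h.loc a

/-! ### Moves out of the component in control -/

/-- The names that become public when the component `σ` emits the value `v`. -/
def SysCfg.emitted (σ : SysCfg) (v : Value) : Set Name := {n | Cl σ.s.loc (σ.P ∪ v.names) n}

/-- The store emitted with the value `v`. -/
noncomputable def SysCfg.emittedStore (σ : SysCfg) (v : Value) : LStore :=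
  σ.s.loc.restrict (locs (σ.emitted v))

theorem Half.emitted_subset (h : Half X S cA σ σ') {v : Value} (hv : v.names ⊆ σ.N) :
    σ.emitted v ⊆ σ.N :=
  fun _ hn => Cl.subset_of_closed (Set.union_subset h.pub hv) (fun _ _ _ => h.atom_names) hn

theorem SysCfg.pub_subset_emitted (σ : SysCfg) (v : Value) : σ.P ⊆ σ.emitted v :=
  fun _ hn => .base (Or.inl hn)

theorem SysCfg.value_subset_emitted (σ : SysCfg) (v : Value) : v.names ⊆ σ.emitted v :=
  fun _ hn => .base (Or.inr hn)

theorem SysCfg.names_emittedStore (σ : SysCfg) (v : Value) :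
    LStore.names (σ.emittedStore v) ⊆ σ.emitted v :=
  Cl.names_restrict_subset _ _

theorem SysCfg.get_emittedStore {σ : SysCfg} {v : Value} {a : ℕ}
    (h : Name.loc a ∈ σ.emitted v) : (σ.emittedStore v).get a = σ.s.loc.get a :=
  if_pos h

theorem SysCfg.get_emittedStore_of_notMem {σ : SysCfg} {v : Value} {a : ℕ}
    (h : Name.loc a ∉ σ.emitted v) : (σ.emittedStore v).get a = none :=
  if_neg h

theorem CtlLoc.get_emittedStore_ne (hl : CtlLoc σ σ' lA Q aux) (h : Half X S cA σ σ') {v : Value}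
    (hv : v.names ⊆ σ.N) {a : ℕ} (ha : Name.loc a ∈ σ.emitted v) :
    (σ.emittedStore v).get a ≠ none := by
  rw [SysCfg.get_emittedStore ha]
  exact hl.dom a (h.emitted_subset hv ha)

/-- The partner never rejects the data it is given: emitted names that it already uses are shared,
hence public for it, and the emitted store covers its public locations because these are public in
`σ` as well. -/
theorem CtlLoc.sysMay (hl : CtlLoc σ σ' lA Q aux) (hc : Core X X' S NA cA Q σ σ') {v : Value}
    (hv : v.names ⊆ σ.N) : SysMay σ'.N σ'.P v (σ.emittedStore v) := by
  have hsub : v.names ∪ LStore.names (σ.emittedStore v) ⊆ σ.emitted v :=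
    Set.union_subset (σ.value_subset_emitted v) (σ.names_emittedStore v)
  constructor
  · rintro n ⟨hn, hn'⟩
    exact hc.right.share n hn' (hc.left.emitted_subset hv (hsub hn))
  · intro a ha
    refine hl.get_emittedStore_ne hc.left hv ?_
    rw [mem_locs, Set.union_assoc] at ha
    rcases ha with ha | ha
    · exact σ.pub_subset_emitted v (hl.pub a ha)
    · exact hsub ha

theorem Core.cross (hc : Core X X' S NA cA Q σ σ') {v : Value} (hv : v.names ⊆ σ.N) :
    Core X X' S NA cA Q (σ.publish (σ.emitted v))
      (σ'.learn (v.names ∪ LStore.names (σ.emittedStore v)) (σ.emittedStore v)) := by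
  have hsub : v.names ∪ LStore.names (σ.emittedStore v) ⊆ σ.emitted v :=
    Set.union_subset (σ.value_subset_emitted v) (σ.names_emittedStore v)
  have hN := hc.left.emitted_subset hv
  refine ((hc.publish (σ.pub_subset_emitted v) hN).symm.learn ?_ ?_ ?_ ?_ ?_).symm
  · intro k; simp
  · exact fun n hn _ => hsub hn
  · exact Set.subset_union_right
  · intro i
    rw [hc.ident]
    have := @hsub (Name.ident i)
    have := @hN (Name.ident i)
    tauto
  · exact fun _ => Iff.rfl

/-- The receiver obtains current values for all its public locations and for all newly learnt ones,
while its private locations were current anyway. So precedence in the linked store can pass to it.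
-/
theorem CtlLoc.cross (hl : CtlLoc σ σ' lA Q aux) (hc : Core X X' S NA cA Q σ σ') {v : Value}
    (hv : v.names ⊆ σ.N) :
    CtlLoc (σ'.learn (v.names ∪ LStore.names (σ.emittedStore v)) (σ.emittedStore v))
      (σ.publish (σ.emitted v)) lA Q (aux.override (σ.emittedStore v)) := by
  have hsub : v.names ∪ LStore.names (σ.emittedStore v) ⊆ σ.emitted v :=
    Set.union_subset (σ.value_subset_emitted v) (σ.names_emittedStore v)
  have hne := fun a => hl.get_emittedStore_ne hc.left hv (a := a)
  have key : ∀ a, Name.loc a ∈ σ.emitted v →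
      Name.loc a ∈ σ'.P ∪ (v.names ∪ LStore.names (σ.emittedStore v)) :=
    fun a ha => Or.inr (Or.inr (LStore.loc_mem_names (hne a ha)))
  refine ⟨?_, ?_, ?_, ?_, ?_⟩
  · intro a ha
    simp only [SysCfg.learn, Store.override, FinPMap.get_override, ne_eq, Option.or_eq_none_iff,
      not_and_or]
    rcases ha with ha | ha
    · rcases hc.right.locDom a ha with h | h
      · exact Or.inl (hne a (σ.pub_subset_emitted v (hl.pub a h)))
      · exact Or.inr h
    · exact Or.inl (hne a (hsub ha))
  · exact key
  · intro a ha
    simp only [FinPMap.get_override, ne_eq, Option.or_eq_none_iff, not_and_or] at ha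
    rcases ha with ha | ha
    · refine key a ?_
      by_contra h
      exact ha (SysCfg.get_emittedStore_of_notMem h)
    · exact key a (σ.pub_subset_emitted v (hl.auxPub a ha))
  · exact fun a ha => key a (σ.pub_subset_emitted v (hl.pubQ a ha))
  · intro a
    simp only [SysCfg.learn, Store.override, FinPMap.get_override, SysCfg.publish]
    rw [hl.loc a]
    by_cases ha : Name.loc a ∈ σ.emitted v
    · rw [SysCfg.get_emittedStore ha]
      cases h : σ.s.loc.get a with
      | some b => rfl
      | none => exact absurd h (hl.dom a (hc.left.emitted_subset hv ha))
    · rw [SysCfg.get_emittedStore_of_notMem ha]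
      by_cases h₁ : σ.s.loc.get a = none
      · simp [h₁]
      · by_cases h₂ : σ'.s.loc.get a = none
        · simp [h₂]
        -- A location stored on both sides is shared, hence public and emitted; elsewhere the order
        -- of the stores is immaterial.
        · exact absurd (σ.pub_subset_emitted v
            (hc.left.share _ (hc.left.loc_mem h₁) (hc.right.loc_mem h₂))) ha

/-- The old auxiliary store disappears completely: its domain is public in `σ`, and the emitted
store is defined at all public locations. -/
theorem CtlLoc.get_aux (hl : CtlLoc σ σ' lA Q aux) (hc : Core X X' S NA cA Q σ σ') {v : Value}
    (hv : v.names ⊆ σ.N) (a : ℕ) :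
    (aux.override (σ.emittedStore v)).get a = (σ.emittedStore v).get a := by
  rw [FinPMap.get_override]
  by_cases ha : Name.loc a ∈ σ.emitted v
  · cases h : (σ.emittedStore v).get a with
    | some b => rfl
    | none => exact absurd h (hl.get_emittedStore_ne hc.left hv ha)
  · rw [SysCfg.get_emittedStore_of_notMem ha, Option.none_or]
    by_contra h
    exact ha (σ.pub_subset_emitted v (hl.auxPub a h))

theorem CtlLoc.get_aux_emitted (hl : CtlLoc σ σ' lA Q aux) (hc : Core X X' S NA cA Q σ σ')
    {v : Value} (hv : v.names ⊆ σ.N) {a : ℕ} (ha : Name.loc a ∈ σ.emitted v) :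
    lA.get a = (aux.override (σ.emittedStore v)).get a := by
  rw [hl.get_aux hc hv, SysCfg.get_emittedStore ha, hl.loc]
  cases h : σ.s.loc.get a with
  | some b => rfl
  | none => exact absurd h (hl.dom a (hc.left.emitted_subset hv ha))

theorem CtlLoc.toIdle (hl : CtlLoc σ σ' lA Q aux) (hc : Core X X' S NA cA Q σ σ') {v : Value}
    (hv : v.names ⊆ σ.N) (Q' : Set Name) :
    IdleLoc (σ.publish (σ.emitted v)) σ' lA Q' (aux.override (σ.emittedStore v)) := by
  have hN := hc.left.emitted_subset hv
  have haux : aux.override (σ.emittedStore v) = σ.emittedStore v :=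
    FinPMap.ext (funext (hl.get_aux hc hv))
  have hne := fun a => hl.get_emittedStore_ne hc.left hv (a := a)
  rw [haux]
  have hsub := σ.names_emittedStore v
  refine ⟨?_, ?_, ?_, ?_, ?_, ?_, ?_⟩
  · exact fun n hn => Or.inl (hN (hsub hn))
  · exact fun n hn _ => hsub hn
  · exact fun n hn hn' => hc.right.share n hn' (hN (hsub hn))
  · exact fun a ha => Or.inr (hne a ha)
  · exact fun a ha => Or.inr (hne a (σ.pub_subset_emitted v (hl.pub a ha)))
  · exact fun a ha => Or.inr (hne a (hsub ha))
  · intro a _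
    rw [hl.loc]
    simp only [SysCfg.publish]
    by_cases ha : Name.loc a ∈ σ.emitted v
    · rw [SysCfg.get_emittedStore ha]
      cases h : σ.s.loc.get a <;> simp
    · rw [SysCfg.get_emittedStore_of_notMem ha, Option.none_or]

/-- Everything reachable from `Q` and `v` through the linked store is reached through current values
in `σ`, which are exactly the values emitted. -/
theorem CtlLoc.cl_iff (hl : CtlLoc σ σ' lA Q aux) (hc : Core X X' S NA cA Q σ σ') {v : Value}
    (hv : v.names ⊆ σ.N) (n : Name) :
    Cl lA (Q ∪ v.names) n ↔ Cl (aux.override (σ.emittedStore v)) (v.names ∪ Q) n := by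
  rw [Set.union_comm v.names Q]
  have hloc : ∀ a, Name.loc a ∈ {n | n ∈ σ.emitted v ∨ ∀ a, n ≠ Name.loc a} →
      Name.loc a ∈ σ.emitted v := fun a ha => ha.resolve_right fun h => h a rfl
  -- `Q` may contain function and continuation names unknown to `σ`. Nothing is reached through
  -- them, so adding all names other than locations gives a closed set.
  refine Cl.congr (Y := {n | n ∈ σ.emitted v ∨ ∀ a, n ≠ Name.loc a}) ?_ ?_ ?_ n
  · rintro n (hn | hn)
    · by_cases h : ∃ a, n = Name.loc a
      · obtain ⟨a, rfl⟩ := h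
        exact Or.inl (σ.pub_subset_emitted v (hl.pubQ a hn))
      · exact Or.inr fun a ha => h ⟨a, ha⟩
    · exact Or.inl (σ.value_subset_emitted v hn)
  · intro a b ha hb m hm
    have ha' := hloc a ha
    rw [hl.loc] at hb
    cases h : σ.s.loc.get a with
    | some c =>
      rw [h] at hb
      cases hb
      exact Or.inl (Cl.step ha' h hm)
    | none => exact absurd h (hl.dom a (hc.left.emitted_subset hv ha'))
  · exact fun a ha => hl.get_aux_emitted hc hv (hloc a ha)

theorem CtlLoc.loc_mem_emitted (hl : CtlLoc σ σ' lA Q aux) (hc : Core X X' S NA cA Q σ σ')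
    {v : Value} (hv : v.names ⊆ σ.N) {n : Name} (hn : Cl lA (Q ∪ v.names) n) :
    n ∈ σ.emitted v ∪ Q := by
  refine Cl.subset_of_closed (Y := σ.emitted v ∪ Q) ?_ ?_ hn
  · exact Set.union_subset Set.subset_union_right
      ((σ.value_subset_emitted v).trans Set.subset_union_left)
  · intro a b ha hb m hm
    have ha' : Name.loc a ∈ σ.emitted v :=
      ha.elim id fun h => σ.pub_subset_emitted v (hl.pubQ a h)
    rw [hl.loc] at hb
    cases h : σ.s.loc.get a with
    | some c =>
      rw [h] at hb
      cases hb
      exact Or.inl (Cl.step ha' h hm)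
    | none => exact absurd h (hl.dom a (hc.left.emitted_subset hv ha'))

theorem CtlLoc.restrict_eq (hl : CtlLoc σ σ' lA Q aux) (hc : Core X X' S NA cA Q σ σ')
    {v : Value} (hv : v.names ⊆ σ.N) {Y Y' : Set Name} (hY : Y = {n | Cl lA (Q ∪ v.names) n})
    (hY' : ∀ a, Name.loc a ∈ Y' ↔ Name.loc a ∈ Y) :
    lA.restrict (locs Y) = (aux.override (σ.emittedStore v)).restrict (locs Y') := by
  refine FinPMap.ext (funext fun a => ?_)
  by_cases ha : Name.loc a ∈ Y
  · rw [FinPMap.get_restrict_of_mem _ (by exact ha),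
      FinPMap.get_restrict_of_mem _ (by exact (hY' a).2 ha)]
    refine hl.get_aux_emitted hc hv ?_
    rw [hY] at ha
    exact (hl.loc_mem_emitted hc hv ha).elim id fun h => σ.pub_subset_emitted v (hl.pubQ a h)
  · rw [FinPMap.get_restrict_of_notMem _ (by exact ha),
      FinPMap.get_restrict_of_notMem _ (fun h => ha ((hY' a).1 h))]

end

/-! ## Moves of the System -/

/-- Non-private locations in the domain of `s` become public, and no private one does. Hence the
label of the composite shows just the non-private part of `s`, which is the store given to the
linked machine. -/
theorem Pub.restrict_updS {Q : Pub} {N : Set Name} {aux s : LStore} {α : Act}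
    (h : SysUpd Q (N \ Q.names) aux α s) :
    s.restrict (locs (Q.updS (N \ Q.names) α s).names) = s.restrict (locs (N \ Q.names)ᶜ) := by
  obtain ⟨-, -, -, -, h⟩ := h
  have hα : α.value.names ⊆ α.dataNames := by
    cases α
    · exact Set.subset_union_right
    · exact subset_rfl
  refine FinPMap.ext (funext fun a => ?_)
  by_cases hs : s.get a = none
  · simp [FinPMap.get_restrict, hs]
  · simp only [FinPMap.get_restrict, mem_locs]
    congr 1
    refine propext ⟨?_, ?_⟩
    · rintro ((h' | h' | h') | h')
      · exact fun h'' => h''.2 h'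
      · exact fun h'' => Set.disjoint_left.1 h (Or.inl (hα h')) h''
      · exact fun h'' => Set.disjoint_left.1 h (Or.inr h') h''
      · simp at h'
    · intro h'
      refine Or.inl (Or.inr (Or.inr (LStore.loc_mem_names ?_)))
      rwa [FinPMap.get_restrict, if_pos h']

section

variable {X X' : Set Name} {NA : Set Name} {cA : FinPMap (Stack × ℕ)}
  {Q : Pub} {σ σ' : SysCfg} {lA aux s : LStore} {α : Act} {pr : Set Name}

/-- On private locations the supplied store only repeats the auxiliary one. -/
theorem SysUpd.names_subset (hu : SysUpd Q pr aux α s) (hpr : pr = (σ.N ∪ σ'.N) \ Q.names) :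
    LStore.names s ⊆ LStore.names (s.restrict (locs prᶜ)) ∪ LStore.names aux := by
  rintro n ⟨a, b, hb, hn⟩
  by_cases ha : Name.loc a ∈ pr
  · right
    have hQ : Name.loc a ∉ Q.names := by rw [hpr] at ha; exact ha.2
    refine ⟨a, b, ?_, hn⟩
    rw [← hu.2.2.1 a hQ (hu.2.2.2.1 a ha (by simp [hb])), hb]
  · left
    exact ⟨a, b, by rw [FinPMap.get_restrict, if_pos (by exact ha), hb], hn⟩

theorem SysUpd.value_disjoint (hu : SysUpd Q pr aux α s) {n : Name}
    (hn : n ∈ α.value.names ∪ LStore.names (s.restrict (locs prᶜ))) : n ∉ pr := by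
  refine fun h => Set.disjoint_left.1 hu.2.2.2.2 ?_ h
  refine hn.imp_left fun h => ?_
  cases α
  · exact Or.inr h
  · exact h

/-- A used identifier outside `Q` is private to the composite, so the ban on private names is what
the linked machine demands of the System. -/
theorem IdleLoc.sysMay (hc : Core X X' Q.polS NA cA Q.names σ σ')
    (hm : SysMay σ.N σ.P α.value s)
    (hpr : pr = (σ.N ∪ σ'.N) \ Q.names) (hu : SysUpd Q pr aux α s) :
    SysMay NA Q.names α.value (s.restrict (locs prᶜ)) := by
  constructor
  · rintro n ⟨hn, hn'⟩
    have h := hu.value_disjoint hn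
    by_contra hQ
    cases n with
    | ident i => exact h (hpr ▸ ⟨(hc.ident i).1 hn', hQ⟩)
    | cont k => simp at hn
  · intro a ha
    rw [mem_locs, Set.union_assoc] at ha
    have hpr' : Name.loc a ∉ pr := by
      rcases ha with ha | ha
      · rw [hpr]; exact fun h => h.2 ha
      · exact hu.value_disjoint ha
    rw [FinPMap.mem_dom, FinPMap.get_restrict, if_pos (by exact hpr')]
    rcases ha with ha | ha | ha
    · exact hu.1 ha
    · exact hm.2 (Or.inl (Or.inr ha))
    · exact hm.2 (Or.inr (LStore.names_restrict _ _ ha))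

theorem IdleLoc.core_learn (hl : IdleLoc σ σ' lA Q.names aux)
    (hc : Core X X' Q.polS NA cA Q.names σ σ')
    (hpr : pr = (σ.N ∪ σ'.N) \ Q.names) (hu : SysUpd Q pr aux α s) :
    Core X X' Q.polS (NA ∪ (α.value.names ∪ LStore.names (s.restrict (locs prᶜ)))) cA Q.names
      (σ.learn (α.value.names ∪ LStore.names s) s) σ' := by
  have hns := hu.names_subset hpr
  refine hc.learn ?_ ?_ Set.subset_union_right ?_ ?_
  · intro k; simp
  · intro n hn hn'
    -- Private names can arrive only through the auxiliary store, and `auxR` covers those. Any other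
    -- name known to `σ'` lies in `Q`.
    by_cases h : n ∈ pr
    · rcases hn with hn | hn
      · exact absurd h (hu.value_disjoint (Or.inl hn))
      · rcases hns hn with hn | hn
        · exact absurd h (hu.value_disjoint (Or.inr hn))
        · exact hl.auxR n hn hn'
    · have hQ : n ∈ Q.names := by
        by_contra hQ
        exact h (hpr ▸ ⟨Or.inr hn', hQ⟩)
      rcases hc.pubSub hQ with h' | h'
      · exact hc.right.share n hn' (hc.left.pub h')
      · exact h'
  · intro i
    have h₁ := @hns (Name.ident i)
    have h₂ := @hl.auxN (Name.ident i)
    have h₃ := @LStore.names_restrict s (locs prᶜ) (Name.ident i)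
    have h₄ := hc.ident i
    simp only [Set.mem_union] at *
    tauto
  · intro k; simp

/-- On private locations the supplied values are those of the auxiliary store, which the linked
store already holds; elsewhere both sides are overridden by the same values. -/
theorem IdleLoc.toCtl (hl : IdleLoc σ σ' lA Q.names aux)
    (hc : Core X X' Q.polS NA cA Q.names σ σ') (hm : SysMay σ.N σ.P α.value s)
    (hpr : pr = (σ.N ∪ σ'.N) \ Q.names) (hu : SysUpd Q pr aux α s) :
    CtlLoc (σ.learn (α.value.names ∪ LStore.names s) s) σ'
      (lA.override (s.restrict (locs prᶜ)))
      (Q.names ∪ (α.value.names ∪ LStore.names (s.restrict (locs prᶜ)))) (aux.override s) := by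
  have hs : ∀ a, s.get a ≠ none →
      Name.loc a ∈ σ.P ∪ (α.value.names ∪ LStore.names s) :=
    fun a ha => Or.inr (Or.inr (LStore.loc_mem_names ha))
  have hd : ∀ a, Name.loc a ∈ Q.names ∨ aux.get a ≠ none → s.get a ≠ none := by
    intro a ha
    by_cases hQ : Name.loc a ∈ Q.names
    · exact hu.1 hQ
    · have ha' := ha.resolve_left hQ
      rw [hu.2.2.1 a hQ ha']
      exact ha'
  refine ⟨?_, ?_, ?_, ?_, ?_⟩
  · intro a ha
    simp only [SysCfg.learn, Store.override, FinPMap.get_override, ne_eq, Option.or_eq_none_iff,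
      not_and_or]
    rcases ha with ha | ha
    -- The System supplies every location public in `σ`; the remaining ones are in the component's
    -- own store.
    · rcases hc.left.locDom a ha with h | h
      · exact Or.inl (hm.2 (Or.inl (Or.inl h)))
      · exact Or.inr h
    · exact Or.inl (hm.2 (by rw [mem_locs, Set.union_assoc]; exact Or.inr ha))
  · exact fun a ha => hs a (hd a (hl.pubR a ha))
  · intro a ha
    simp only [FinPMap.get_override, ne_eq, Option.or_eq_none_iff, not_and_or] at ha
    exact hs a (ha.elim id fun h => hd a (Or.inr h))
  · rintro a (ha | ha | ha)
    · exact hs a (hd a (Or.inl ha))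
    · exact Or.inr (Or.inl ha)
    · exact Or.inr (Or.inr (LStore.names_restrict _ _ ha))
  · intro a
    simp only [SysCfg.learn, Store.override, FinPMap.get_override]
    by_cases ha : Name.loc a ∈ pr
    · have hQ : Name.loc a ∉ Q.names := by rw [hpr] at ha; exact ha.2
      rw [FinPMap.get_restrict_of_notMem _ (by simpa using ha), Option.none_or, hl.loc a hQ]
      by_cases h₀ : aux.get a = none
      · have : s.get a = none := by
          by_contra h
          exact hu.2.2.2.1 a ha h h₀
        simp [h₀, this]
      · rw [hu.2.2.1 a hQ h₀, Option.or_assoc]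
    · rw [FinPMap.get_restrict_of_mem _ (by exact ha)]
      by_cases h₀ : s.get a = none
      · have h₁ : Name.loc a ∉ Q.names := fun h => hd a (Or.inl h) h₀
        have h₂ : aux.get a = none := by
          by_contra h
          exact hd a (Or.inr h) h₀
        simp [h₀, hl.loc a h₁, h₂]
      · obtain ⟨b, hb⟩ := Option.ne_none_iff_exists'.1 h₀
        simp [hb]

/-! ### From a System move of the linked module to one of the composite -/

/-- The store supplied to a component when the System supplies `s`: it includes the private
shared locations. -/
noncomputable def Pub.supply (Q : Pub) (aux s : LStore) : LStore :=
  (aux.restrict (locs Q.namesᶜ)).override s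

/-- The System cannot supply private locations, since the linked machine uses them without
publishing them. The additions from the auxiliary store are all private, so removing private
locations gives back `s`. -/
theorem IdleLoc.restrict_supply (hl : IdleLoc σ σ' lA Q.names aux)
    (hc : Core X X' Q.polS NA cA Q.names σ σ') {v : Value} (hm : SysMay NA Q.names v s)
    (hpr : pr = (σ.N ∪ σ'.N) \ Q.names) : (Q.supply aux s).restrict (locs prᶜ) = s := by
  refine FinPMap.ext (funext fun a => ?_)
  by_cases ha : Name.loc a ∈ pr
  · rw [FinPMap.get_restrict_of_notMem _ (by simpa using ha)]
    rw [hpr] at ha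
    by_contra h
    exact ha.2 (hm.1 ⟨Or.inr (LStore.loc_mem_names (Ne.symm h)), (hc.ident _).2 ha.1⟩)
  · rw [FinPMap.get_restrict_of_mem _ (by exact ha), Pub.supply, FinPMap.get_override]
    by_cases hQ : Name.loc a ∈ Q.names
    · rw [FinPMap.get_restrict_of_notMem _ (by simpa using hQ), Option.or_none]
    · have : aux.get a = none := by
        by_contra h
        exact ha (hpr ▸ ⟨hl.auxN (LStore.loc_mem_names h), hQ⟩)
      rw [FinPMap.get_restrict_of_mem _ (by exact hQ), this, Option.or_none]

theorem Pub.names_supply (Q : Pub) (aux s : LStore) :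
    LStore.names (Q.supply aux s) ⊆ LStore.names aux ∪ LStore.names s :=
  (LStore.names_override _ _).trans
    (Set.union_subset_union_left _ (LStore.names_restrict _ _))

/-- A component expects values for all its public locations, including those shared with its partner
but unknown to the System. The auxiliary store provides these, and its closedness covers the
locations it mentions. -/
theorem IdleLoc.sysMay_supply (hl : IdleLoc σ σ' lA Q.names aux)
    (hc : Core X X' Q.polS NA cA Q.names σ σ') {v : Value} (hm : SysMay NA Q.names v s) :
    SysMay σ.N σ.P v (Q.supply aux s) := by
  have hd : ∀ a, Name.loc a ∈ Q.names ∨ aux.get a ≠ none → (Q.supply aux s).get a ≠ none := by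
    intro a ha
    simp only [Pub.supply, FinPMap.get_override, ne_eq, Option.or_eq_none_iff, not_and_or]
    by_cases hQ : Name.loc a ∈ Q.names
    · exact Or.inl (hm.2 (Or.inl (Or.inl hQ)))
    · right
      rw [FinPMap.get_restrict, if_pos (by exact hQ)]
      exact ha.resolve_left hQ
  have hs : ∀ a, s.get a ≠ none → (Q.supply aux s).get a ≠ none := by
    intro a ha
    simp only [Pub.supply, FinPMap.get_override, ne_eq, Option.or_eq_none_iff, not_and_or]
    exact Or.inl ha
  have key : ∀ n ∈ v.names ∪ LStore.names s, n ∈ σ.N → n ∈ σ.P := by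
    intro n hn hn'
    have hNA : n ∈ NA := by
      cases n with
      | ident i => exact (hc.ident i).2 (Or.inl hn')
      | cont k => simp at hn
    rcases hc.pubSub (hm.1 ⟨hn, hNA⟩) with h | h
    · exact h
    · exact hc.left.share n hn' (hc.right.pub h)
  constructor
  · rintro n ⟨hn | hn, hn'⟩
    · exact key n (Or.inl hn) hn'
    · rcases Q.names_supply aux s hn with hn | hn
      · exact hl.auxL n hn hn'
      · exact key n (Or.inr hn) hn'
  · rintro a ((ha | ha) | ha)
    · exact hd a (hl.pubL a ha)
    · exact hs a (hm.2 (Or.inl (Or.inr ha)))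
    · rcases Q.names_supply aux s ha with h | h
      · exact hd a (hl.closed a h)
      · exact hs a (hm.2 (Or.inr h))

theorem IdleLoc.sysUpd_supply (hl : IdleLoc σ σ' lA Q.names aux)
    (hc : Core X X' Q.polS NA cA Q.names σ σ') (hm : SysMay NA Q.names α.value s)
    (hpr : pr = (σ.N ∪ σ'.N) \ Q.names)
    (hα : ∀ n ∈ α.dataNames, n ∈ NA → n ∈ Q.names) (hα' : ∀ k, Name.cont k ∉ α.dataNames) :
    SysUpd Q pr aux α (Q.supply aux s) := by
  have hQ : ∀ a, Name.loc a ∈ Q.names → s.get a ≠ none := fun a ha => hm.2 (Or.inl (Or.inl ha))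
  have hnp : ∀ n, n ∈ α.dataNames ∪ LStore.names s → n ∈ pr → n ∈ Q.names := by
    intro n hn hp
    rw [hpr] at hp
    cases n with
    | ident i =>
      have := (hc.ident i).2 hp.1
      exact hn.elim (fun h => hα _ h this) fun h => hm.1 ⟨Or.inr h, this⟩
    | cont k => simp [hα'] at hn
  have hpQ : ∀ n ∈ pr, n ∉ Q.names := by rw [hpr]; exact fun n h => h.2
  refine ⟨?_, ?_, ?_, ?_, ?_⟩
  · intro a ha
    simp [Pub.supply, hQ a ha]
  · intro a ha
    rw [FinPMap.mem_dom, FinPMap.get_restrict] at ha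
    split at ha
    · next h => simp [Pub.supply, hQ a h]
    · exact absurd rfl ha
  · intro a ha h₀
    have : s.get a = none := by
      by_contra h
      have hn : Name.loc a ∈ LStore.names s := LStore.loc_mem_names h
      exact ha (hnp _ (Or.inr hn) (hpr ▸ ⟨hl.auxN (LStore.loc_mem_names h₀), ha⟩))
    rw [Pub.supply, FinPMap.get_override, this, FinPMap.get_restrict_of_mem _ (by exact ha),
      Option.none_or]
  · intro a ha h₀
    simp only [Pub.supply, FinPMap.get_override, ne_eq, Option.or_eq_none_iff, not_and_or] at h₀
    rcases h₀ with h | h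
    · exact absurd (hnp _ (Or.inr (LStore.loc_mem_names h)) ha) (hpQ _ ha)
    · rw [FinPMap.get_restrict] at h
      split at h
      · exact h
      · exact absurd rfl h
  · rw [hl.restrict_supply hc hm hpr]
    exact Set.disjoint_left.2 fun n hn hp => hpQ n hp (hnp n hn hp)

end

/-! ## Composite states with a component in control -/

/-- `L` is the linked module of `M` and `M'`. -/
structure Linked (L M M' : Mod) (X X' : Set Name) : Prop where
  fun_iff : ∀ f d, L.fun? f = some d ↔ M.fun? f = some d ∨ M'.fun? f = some d
  disj : ∀ f, M.fun? f = none ∨ M'.fun? f = none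
  left : ∀ f d, M.fun? f = some d → Name.fn f ∈ X ∧ d.term.names ⊆ X
  right : ∀ f d, M'.fun? f = some d → Name.fn f ∈ X' ∧ d.term.names ⊆ X'

theorem Linked.symm {L M M' : Mod} {X X' : Set Name} (h : Linked L M M' X X') :
    Linked L M' M X' X where
  fun_iff f d := by rw [or_comm]; exact h.fun_iff f d
  disj f := (h.disj f).symm
  left := h.right
  right := h.left

theorem Linked.fun_eq_none {L M M' : Mod} {X X' : Set Name} (h : Linked L M M' X X') (f : ℕ) :
    L.fun? f = none ↔ M.fun? f = none ∧ M'.fun? f = none := by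
  have := h.fun_iff f
  simp only [Option.eq_none_iff_forall_ne_some, ne_eq, this]
  grind

/-- The configuration without the term that is being evaluated. -/
def ProgCfg.sys (p : ProgCfg) : SysCfg := ⟨p.N, p.P, p.s⟩

/-- Invariant of a composite state in which the component `p` has control: the stack and the
continuation of the linked module are `p.t ++ T` and `K`. -/
structure Ctl (X X' NA : Set Name) (sA : Store) (T : Stack) (K : ℕ) (p : ProgCfg) (σ : SysCfg)
    (Q : Pub) (aux : LStore) : Prop where
  core : Core X X' Q.polS NA sA.cont Q.names p.sys σ
  loc : CtlLoc p.sys σ sA.loc Q.names aux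
  stack : Stack.names p.t ⊆ p.N
  term : p.e.names ⊆ p.N
  cont : Name.cont p.k ∈ p.N
  unf : Unf Q.polS p.s.cont.get σ.s.cont.get p.k T K

section

variable {X X' NA : Set Name} {S : Set ℕ} {cA : FinPMap (Stack × ℕ)} {Qn : Set Name}
  {σ σ' : SysCfg}

theorem Core.setLoc (h : Core X X' S NA cA Qn σ σ') {a : ℕ} {b : Atom} (ha : Name.loc a ∈ σ.N)
    (hb : b.names ⊆ σ.N) : Core X X' S NA cA Qn ⟨σ.N, σ.P, σ.s.setLoc a b⟩ σ' where
  left :=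
    { h.left with
      store := (Store.names_setLoc _ _ _).trans (Set.union_subset h.left.store
        (Set.union_subset (Set.singleton_subset_iff.2 ha) hb))
      locDom := fun c hc => by
        refine (h.left.locDom c hc).imp_right fun h' => ?_
        simp only [Store.setLoc, FinPMap.get_set]
        split
        · simp
        · exact h' }
  right := { h.right with }
  pubSub := h.pubSub
  ident := h.ident
  contUsed := h.contUsed
  contNA := h.contNA
  saved := h.saved

theorem Core.alloc (h : Core X X' S NA cA Qn σ σ') {a : ℕ} {b : Atom}
    (ha : Name.loc a ∉ σ'.N) (hb : b.names ⊆ σ.N) :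
    Core X X' S (NA ∪ {Name.loc a}) cA Qn ⟨σ.N ∪ {Name.loc a}, σ.P, σ.s.setLoc a b⟩ σ' where
  left :=
    { scope := h.left.scope.trans Set.subset_union_left
      pub := h.left.pub.trans Set.subset_union_left
      store := by
        refine (Store.names_setLoc _ _ _).trans ?_
        have := h.left.store
        grind
      contPub := fun k hk => h.left.contPub k (hk.resolve_right (by simp))
      locDom := fun c hc => by
        simp only [Store.setLoc, FinPMap.get_set]
        by_cases hca : c = a
        · simp [hca]
        · simp only [hca, if_false]
          exact h.left.locDom c (hc.resolve_right (by simpa using hca))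
      share := by
        rintro n (hn | rfl) hn'
        · exact h.left.share n hn hn'
        · exact absurd hn' ha
      pol := h.left.pol
      fin := h.left.fin.subset fun k hk => hk.resolve_right (by simp)
      split := fun k hk => h.left.split k (hk.resolve_right (by simp))
      conts := h.left.conts }
  right :=
    { h.right with
      share := by
        rintro n hn (hn' | rfl)
        · exact h.right.share n hn hn'
        · exact absurd hn ha
      split := fun k hk => (h.right.split k hk).imp_right
        fun h' => h'.imp_right fun h'' => ⟨Or.inl h''.1, h''.2⟩
      conts := fun k t k₁ hk hk' => h.right.conts k t k₁ hk fun h' => hk' (Or.inl h') }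
  pubSub := h.pubSub
  ident i := by
    simp only [Set.mem_union, h.ident]
    tauto
  contUsed k hk := by
    refine (h.contUsed k (hk.resolve_right (by simp))).imp_left Or.inl
  contNA k := by
    rw [← h.contNA]
    simp
  saved k hk := (h.saved k hk).imp_right fun h' =>
    ⟨h'.1, fun h'' => h'.2 (h''.resolve_right (by simp))⟩

end

namespace Ctl

variable {L M M' : Mod} {X X' NA : Set Name} {sA : Store} {T : Stack} {K : ℕ} {p p' : ProgCfg}
  {σ : SysCfg} {Q : Pub} {aux : LStore} {N P : Set Name} {s : Store} {t t' : Stack} {e e' : Term}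
  {k : ℕ}

theorem names_eq (h : Ctl X X' NA sA T K p σ Q aux) : p.names = p.N := by
  have h₁ := h.core.left.names_eq
  unfold ProgCfg.names
  change p.sys.names ∪ _ ∪ _ ∪ _ = p.N
  rw [h₁]
  have h₂ := h.stack
  have h₃ := h.term
  have h₄ := h.cont
  simp only [ProgCfg.sys]
  grind

theorem fresh (h : Ctl X X' NA sA T K p σ Q aux) (h' : Ctl X X' NA sA T K p' σ Q aux)
    (hN : p'.N = p.N) : p'.names ∩ σ.names ⊆ p.names := by
  rw [h.names_eq, h'.names_eq, hN]
  exact Set.inter_subset_left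

theorem congr (h : Ctl X X' NA sA T K ⟨N, P, s, t, e, k⟩ σ Q aux)
    (hn : Stack.names t' ∪ e'.names ⊆ N) :
    Ctl X X' NA sA T K ⟨N, P, s, t', e', k⟩ σ Q aux where
  core := h.core
  loc := h.loc
  stack := (Set.union_subset_iff.1 hn).1
  term := (Set.union_subset_iff.1 hn).2
  cont := h.cont
  unf := h.unf

theorem setLoc (h : Ctl X X' NA sA T K ⟨N, P, s, t, e, k⟩ σ Q aux) {a : ℕ} {b : Atom}
    (ha : Name.loc a ∈ N) (hb : b.names ⊆ N) (hn : Stack.names t' ∪ e'.names ⊆ N) :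
    Ctl X X' NA (sA.setLoc a b) T K ⟨N, P, s.setLoc a b, t', e', k⟩ σ Q aux where
  core := h.core.setLoc ha hb
  loc :=
    { dom := fun c hc => by
        simp only [ProgCfg.sys, Store.setLoc, FinPMap.get_set]
        split
        · simp
        · exact h.loc.dom c hc
      pub := h.loc.pub
      auxPub := h.loc.auxPub
      pubQ := h.loc.pubQ
      loc := fun c => by
        simp only [ProgCfg.sys, Store.setLoc, FinPMap.get_set]
        split
        · simp
        · exact h.loc.loc c }
  stack := (Set.union_subset_iff.1 hn).1
  term := (Set.union_subset_iff.1 hn).2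
  cont := h.cont
  unf := h.unf

theorem alloc (h : Ctl X X' NA sA T K ⟨N, P, s, t, e, k⟩ σ Q aux) {a : ℕ}
    (ha' : Name.loc a ∉ σ.N) (hn : Stack.names t' ∪ e'.names ⊆ N ∪ {Name.loc a}) :
    Ctl X X' (NA ∪ {Name.loc a}) (sA.setLoc a (.int 0)) T K
      ⟨N ∪ {Name.loc a}, P, s.setLoc a (.int 0), t', e', k⟩ σ Q aux where
  core := h.core.alloc ha' (Set.empty_subset _)
  loc :=
    { dom := fun c hc => by
        simp only [ProgCfg.sys, Store.setLoc, FinPMap.get_set]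
        by_cases hca : c = a
        · simp [hca]
        · simp only [hca, if_false]
          exact h.loc.dom c (hc.resolve_right (by simpa using hca))
      pub := h.loc.pub
      auxPub := h.loc.auxPub
      pubQ := h.loc.pubQ
      loc := fun c => by
        simp only [ProgCfg.sys, Store.setLoc, FinPMap.get_set]
        split
        · simp
        · exact h.loc.loc c }
  stack := (Set.union_subset_iff.1 hn).1
  term := (Set.union_subset_iff.1 hn).2
  cont := Or.inl h.cont
  unf := h.unf

theorem fresh_alloc (h : Ctl X X' NA sA T K ⟨N, P, s, t, e, k⟩ σ Q aux) {a : ℕ}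
    (ha' : Name.loc a ∉ σ.N) (hn : Stack.names t' ∪ e'.names ⊆ N ∪ {Name.loc a}) :
    ProgCfg.names ⟨N ∪ {Name.loc a}, P, s.setLoc a (.int 0), t', e', k⟩ ∩ σ.names ⊆
      ProgCfg.names ⟨N, P, s, t, e, k⟩ := by
  rw [h.names_eq, (h.alloc ha' hn).names_eq, h.core.right.names_eq]
  rintro n ⟨hn | rfl, hn'⟩
  · exact hn
  · exact absurd hn' ha'

/-- The side condition on internal moves of the composite serves exactly this purpose: a location
allocated by one component is new to the other, and so to the linked machine. -/
theorem notMem_of_fresh (h : Ctl X X' NA sA T K ⟨N, P, s, t, e, k⟩ σ Q aux) {a : ℕ}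
    (ha : Name.loc a ∉ N)
    (hn : ProgCfg.names ⟨N ∪ {Name.loc a}, P, s.setLoc a (.int 0), t', e', k⟩ ∩ σ.names ⊆
      ProgCfg.names ⟨N, P, s, t, e, k⟩) : Name.loc a ∉ σ.N := by
  intro ha'
  rw [h.names_eq, h.core.right.names_eq] at hn
  refine ha (hn ⟨?_, ha'⟩)
  simp [ProgCfg.names]

theorem loc_notMem_iff (h : Ctl X X' NA sA T K ⟨N, P, s, t, e, k⟩ σ Q aux) (a : ℕ) :
    Name.loc a ∉ NA ↔ Name.loc a ∉ N ∧ Name.loc a ∉ σ.N := by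
  rw [h.core.ident, not_or]
  rfl

theorem get_loc (h : Ctl X X' NA sA T K ⟨N, P, s, t, e, k⟩ σ Q aux) {a : ℕ}
    (ha : Name.loc a ∈ N) : sA.loc.get a = s.loc.get a := by
  rw [h.loc.loc a]
  have := h.loc.dom a ha
  simp only [ProgCfg.sys] at this ⊢
  cases hs : s.loc.get a with
  | some b => rfl
  | none => exact absurd hs this

theorem names_subset (h : Ctl X X' NA sA T K ⟨N, P, s, t, e, k⟩ σ Q aux) :
    Stack.names t ∪ e.names ⊆ N := Set.union_subset h.stack h.term

theorem names_loc {a : ℕ} : (Atom.ident (.loc a)).names = {Name.loc a} := rfl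

/-- Internal moves of the component in control are moves of the linked module. -/
theorem red (hL : Linked L M M' X X') (h : Ctl X X' NA sA T K p σ Q aux) (hr : Red M p p')
    (hn : p'.names ∩ σ.names ⊆ p.names) :
    ∃ NA' sA', Red L ⟨NA, Q.names, sA, p.t ++ T, p.e, K⟩
        ⟨NA', Q.names, sA', p'.t ++ T, p'.e, K⟩ ∧ Ctl X X' NA' sA' T K p' σ Q aux := by
  have hsub := h.names_subset
  cases hr with
  | new ha =>
    have ha' := h.notMem_of_fresh ha hn
    refine ⟨_, _, .new ((h.loc_notMem_iff _).2 ⟨ha, ha'⟩), h.alloc ha' ?_⟩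
    simp only [Term.names, Value.names_singleton, names_loc] at hsub ⊢
    grind
  | localVar ha =>
    have ha' := h.notMem_of_fresh ha hn
    refine ⟨_, _, .localVar ((h.loc_notMem_iff _).2 ⟨ha, ha'⟩), h.alloc ha' ?_⟩
    rename_i x e k a
    have := Term.names_subst x (.ident (.loc a)) e
    simp only [Term.names, Atom.names] at hsub this ⊢
    grind
  | assignEval =>
    refine ⟨_, _, .assignEval, h.setLoc ?_ ?_ ?_⟩ <;>
    simp only [Stack.names_cons, Frame.names, Term.names, Value.names_nil,
      Value.names_singleton, names_loc] at hsub ⊢ <;> grind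
  | derefEval hb =>
    rename_i N P s t a b k
    have ha : Name.loc a ∈ N := h.term (by
      simp [Term.names, Value.names_singleton, names_loc])
    refine ⟨_, _, .derefEval ((h.get_loc ha).trans hb), h.congr ?_⟩
    have := h.core.left.atom_names hb
    simp only [Stack.names_cons, Frame.names, Term.names,
      Value.names_singleton, ProgCfg.sys] at hsub this ⊢
    grind
  | binopEval hb =>
    refine ⟨_, _, .binopEval hb, h.congr ?_⟩
    have := BinOp.names_eval hb
    simp only [Stack.names_cons, Frame.names, Term.names,
      Value.names_singleton] at hsub this ⊢
    grind
  | pairEval =>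
    refine ⟨_, _, .pairEval, h.congr ?_⟩
    simp only [Stack.names_cons, Frame.names, Term.names, Value.names_append] at hsub ⊢
    grind
  | appEval hf he =>
    refine ⟨_, _, .appEval ((hL.fun_iff _ _).2 (Or.inl hf)) he, h.congr ?_⟩
    have h₁ := Func.names_inst he
    have h₂ := (hL.left _ _ hf).2
    have h₃ := h.core.left.scope
    simp only [Stack.names_cons, Frame.names, Term.names, ProgCfg.sys] at hsub h₃ ⊢
    grind
  | iteTrue hz =>
    refine ⟨_, _, .iteTrue hz, h.congr ?_⟩
    simp only [Stack.names_cons, Frame.names, Term.names] at hsub ⊢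
    grind
  | _ =>
    refine ⟨_, _, by constructor, h.congr ?_⟩
    simp only [Stack.names_cons, Frame.names, Term.names] at hsub ⊢
    grind

/-- The next move of the linked module is a move of the component in control. -/
def Ready (M' : Mod) (T : Stack) (K : ℕ) (p : ProgCfg) (Q : Pub) : Prop :=
  (∀ v, p.e = .val v → p.t = [] → T = [] ∧ K = p.k ∧ p.k ∈ Q.polS) ∧
  ∀ v f t, p.e = .val v → p.t = .appR [.ident (.fn f)] :: t → M'.fun? f = none

/-- When the term is a value, readiness makes `T` empty if `t` is. So the frame on which the linked
machine acts belongs to the component in control. -/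
theorem Ready.split {F : Frame} {U : Stack} {v : Value}
    (h : Ready M' T K ⟨N, P, s, t, .val v, k⟩ Q) (hU : t ++ T = F :: U) :
    ∃ t₀, t = F :: t₀ ∧ U = t₀ ++ T := by
  cases t with
  | nil =>
    have := (h.1 v rfl rfl).1
    simp [this] at hU
  | cons G t₀ =>
    simp only [List.cons_append, List.cons.injEq] at hU
    exact ⟨t₀, by rw [hU.1], hU.2.symm⟩

theorem red_inv (hL : Linked L M M' X X') (h : Ctl X X' NA sA T K p σ Q aux)
    (hready : Ready M' T K p Q) {A' : ProgCfg}
    (hr : Red L ⟨NA, Q.names, sA, p.t ++ T, p.e, K⟩ A') :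
    ∃ p' NA' sA', A' = ⟨NA', Q.names, sA', p'.t ++ T, p'.e, K⟩ ∧ Red M p p' ∧
      p'.names ∩ σ.names ⊆ p.names ∧ Ctl X X' NA' sA' T K p' σ Q aux := by
  obtain ⟨N, P, s, t, e, k⟩ := p
  -- Covers all moves that change neither the names nor the store.
  have pure : ∀ {t' e'}, Red M ⟨N, P, s, t, e, k⟩ ⟨N, P, s, t', e', k⟩ →
      Stack.names t' ∪ e'.names ⊆ N →
      ∃ p' NA' sA', (⟨NA, Q.names, sA, t' ++ T, e', K⟩ : ProgCfg) =
        ⟨NA', Q.names, sA', p'.t ++ T, p'.e, K⟩ ∧ Red M ⟨N, P, s, t, e, k⟩ p' ∧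
        p'.names ∩ σ.names ⊆ ProgCfg.names ⟨N, P, s, t, e, k⟩ ∧
        Ctl X X' NA' sA' T K p' σ Q aux :=
    fun hr hn => ⟨_, NA, sA, rfl, hr, h.fresh (h.congr hn) rfl, h.congr hn⟩
  have hsub := h.names_subset
  dsimp only at hr
  generalize hU : t ++ T = U at hr
  cases hr with
  | new ha =>
    subst hU
    obtain ⟨ha, ha'⟩ := (h.loc_notMem_iff _).1 ha
    refine ⟨_, _, _, rfl, .new ha, h.fresh_alloc ha' ?_, h.alloc ha' ?_⟩ <;>
    simp only [Term.names, Value.names_singleton, names_loc] at hsub ⊢ <;> grind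
  | localVar ha =>
    rename_i x e a
    subst hU
    obtain ⟨ha, ha'⟩ := (h.loc_notMem_iff _).1 ha
    have := Term.names_subst x (.ident (.loc a)) e
    refine ⟨_, _, _, rfl, .localVar ha, h.fresh_alloc ha' ?_, h.alloc ha' ?_⟩ <;>
    simp only [Term.names, Atom.names] at hsub this ⊢ <;> grind
  | assignEval =>
    obtain ⟨t, rfl, rfl⟩ := hready.split hU
    rename_i a b
    have h₁ : Ctl X X' NA (sA.setLoc a b) T K ⟨N, P, s.setLoc a b, t, .val [], k⟩ σ Q aux := by
      refine h.setLoc ?_ ?_ ?_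
      all_goals
        simp only [Stack.names_cons, Frame.names, Term.names, Value.names_nil,
          Value.names_singleton, names_loc] at hsub ⊢
        grind
    refine ⟨_, _, _, rfl, .assignEval, ?_, h₁⟩
    rw [h.names_eq, h₁.names_eq]
    exact Set.inter_subset_left
  | derefEval hb =>
    obtain ⟨t, rfl, rfl⟩ := hready.split hU
    have ha : Name.loc _ ∈ N := h.term (by simp only [Term.names, Value.names_singleton]; rfl)
    rw [h.get_loc ha] at hb
    refine pure (.derefEval hb) ?_
    have := h.core.left.atom_names hb
    simp only [Stack.names_cons, Frame.names, Term.names,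
      Value.names_singleton, ProgCfg.sys] at hsub this ⊢
    grind
  | binopEval hb =>
    obtain ⟨t, rfl, rfl⟩ := hready.split hU
    refine pure (.binopEval hb) ?_
    have := BinOp.names_eval hb
    simp only [Stack.names_cons, Frame.names, Term.names,
      Value.names_singleton] at hsub this ⊢
    grind
  | pairEval =>
    obtain ⟨t, rfl, rfl⟩ := hready.split hU
    refine pure .pairEval ?_
    simp only [Stack.names_cons, Frame.names, Term.names, Value.names_append] at hsub ⊢
    grind
  | appEval hf he =>
    obtain ⟨t, rfl, rfl⟩ := hready.split hU
    -- Readiness excludes functions of the partner, so the body comes from `M`.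
    have hf' := ((hL.fun_iff _ _).1 hf).resolve_right fun hf' => by
      rw [hready.2 _ _ _ rfl rfl] at hf'
      cases hf'
    refine pure (.appEval hf' he) ?_
    have h₁ := Func.names_inst he
    have h₂ := (hL.left _ _ hf').2
    have h₃ := h.core.left.scope
    simp only [Stack.names_cons, Frame.names, Term.names, ProgCfg.sys] at hsub h₃ ⊢
    grind
  | iteTrue hz =>
    obtain ⟨t, rfl, rfl⟩ := hready.split hU
    refine pure (.iteTrue hz) ?_
    simp only [Stack.names_cons, Frame.names, Term.names] at hsub ⊢
    grind
  | itePush | binopPush | assignPush | seqPush | derefPush | retPush | appPush | pairPush =>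
    subst hU
    rw [← List.cons_append]
    refine pure (by constructor) ?_
    simp only [Stack.names_cons, Frame.names, Term.names] at hsub ⊢
    grind
  | iteFalse | seqEval | retEval =>
    obtain ⟨t, rfl, rfl⟩ := hready.split hU
    refine pure (by constructor) ?_
    simp only [Stack.names_cons, Frame.names, Term.names] at hsub ⊢
    grind
  | _ =>
    obtain ⟨t, rfl, rfl⟩ := hready.split hU
    rw [← List.cons_append]
    refine pure (by constructor) ?_
    simp only [Stack.names_cons, Frame.names, Term.names] at hsub ⊢
    grind

end Ctl

/-! ## Transitions between components and with the System -/

theorem IdleLoc.save {σ σ' : SysCfg} {lA aux : LStore} {Q : Set Name} (h : IdleLoc σ σ' lA Q aux)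
    (k : ℕ) (c : Stack × ℕ) : IdleLoc (σ.save k c) σ' lA Q aux where
  auxN := h.auxN.trans (Set.union_subset_union_left _ Set.subset_union_left)
  auxL := by
    rintro n hn (hn' | rfl)
    · exact Or.inl (h.auxL n hn hn')
    · simp at hn
  auxR := h.auxR
  pubL a ha := h.pubL a (ha.resolve_right (by simp))
  pubR := h.pubR
  closed := h.closed
  loc := h.loc

/-- The states of the linked module that are related to a composite state. -/
inductive Rel (X X' : Set Name) : Cfg → Comp → Prop where
  | left {NA sA T K p σ Q aux} (h : Ctl X X' NA sA T K p σ Q aux) :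
      Rel X X' (.prog ⟨NA, Q.names, sA, p.t ++ T, p.e, K⟩) ⟨.prog p, .sys σ, Q, aux⟩
  | right {NA sA T K p σ Q aux} (h : Ctl X' X NA sA T K p σ Q aux) :
      Rel X X' (.prog ⟨NA, Q.names, sA, p.t ++ T, p.e, K⟩) ⟨.sys σ, .prog p, Q, aux⟩
  | idle {NA sA σ σ' Q aux} (hc : Core X X' Q.polS NA sA.cont Q.names σ σ')
      (hl : IdleLoc σ σ' sA.loc Q.names aux) :
      Rel X X' (.sys ⟨NA, Q.names, sA⟩) ⟨.sys σ, .sys σ', Q, aux⟩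

theorem Rel.swap {X X' : Set Name} {A : Cfg} {C : Comp} (h : Rel X X' A C) :
    Rel X' X A C.swap := by
  cases h with
  | left h => exact .right h
  | right h => exact .left h
  | idle hc hl => exact .idle hc.symm (hl.symm hc)

theorem Rel.pub_eq {X X' : Set Name} {A : Cfg} {C : Comp} (h : Rel X X' A C) :
    A.pub = C.pub.names := by
  cases h <;> rfl

namespace Ctl

variable {L M M' : Mod} {X X' NA : Set Name} {sA : Store} {T : Stack} {K : ℕ}
  {σ : SysCfg} {Q : Pub} {aux : LStore} {N P : Set Name} {s : Store} {t : Stack} {v : Value}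
  {k f : ℕ} {F : Frame}

/-- The partner resumes the frames saved under `k`, which are the first segment of the unfolding of
`k`. -/
theorem crossRet (h : Ctl X X' NA sA T K ⟨N, P, s, [], .val v, k⟩ σ Q aux)
    {t' T' : Stack} {k' : ℕ} (hk : σ.s.cont.get k = some (t', k'))
    (hU : Unf Q.polS σ.s.cont.get s.cont.get k' T' K) :
    let r := SysCfg.emittedStore ⟨N, P, s⟩ v
    Ctl X' X NA sA T' K
      ⟨σ.N ∪ (v.names ∪ LStore.names r), σ.P ∪ (v.names ∪ LStore.names r), σ.s.override r, t',
        .val v, k'⟩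
      ⟨N, SysCfg.emitted ⟨N, P, s⟩ v, s⟩ Q (aux.override r) where
  core := (h.core.cross h.term).symm
  loc := h.loc.cross h.core h.term
  stack _ hn := Or.inl (h.core.right.store (Or.inr ⟨k, t', k', hk, Or.inr (Or.inl hn)⟩))
  term _ hn := Or.inr (Or.inl hn)
  cont := Or.inl (h.core.right.store (Or.inr ⟨k, t', k', hk, Or.inr (Or.inr rfl)⟩))
  unf := hU

/-- The frames `t` leave the caller's stack and reappear as the first segment of the unfolding of
the new continuation. -/
theorem crossCall
    (h : Ctl X X' NA sA T K ⟨N, P, s, .appR [.ident (.fn f)] :: t, .val v, k⟩ σ Q aux) {k' : ℕ}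
    (hk : Name.cont k' ∉ N) (hk' : Name.cont k' ∉ σ.N) (hf : Name.fn f ∈ X') :
    let r := SysCfg.emittedStore ⟨N, P, s⟩ v
    Ctl X' X NA sA (t ++ T) K
      ⟨σ.N ∪ {Name.cont k'} ∪ (v.names ∪ LStore.names r),
        σ.P ∪ {Name.cont k'} ∪ (v.names ∪ LStore.names r), σ.s.override r,
        [.appR [.ident (.fn f)]], .val v, k'⟩
      ⟨N ∪ {Name.cont k'}, SysCfg.emitted ⟨N, P, s⟩ v ∪ {Name.cont k'}, s.setCont k' (t, k)⟩
      Q (aux.override r) := by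
  intro r
  have ht : Stack.names t ⊆ N := by
    have := h.stack
    rw [Stack.names_cons] at this
    exact (Set.union_subset_iff.1 this).2
  have hc := h.core.cross h.term
  have hl := h.loc.cross h.core h.term
  have hs : s.cont.get k' = none := by
    by_contra h'
    exact hk (h.core.left.cont_mem h')
  have hc' := (hc.exchange hk (by simpa [SysCfg.learn] using hk') h.cont ht).symm
  rw [Set.union_right_comm, Set.union_right_comm σ.P]
  refine ⟨hc', ?_, ?_, ?_, Or.inr rfl, ?_⟩
  · refine hl.congr ?_ ?_ ?_ rfl rfl fun _ => id
    · exact fun a ha => ha.resolve_right (by simp)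
    · exact fun a => ⟨fun ha => ha.resolve_right (by simp), Or.inl⟩
    · exact fun a ha => ha.resolve_right (by simp)
  · rintro n hn
    simp only [Stack.names_cons, Frame.names, Stack.names_nil, Set.union_empty,
      Value.names_singleton] at hn
    cases hn
    exact Or.inl (Or.inl (h.core.right.scope hf))
  · exact fun _ hn => Or.inl (Or.inr (Or.inl hn))
  · refine .step (κ' := (s.setCont k' (t, k)).cont.get) (k₁ := k) ?_ ?_
    · simp [Store.setCont, FinPMap.get_set]
    · exact h.unf.mono subset_rfl (Core.get_cont_setCont hs _) fun _ _ => id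

theorem names_updP (h : Ctl X X' NA sA T K ⟨N, P, s, t, .val v, k⟩ σ Q aux) (α : Act)
    (hα : α.value = v) :
    (Q.updP α (aux.override (SysCfg.emittedStore ⟨N, P, s⟩ v))).names =
      {n | Cl sA.loc (Q.names ∪ v.names) n} ∪ Name.cont '' α.newCont := by
  ext n
  simp only [Pub.updP, hα, Set.mem_union, Set.mem_ofPred_eq]
  exact or_congr_left (h.loc.cl_iff h.core h.term n).symm

/-- The composite computes its label from the auxiliary store and the linked machine from its full
store; they agree on the closure of the public names. -/
theorem label_eq (h : Ctl X X' NA sA T K ⟨N, P, s, t, .val v, k⟩ σ Q aux) (α : Act)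
    (hα : α.value = v) :
    sA.loc.restrict (locs {n | Cl sA.loc (Q.names ∪ v.names) n}) =
      (aux.override (SysCfg.emittedStore ⟨N, P, s⟩ v)).restrict
        (locs (Q.updP α (aux.override (SysCfg.emittedStore ⟨N, P, s⟩ v))).names) := by
  refine h.loc.restrict_eq h.core h.term rfl fun a => ?_
  rw [h.names_updP α hα]
  simp

theorem progRet (h : Ctl X X' NA sA T K ⟨N, P, s, [], .val v, k⟩ σ Q aux) :
    Rel X X' (.sys ⟨NA, {n | Cl sA.loc (Q.names ∪ v.names) n}, sA⟩)
      ⟨.sys ⟨N, SysCfg.emitted ⟨N, P, s⟩ v, s⟩, .sys σ,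
        Q.updP (.ret v k) (aux.override (SysCfg.emittedStore ⟨N, P, s⟩ v)),
        aux.override (SysCfg.emittedStore ⟨N, P, s⟩ v)⟩ := by
  have hQ := h.names_updP (.ret v k) rfl
  simp only [Act.newCont, Set.image_empty, Set.union_empty] at hQ
  rw [← hQ]
  have hE := SysCfg.pub_subset_emitted ⟨N, P, s⟩ v
  have hc := h.core.publish hE (h.core.left.emitted_subset h.term)
  refine .idle (hc.setPub ?_) (h.loc.toIdle h.core h.term _)
  rw [hQ]
  intro n hn
  rcases h.loc.loc_mem_emitted h.core h.term hn with h' | h'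
  · exact Or.inl h'
  · exact hc.pubSub h'

theorem progCall
    (h : Ctl X X' NA sA T K ⟨N, P, s, F :: t, .val v, k⟩ σ Q aux) {k' : ℕ}
    (hk : Name.cont k' ∉ N) (hk' : Name.cont k' ∉ σ.N) :
    Rel X X' (.sys ⟨NA ∪ {Name.cont k'},
        {n | Cl sA.loc (Q.names ∪ v.names) n} ∪ {Name.cont k'}, sA.setCont k' (t ++ T, K)⟩)
      ⟨.sys ⟨N ∪ {Name.cont k'}, SysCfg.emitted ⟨N, P, s⟩ v ∪ {Name.cont k'},
          s.setCont k' (t, k)⟩, .sys σ,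
        Q.updP (.call f v k') (aux.override (SysCfg.emittedStore ⟨N, P, s⟩ v)),
        aux.override (SysCfg.emittedStore ⟨N, P, s⟩ v)⟩ := by
  have hQ := h.names_updP (.call f v k') rfl
  simp only [Act.newCont, Set.image_singleton] at hQ
  have hE := SysCfg.pub_subset_emitted ⟨N, P, s⟩ v
  have ht : Stack.names t ⊆ N := by
    have := h.stack
    rw [Stack.names_cons] at this
    exact (Set.union_subset_iff.1 this).2
  have hc := h.core.publish hE (h.core.left.emitted_subset h.term)
  have hc' : Core X X' Q.polS NA sA.cont {n | Cl sA.loc (Q.names ∪ v.names) n} _ σ :=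
    hc.setPub fun n hn => by
      rcases h.loc.loc_mem_emitted h.core h.term hn with h' | h'
      · exact Or.inl h'
      · exact hc.pubSub h'
  have hc₂ := hc'.release hk hk' h.cont ht h.unf
  rw [← hQ] at hc₂ ⊢
  exact .idle hc₂ ((h.loc.toIdle h.core h.term _).save k' (t, k))

end Ctl

/-! ### System moves and the related states they lead to -/

section

variable {L M M' : Mod} {X X' NA : Set Name} {sA : Store} {T : Stack} {K : ℕ}
  {σ σ' : SysCfg} {Q : Pub} {aux s : LStore} {t : Stack} {v : Value} {k k' f : ℕ} {pr : Set Name}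

theorem Pub.names_updS_ret (Q : Pub) (pr : Set Name) (s : LStore) (v : Value) (k : ℕ) :
    (Q.updS pr (.ret v k) s).names =
      Q.names ∪ (v.names ∪ LStore.names (s.restrict (locs prᶜ))) := by
  simp [Pub.updS, Act.newCont, Act.value]

theorem Pub.names_updS_call (Q : Pub) (pr : Set Name) (s : LStore) (f : ℕ) (v : Value) (k : ℕ) :
    (Q.updS pr (.call f v k) s).names =
      Q.names ∪ {Name.cont k} ∪ (v.names ∪ LStore.names (s.restrict (locs prᶜ))) := by
  simp only [Pub.updS, Act.newCont, Act.value, Set.image_singleton]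
  rw [Set.union_right_comm]

theorem Rel.sysRet (hc : Core X X' Q.polS NA sA.cont Q.names σ σ')
    (hl : IdleLoc σ σ' sA.loc Q.names aux)
    (hk : σ.s.cont.get k' = some (t, k)) (hU : Unf Q.polS σ.s.cont.get σ'.s.cont.get k T K)
    (hm : SysMay σ.N σ.P v s) (hpr : pr = (σ.N ∪ σ'.N) \ Q.names)
    (hu : SysUpd Q pr aux (.ret v k') s) :
    let r := s.restrict (locs prᶜ)
    Rel X X' (.prog ⟨NA ∪ (v.names ∪ LStore.names r), Q.names ∪ (v.names ∪ LStore.names r),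
        sA.override r, t ++ T, .val v, K⟩)
      ⟨.prog ⟨σ.N ∪ (v.names ∪ LStore.names s), σ.P ∪ (v.names ∪ LStore.names s),
          σ.s.override s, t, .val v, k⟩, .sys σ', Q.updS pr (.ret v k') s, aux.override s⟩ := by
  intro r
  have hcl := hl.core_learn hc hpr hu
  have hll := hl.toCtl hc (α := .ret v k') hm hpr hu
  rw [← Q.names_updS_ret pr s v k']
  refine .left (Q := Q.updS pr (.ret v k') s)
    (p := ⟨σ.N ∪ (v.names ∪ LStore.names s), σ.P ∪ (v.names ∪ LStore.names s),
      σ.s.override s, t, .val v, k⟩) ⟨?_, ?_, ?_, ?_, ?_, ?_⟩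
  · rw [Q.names_updS_ret]
    have : (Q.updS pr (.ret v k') s).polS = Q.polS := by simp [Pub.updS, Act.newCont]
    rw [this]
    refine hcl.setPub ?_
    refine Set.union_subset hcl.pubSub fun n hn => Or.inl (Or.inr ?_)
    exact hn.imp_right fun h => LStore.names_restrict _ _ h
  · rw [Q.names_updS_ret]
    exact hll
  · exact fun _ hn => Or.inl (hc.left.store (Or.inr ⟨k', t, k, hk, Or.inr (Or.inl hn)⟩))
  · exact fun _ hn => Or.inr (Or.inl hn)
  · exact Or.inl (hc.left.store (Or.inr ⟨k', t, k, hk, Or.inr (Or.inr rfl)⟩))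
  · exact hU.mono Set.subset_union_left (fun _ _ => id) fun _ _ => id

theorem Rel.sysCall (hc : Core X X' Q.polS NA sA.cont Q.names σ σ')
    (hl : IdleLoc σ σ' sA.loc Q.names aux) (hf : Name.fn f ∈ X)
    (hk : σ.s.cont.get k = none) (hk' : Name.cont k ∈ σ'.N → k ∈ Q.polS)
    (hm : SysMay σ.N σ.P v s) (hpr : pr = (σ.N ∪ σ'.N) \ Q.names)
    (hu : SysUpd Q pr aux (.call f v k) s) :
    let r := s.restrict (locs prᶜ)
    Rel X X' (.prog ⟨NA ∪ {Name.cont k} ∪ (v.names ∪ LStore.names r),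
        Q.names ∪ {Name.cont k} ∪ (v.names ∪ LStore.names r),
        sA.override r, [.appR [.ident (.fn f)]], .val v, k⟩)
      ⟨.prog ⟨σ.N ∪ {Name.cont k} ∪ (v.names ∪ LStore.names s),
          σ.P ∪ {Name.cont k} ∪ (v.names ∪ LStore.names s),
          σ.s.override s, [.appR [.ident (.fn f)]], .val v, k⟩, .sys σ',
        Q.updS pr (.call f v k) s, aux.override s⟩ := by
  intro r
  have hcl := (hl.core_learn hc hpr hu).receive hk hk'
  have hll := hl.toCtl hc (α := .call f v k) hm hpr hu
  rw [← Q.names_updS_call pr s f v k]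
  -- A continuation received from the System unfolds to itself, so `T` is empty.
  refine .left (Q := Q.updS pr (.call f v k) s) (T := [])
    (p := ⟨σ.N ∪ {Name.cont k} ∪ (v.names ∪ LStore.names s),
          σ.P ∪ {Name.cont k} ∪ (v.names ∪ LStore.names s),
          σ.s.override s, [.appR [.ident (.fn f)]], .val v, k⟩) ?_
  rw [Set.union_right_comm, Set.union_right_comm σ.N, Set.union_right_comm σ.P]
  refine ⟨?_, ?_, ?_, ?_, ?_, ?_⟩
  · rw [Q.names_updS_call]
    refine hcl.setPub ?_
    refine Set.union_subset hcl.pubSub fun n hn => Or.inl (Or.inl (Or.inr ?_))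
    exact hn.imp_right fun h => LStore.names_restrict _ _ h
  · rw [Q.names_updS_call]
    refine hll.congr ?_ ?_ ?_ rfl rfl ?_
    · exact fun a ha => ha.resolve_right (by simp)
    · exact fun a => ⟨fun ha => ha.resolve_right (by simp), Or.inl⟩
    · exact fun a ha => ha
    · rintro a ((ha | ha) | ha)
      · exact Or.inl ha
      · simp at ha
      · exact Or.inr ha
  · rintro n hn
    simp only [Stack.names_cons, Frame.names, Stack.names_nil, Set.union_empty,
      Value.names_singleton] at hn
    cases hn
    exact Or.inl (Or.inl (hc.left.scope hf))
  · exact fun _ hn => Or.inl (Or.inr (Or.inl hn))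
  · exact Or.inr rfl
  · exact .base (Or.inr rfl)

end

/-! ## The linked module simulates the composition -/

section

variable {L M M' : Mod} {X X' NA : Set Name} {S : Set ℕ} {cA : FinPMap (Stack × ℕ)} {Qn : Set Name}
  {sA : Store} {σ σ' : SysCfg} {Q : Pub} {aux : LStore} {T : Stack} {K : ℕ} {p : ProgCfg}
  {A A' : Cfg} {C C' : Comp} {ℓ : Label}

/-- If the linked machine had saved `k`, one of the components would have; for `σ'` this fails
because `k` would be a System continuation. -/
theorem Core.cont_free (h : Core X X' S NA cA Qn σ σ') {k : ℕ} (hk : σ.s.cont.get k = none)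
    (hk' : Name.cont k ∈ σ'.N → k ∈ S) : cA.get k = none := by
  by_contra hc
  rcases h.saved k hc with h' | h'
  · exact h'.1 hk
  · exact h'.1 (h.right.pol k (hk' (h.right.cont_mem h'.1)))

theorem Ctl.cont_notMem (h : Ctl X X' NA sA T K p σ Q aux) {k : ℕ} (hk : Name.cont k ∉ p.N)
    (hk' : Name.cont k ∉ σ.N) : Name.cont k ∉ NA :=
  fun hc => (h.core.contUsed k hc).elim hk hk'

theorem Half.cont_notMem (h : Half X S cA σ σ') {k : ℕ} (hk : Name.cont k ∉ σ.names) :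
    Name.cont k ∉ σ.N := by
  rwa [h.names_eq] at hk

theorem Ctl.fn_mem_pub {N P : Set Name} {s : Store} {t : Stack} {e : Term} {f k : ℕ}
    (h : Ctl X X' NA sA T K ⟨N, P, s, .appR [.ident (.fn f)] :: t, e, k⟩ σ Q aux)
    (hf : Name.fn f ∈ σ.N) : Name.fn f ∈ σ.P := by
  refine h.core.right.share _ hf (h.stack ?_)
  rw [Stack.names_cons]
  left
  rw [Frame.names, Value.names_singleton]
  rfl

/-- The negative premise of the composition rule can fail to hold only if `M'` defines `f`, since
the partner accepts all data and fresh continuations. Hence `f` is undefined in the linked module.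
-/
theorem Ctl.step_progCall {N P : Set Name} {s : Store} {t : Stack} {f k k' : ℕ} {v : Value}
    (hL : Linked L M M' X X')
    (hc : Ctl X X' NA sA T K ⟨N, P, s, .appR [.ident (.fn f)] :: t, .val v, k⟩ σ Q aux)
    (hf : M.fun? f = none) (hk : Name.cont k' ∉ N) (hk' : Name.cont k' ∉ σ.N)
    (h' : ∀ X, ¬ Step M' (.sys σ)
      (.sp (.call f v k') (SysCfg.emittedStore ⟨N, P, s⟩ v)) X) :
    ∃ A', Step L (.prog ⟨NA, Q.names, sA, .appR [.ident (.fn f)] :: t ++ T, .val v, K⟩)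
      (.ps (.call f v k') ((aux.override (SysCfg.emittedStore ⟨N, P, s⟩ v)).restrict
        (locs (Q.updP (.call f v k')
          (aux.override (SysCfg.emittedStore ⟨N, P, s⟩ v))).names))) A' ∧
      Rel X X' A' ⟨.sys ⟨N ∪ {Name.cont k'}, SysCfg.emitted ⟨N, P, s⟩ v ∪ {Name.cont k'},
          s.setCont k' (t, k)⟩, .sys σ,
        Q.updP (.call f v k') (aux.override (SysCfg.emittedStore ⟨N, P, s⟩ v)),
        aux.override (SysCfg.emittedStore ⟨N, P, s⟩ v)⟩ := by
  have hf' : M'.fun? f = none := by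
    by_contra hf'
    refine h' _ (.spCall hf' hc.fn_mem_pub (fun hd => ?_) (hc.loc.sysMay hc.core hc.term))
    exact hk' (hc.core.right.cont_mem hd)
  have hstep := Step.psCall (M := L) (N := NA) (P := Q.names) (s := sA) (t := t ++ T) (v := v)
    (k := K) ((hL.fun_eq_none f).2 ⟨hf, hf'⟩) (hc.cont_notMem hk hk') rfl
  rw [hc.label_eq (.call f v k') rfl] at hstep
  exact ⟨_, hstep, hc.progCall hk hk'⟩

/-- If `k` were saved by the partner, the partner would accept the return. So `k` belongs to the
System and `T` is empty. -/
theorem Ctl.step_progRet {N P : Set Name} {s : Store} {k : ℕ} {v : Value}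
    (hc : Ctl X X' NA sA T K ⟨N, P, s, [], .val v, k⟩ σ Q aux)
    (h' : ∀ X, ¬ Step M' (.sys σ) (.sp (.ret v k) (SysCfg.emittedStore ⟨N, P, s⟩ v)) X) :
    ∃ A', Step L (.prog ⟨NA, Q.names, sA, T, .val v, K⟩)
      (.ps (.ret v k) ((aux.override (SysCfg.emittedStore ⟨N, P, s⟩ v)).restrict
        (locs (Q.updP (.ret v k) (aux.override (SysCfg.emittedStore ⟨N, P, s⟩ v))).names))) A' ∧
      Rel X X' A' ⟨.sys ⟨N, SysCfg.emitted ⟨N, P, s⟩ v, s⟩, .sys σ,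
        Q.updP (.ret v k) (aux.override (SysCfg.emittedStore ⟨N, P, s⟩ v)),
        aux.override (SysCfg.emittedStore ⟨N, P, s⟩ v)⟩ := by
  rcases hc.unf.cases' with ⟨-, rfl, hK⟩ | ⟨t, k₁, T', h₁, -, -⟩
  · dsimp only at hK
    subst hK
    have hstep := Step.psRet (M := L) (N := NA) (P := Q.names) (s := sA) (v := v) (k := K) rfl
    rw [hc.label_eq (.ret v K) rfl] at hstep
    exact ⟨_, hstep, hc.progRet⟩
  · exact absurd (.spRet h₁ (hc.loc.sysMay hc.core hc.term)) (h' _)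

theorem Rel.step_sysCall {s : LStore} {f k : ℕ} {v : Value} {pr : Set Name}
    (hL : Linked L M M' X X') (hc : Core X X' Q.polS NA sA.cont Q.names σ σ')
    (hl : IdleLoc σ σ' sA.loc Q.names aux) (hf : M.fun? f ≠ none) (hk : k ∉ σ.s.cont.dom)
    (hm : SysMay σ.N σ.P v s) (hpr : pr = (σ.names ∪ σ'.names) \ Q.names)
    (hu : SysUpd Q pr aux (.call f v k) s)
    (hk' : Name.cont k ∉ σ'.names \ Name.cont '' Q.polS) :
    ∃ A', Step L (.sys ⟨NA, Q.names, sA⟩)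
      (.sp (.call f v k) (s.restrict (locs (Q.updS pr (.call f v k) s).names))) A' ∧
      Rel X X' A' ⟨.prog ⟨σ.N ∪ {Name.cont k} ∪ (v.names ∪ LStore.names s),
          σ.P ∪ {Name.cont k} ∪ (v.names ∪ LStore.names s),
          σ.s.override s, [.appR [.ident (.fn f)]], .val v, k⟩, .sys σ',
        Q.updS pr (.call f v k) s, aux.override s⟩ := by
  rw [hc.left.names_eq, hc.right.names_eq] at hpr
  rw [hc.right.names_eq] at hk'
  have hk₁ : σ.s.cont.get k = none := by simpa using hk
  have hk₂ : Name.cont k ∈ σ'.N → k ∈ Q.polS := by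
    intro h
    by_contra h'
    exact hk' ⟨h, by simpa using h'⟩
  obtain ⟨d, hd⟩ := Option.ne_none_iff_exists'.1 hf
  have hfX := (hL.left _ _ hd).1
  have hm' := IdleLoc.sysMay hc (α := .call f v k) hm hpr hu
  have hstep := Step.spCall (M := L) (f := f) (k := k) (s := sA)
    (by rw [(hL.fun_iff f d).2 (Or.inl hd)]; simp) (fun _ => ?_) ?_ hm'
  · subst hpr
    rw [Pub.restrict_updS hu]
    exact ⟨_, hstep, .sysCall hc hl hfX hk₁ hk₂ hm rfl hu⟩
  · by_contra hQ
    exact Set.disjoint_left.1 hu.2.2.2.2 (Or.inl (Or.inl rfl))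
      (hpr ▸ ⟨Or.inl (hc.left.scope hfX), hQ⟩)
  · simpa using hc.cont_free hk₁ hk₂

theorem Rel.step_sysRet {s : LStore} {k k' : ℕ} {t : Stack} {v : Value} {pr : Set Name}
    (hc : Core X X' Q.polS NA sA.cont Q.names σ σ')
    (hl : IdleLoc σ σ' sA.loc Q.names aux) (hk : σ.s.cont.get k' = some (t, k))
    (hm : SysMay σ.N σ.P v s) (hpr : pr = (σ.names ∪ σ'.names) \ Q.names)
    (hu : SysUpd Q pr aux (.ret v k') s) (hk' : Name.cont k' ∉ σ'.names) :
    ∃ A', Step L (.sys ⟨NA, Q.names, sA⟩)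
      (.sp (.ret v k') (s.restrict (locs (Q.updS pr (.ret v k') s).names))) A' ∧
      Rel X X' A' ⟨.prog ⟨σ.N ∪ (v.names ∪ LStore.names s), σ.P ∪ (v.names ∪ LStore.names s),
          σ.s.override s, t, .val v, k⟩, .sys σ', Q.updS pr (.ret v k') s, aux.override s⟩ := by
  rw [hc.left.names_eq, hc.right.names_eq] at hpr
  rw [hc.right.names_eq] at hk'
  obtain ⟨T, K, hA, hU⟩ := hc.left.conts _ _ _ hk hk'
  have hstep := Step.spRet (M := L) hA (IdleLoc.sysMay hc (α := .ret v k') hm hpr hu)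
  subst hpr
  rw [Pub.restrict_updS hu]
  exact ⟨_, hstep, .sysRet hc hl hk hU hm rfl hu⟩

/-- Synchronisations are answered by staying put, because they only redistribute the glued stack and
store; every other rule corresponds to one rule of the linked machine. -/
theorem Rel.stepL (hL : Linked L M M' X X') (hr : Rel X X' A C) (hs : StepL M M' C ℓ C') :
    (ℓ = .tau ∧ Rel X X' A C') ∨ ∃ A', Step L A ℓ A' ∧ Rel X X' A' C' := by
  cases hs with
  | int h hn =>
    cases hr with
    | left hc =>
      cases h with
      | int h =>
        obtain ⟨NA', sA', h₁, h₂⟩ := hc.red hL h hn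
        exact Or.inr ⟨_, .int h₁, .left h₂⟩
  | crossCall h h' hk =>
    cases hr with
    | left hc =>
      have hk₂ := hc.core.right.cont_notMem hk
      cases h with
      | psCall hf hk₁ hP =>
        subst hP
        cases h' with
        | spCall hf' hfP hdom hm =>
          obtain ⟨d, hd⟩ := Option.ne_none_iff_exists'.1 hf'
          exact Or.inl ⟨rfl, .right (hc.crossCall hk₁ hk₂ (hL.right _ _ hd).1)⟩
  | crossRet h h' =>
    cases hr with
    | left hc =>
      cases h with
      | psRet hP =>
        subst hP
        cases h' with
        | spRet hk hm =>
          left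
          refine ⟨rfl, ?_⟩
          -- The first case is impossible: the partner saves no System continuation. In the second,
          -- the saved frames are those of the unfolding.
          rcases hc.unf.cases' with ⟨h₁, -, -⟩ | ⟨t, k₁, T', h₁, rfl, hU⟩
          · cases hk.symm.trans (hc.core.right.pol _ h₁)
          · cases hk.symm.trans h₁
            exact .right (hc.crossRet h₁ hU)
  | progCall h h' hs hQ hk =>
    subst hs hQ
    cases hr with
    | left hc =>
      cases h with
      | psCall hf hk₁ hP =>
        subst hP
        exact Or.inr (hc.step_progCall hL hf hk₁ (hc.core.right.cont_notMem hk) h')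
  | progRet h h' hs hQ =>
    subst hs hQ
    cases hr with
    | left hc =>
      cases h with
      | psRet hP =>
        subst hP
        exact Or.inr (hc.step_progRet h')
  | sysCall h hpr hs hQ hk =>
    subst hQ
    cases hr with
    | idle hc hl =>
      cases h with
      | spCall hf hfP hdom hm => exact Or.inr (Rel.step_sysCall hL hc hl hf hdom hm hpr hs hk)
  | sysRet h hpr hs hQ hk =>
    subst hQ
    cases hr with
    | idle hc hl =>
      cases h with
      | spRet hk' hm => exact Or.inr (Rel.step_sysRet hc hl hk' hm hpr hs hk)

theorem Rel.compStep (hL : Linked L M M' X X') (hr : Rel X X' A C) (hs : CompStep M M' C ℓ C') :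
    (ℓ = .tau ∧ Rel X X' A C') ∨ ∃ A', Step L A ℓ A' ∧ Rel X X' A' C' := by
  rcases hs with hs | hs
  · exact hr.stepL hL hs
  · rcases hr.swap.stepL hL.symm hs with ⟨h₁, h₂⟩ | ⟨A', h₁, h₂⟩
    · exact Or.inl ⟨h₁, h₂.swap⟩
    · exact Or.inr ⟨A', h₁, h₂.swap⟩

/-! ## The composition simulates the linked module -/

theorem Comp.bound_swap (C : Comp) : C.swap.bound = C.bound := by
  simp only [Comp.bound, Comp.swap, Set.inter_comm]

theorem CompStep.swap (h : CompStep M' M C.swap ℓ C') : CompStep M M' C ℓ C'.swap :=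
  Or.symm h

theorem tauStar_swap {C C' : Comp} (h : (semComp M' M).TauStar C C') :
    (semComp M M').TauStar C.swap C'.swap := by
  induction h with
  | refl => exact .refl
  | tail _ h ih => exact ih.tail (CompStep.swap (C := Comp.swap _) h)

/-- Calls of the left component that the System makes. -/
theorem Rel.idle_call_left (hL : Linked L M M' X X')
    (hc : Core X X' Q.polS NA sA.cont Q.names σ σ') (hl : IdleLoc σ σ' sA.loc Q.names aux)
    {f k : ℕ} {v : Value} {s : LStore} (hf : M.fun? f ≠ none)
    (hfP : Name.fn f ∈ NA → Name.fn f ∈ Q.names) (hk : sA.cont.get k = none)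
    (hb : Name.cont k ∉ Comp.bound ⟨.sys σ, .sys σ', Q, aux⟩) (hm : SysMay NA Q.names v s) :
    ∃ C', StepL M M' ⟨.sys σ, .sys σ', Q, aux⟩ (.sp (.call f v k) s) C' ∧
      Rel X X' (.prog ⟨NA ∪ {Name.cont k} ∪ (v.names ∪ LStore.names s),
        Q.names ∪ {Name.cont k} ∪ (v.names ∪ LStore.names s),
        sA.override s, [.appR [.ident (.fn f)]], .val v, k⟩) C' := by
  have hb' : Name.cont k ∈ σ.N → Name.cont k ∈ σ'.N → k ∈ Q.polS := by
    intro h₁ h₂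
    by_contra h₃
    exact hb ⟨k, rfl, ⟨hc.left.contPub k h₁, hc.right.contPub k h₂⟩, h₃⟩
  -- A saved name known to both would be the System's, as it is not bound, against `pol`. A saved
  -- name unknown to `σ'` would also be saved by the linked machine.
  have hk₁ : σ.s.cont.get k = none := by
    by_contra h
    have hN := hc.left.cont_mem h
    obtain ⟨⟨t, k₁⟩, h'⟩ := Option.ne_none_iff_exists'.1 h
    by_cases hN' : Name.cont k ∈ σ'.N
    · exact h (hc.left.pol k (hb' hN hN'))
    · obtain ⟨T, K, hA, -⟩ := hc.left.conts k t k₁ h' hN'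
      rw [hk] at hA
      cases hA
  have hk₂ : Name.cont k ∈ σ'.N → k ∈ Q.polS := by
    intro h
    rcases hc.right.split k h with h' | h' | h'
    · exact h'
    · exact absurd hk h'
    · exact hb' h'.1 h
  obtain ⟨d, hd⟩ := Option.ne_none_iff_exists'.1 hf
  have hfX := (hL.left _ _ hd).1
  have hu := hl.sysUpd_supply hc (α := .call f v k) hm rfl (fun n hn hn' => ?_) ?_
  · have hr := hl.restrict_supply hc hm rfl
    have hm' := hl.sysMay_supply hc hm
    have hrel := Rel.sysCall hc hl hfX hk₁ hk₂ hm' rfl hu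
    have hlab := Pub.restrict_updS hu
    rw [hr] at hlab
    simp only [hr] at hrel
    have hstep := StepL.sysCall (M' := M') (σ' := σ') (.spCall hf (fun hN => ?_)
      (by simpa using hk₁) hm') ?_ hu rfl ?_
    · rw [hlab] at hstep
      exact ⟨_, hstep, hrel⟩
    · rcases hc.pubSub (hfP ((hc.ident _).2 (Or.inl hN))) with h | h
      · exact h
      · exact hc.left.share _ hN (hc.right.pub h)
    · rw [hc.left.names_eq, hc.right.names_eq]
    · rw [hc.right.names_eq]
      exact fun h => h.2 ⟨k, hk₂ h.1, rfl⟩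
  · rcases hn with rfl | hn
    · exact hfP hn'
    · exact hm.1 ⟨Or.inl hn, hn'⟩
  · intro k' h
    simp [Act.dataNames] at h

/-- Returns of the System to the left component. -/
theorem Rel.idle_ret_left
    (hc : Core X X' Q.polS NA sA.cont Q.names σ σ') (hl : IdleLoc σ σ' sA.loc Q.names aux)
    {k k' : ℕ} {t : Stack} {v : Value} {s : LStore} (hk : sA.cont.get k' = some (t, k))
    (hk₁ : σ.s.cont.get k' ≠ none) (hk₂ : Name.cont k' ∉ σ'.N) (hm : SysMay NA Q.names v s) :
    ∃ C', StepL M M' ⟨.sys σ, .sys σ', Q, aux⟩ (.sp (.ret v k') s) C' ∧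
      Rel X X' (.prog ⟨NA ∪ (v.names ∪ LStore.names s), Q.names ∪ (v.names ∪ LStore.names s),
        sA.override s, t, .val v, k⟩) C' := by
  obtain ⟨⟨t', k₁⟩, hσ⟩ := Option.ne_none_iff_exists'.1 hk₁
  obtain ⟨T, K, hA, hU⟩ := hc.left.conts _ _ _ hσ hk₂
  cases hk.symm.trans hA
  have hu := hl.sysUpd_supply hc (α := .ret v k') hm rfl (fun n hn hn' => hm.1 ⟨Or.inl hn, hn'⟩) ?_
  · have hr := hl.restrict_supply hc hm rfl
    have hm' := hl.sysMay_supply hc hm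
    have hrel := Rel.sysRet hc hl hσ hU hm' rfl hu
    have hlab := Pub.restrict_updS hu
    rw [hr] at hlab
    simp only [hr] at hrel
    have hstep := StepL.sysRet (M := M) (M' := M') (σ' := σ') (.spRet hσ hm') ?_ hu rfl ?_
    · rw [hlab] at hstep
      exact ⟨_, hstep, hrel⟩
    · rw [hc.left.names_eq, hc.right.names_eq]
    · rwa [hc.right.names_eq]
  · intro k' h
    simp [Act.dataNames] at h

theorem Rel.idle_step (hL : Linked L M M' X X')
    (hc : Core X X' Q.polS NA sA.cont Q.names σ σ') (hl : IdleLoc σ σ' sA.loc Q.names aux)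
    (hs : Step L (.sys ⟨NA, Q.names, sA⟩) ℓ A')
    (hd : Disjoint ℓ.names (Comp.bound ⟨.sys σ, .sys σ', Q, aux⟩)) :
    ∃ C', CompStep M M' ⟨.sys σ, .sys σ', Q, aux⟩ ℓ C' ∧ Rel X X' A' C' := by
  have hl' := hl.symm hc
  cases hs with
  | spCall hf hfP hk hm =>
    rename_i f v k s
    have hk' : sA.cont.get k = none := by simpa using hk
    have hb : Name.cont k ∉ Comp.bound ⟨.sys σ, .sys σ', Q, aux⟩ :=
      Set.disjoint_left.1 hd (Or.inl (Or.inl (Or.inr rfl)))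
    by_cases hM : M.fun? f = none
    · have hM' : M'.fun? f ≠ none := fun h => hf ((hL.fun_eq_none f).2 ⟨hM, h⟩)
      obtain ⟨C', h₁, h₂⟩ := Rel.idle_call_left hL.symm hc.symm hl' hM' hfP hk'
        (by rw [← Comp.bound_swap]; exact hb) hm
      exact ⟨C'.swap, Or.inr h₁, h₂.swap⟩
    · obtain ⟨C', h₁, h₂⟩ := Rel.idle_call_left hL hc hl hM hfP hk' hb hm
      exact ⟨C', Or.inl h₁, h₂⟩
  | spRet hk hm =>
    rcases hc.saved _ (by rw [hk]; simp) with h | h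
    · obtain ⟨C', h₁, h₂⟩ := Rel.idle_ret_left (M := M) (M' := M') hc hl hk h.1 h.2 hm
      exact ⟨C', Or.inl h₁, h₂⟩
    · obtain ⟨C', h₁, h₂⟩ := Rel.idle_ret_left (M := M') (M' := M) hc.symm hl' hk h.1 h.2 hm
      exact ⟨C'.swap, Or.inr h₁, h₂.swap⟩

/-- The left component of `C` has control and makes the next move of the linked module, in
state `A`; the continuation name `k₀` is not used in `C`. -/
def ReadyAt (M' : Mod) (X X' : Set Name) (k₀ : ℕ) (A : Cfg) (C : Comp) : Prop :=
  ∃ NA sA T K p σ Q aux, A = .prog ⟨NA, Q.names, sA, p.t ++ T, p.e, K⟩ ∧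
    C = ⟨.prog p, .sys σ, Q, aux⟩ ∧ Ctl X X' NA sA T K p σ Q aux ∧ Ctl.Ready M' T K p Q ∧
    Name.cont k₀ ∉ p.N ∧ Name.cont k₀ ∉ σ.N

/-- At a ready state the move of the linked machine is enabled in the component in control, and its
partner cannot intercept it: the partner lacks the called function, or has not saved the
continuation. -/
theorem ReadyAt.step (hL : Linked L M M' X X') {k₀ : ℕ} (h : ReadyAt M' X X' k₀ A C)
    (hs : Step L A ℓ A') (hk₀ : ∀ f v k s, ℓ = .ps (.call f v k) s → k = k₀) :
    ∃ C', StepL M M' C ℓ C' ∧ Rel X X' A' C' := by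
  obtain ⟨NA, sA, T, K, p, σ, Q, aux, rfl, rfl, h, hready, hN, hσ⟩ := h
  generalize hA : Cfg.prog ⟨NA, Q.names, sA, p.t ++ T, p.e, K⟩ = A at hs
  cases hs with
  | int hr =>
    cases hA
    obtain ⟨p', NA', sA', rfl, h₁, h₂, h₃⟩ := h.red_inv hL hready hr
    exact ⟨_, .int (.int h₁) h₂, .left h₃⟩
  | psCall hf hk hP =>
    obtain ⟨N, P, s, t, e, k⟩ := p
    simp only [Cfg.prog.injEq, ProgCfg.mk.injEq] at hA
    obtain ⟨rfl, rfl, rfl, hU, rfl, rfl⟩ := hA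
    subst hP
    obtain rfl := hk₀ _ _ _ _ rfl
    obtain ⟨t, rfl, rfl⟩ := hready.split hU
    have hf' := (hL.fun_eq_none _).1 hf
    rw [h.label_eq (.call _ _ _) rfl]
    refine ⟨_, .progCall (.psCall hf'.1 hN rfl) ?_ rfl rfl ?_, h.progCall hN hσ⟩
    · intro X hX
      cases hX with
      | spCall hf'' => exact hf'' hf'.2
    · rwa [h.core.right.names_eq]
  | psRet hP =>
    obtain ⟨N, P, s, t, e, k⟩ := p
    simp only [Cfg.prog.injEq, ProgCfg.mk.injEq, List.append_eq_nil_iff] at hA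
    obtain ⟨rfl, rfl, rfl, ⟨rfl, rfl⟩, rfl, rfl⟩ := hA
    subst hP
    obtain ⟨-, hK, hS⟩ := hready.1 _ rfl rfl
    dsimp only at hK hS
    subst hK
    rw [h.label_eq (.ret _ _) rfl]
    refine ⟨_, .progRet (.psRet rfl) ?_ rfl rfl, h.progRet⟩
    intro X hX
    cases hX with
    | spRet hk =>
      have := h.core.right.pol _ hS
      rw [hk] at this
      cases this
  | spCall => cases hA
  | spRet => cases hA

/-! ### Synchronisations that precede a move of the linked module -/

theorem exists_fresh_cont {N N' : Set Name} (h : {k | Name.cont k ∈ N}.Finite)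
    (h' : {k | Name.cont k ∈ N'}.Finite) (F : Finset ℕ) :
    ∃ k, Name.cont k ∉ N ∧ Name.cont k ∉ N' ∧ k ∉ F := by
  obtain ⟨k, hk⟩ := ((h.union h').union F.finite_toSet).exists_notMem
  simp only [Set.mem_union, not_or] at hk
  exact ⟨k, hk.1.1, hk.1.2, hk.2⟩

/-- A component that has control and is about to call the other component does so. -/
theorem Ctl.normalize_call {k₀ : ℕ} (hL : Linked L M M' X X')
    (h : Ctl X X' NA sA T K p σ Q aux)
    (hret : ∀ v, p.e = .val v → p.t = [] → T = [] ∧ K = p.k ∧ p.k ∈ Q.polS)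
    (hN : Name.cont k₀ ∉ p.N) (hσ : Name.cont k₀ ∉ σ.N) :
    ∃ C, (semComp M M').TauStar (⟨.prog p, .sys σ, Q, aux⟩ : Comp) C ∧
      (ReadyAt M' X X' k₀ (.prog ⟨NA, Q.names, sA, p.t ++ T, p.e, K⟩) C ∨
        ReadyAt M X' X k₀ (.prog ⟨NA, Q.names, sA, p.t ++ T, p.e, K⟩) C.swap) := by
  by_cases hcall : ∀ v f t, p.e = .val v → p.t = .appR [.ident (.fn f)] :: t → M'.fun? f = none
  · exact ⟨_, .refl, Or.inl ⟨_, _, _, _, _, _, _, _, rfl, rfl, h, ⟨hret, hcall⟩, hN, hσ⟩⟩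
  push Not at hcall
  obtain ⟨v, f, t, he, ht, hf⟩ := hcall
  obtain ⟨N, P, s, _, _, k⟩ := p
  dsimp only at he ht
  subst he ht
  -- The exchanged name also avoids `k₀`, which must stay fresh for a later call to the System.
  obtain ⟨k', hk, hk', hne⟩ := exists_fresh_cont h.core.left.fin h.core.right.fin {k₀}
  have hM := (hL.disj f).resolve_right hf
  obtain ⟨d, hd⟩ := Option.ne_none_iff_exists'.1 hf
  have h₂ := h.crossCall hk hk' (hL.right _ _ hd).1
  have hne' : Name.cont k₀ ∉ ({Name.cont k'} : Set Name) := by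
    simpa [eq_comm] using hne
  refine ⟨_, .single (Or.inl (.crossCall (.psCall hM hk rfl)
    (.spCall hf h.fn_mem_pub (fun hd => hk' (h.core.right.cont_mem hd))
      (h.loc.sysMay h.core h.term)) ?_)), Or.inr ⟨_, _, _, _, _, _, _, _, ?_, rfl, h₂, ⟨?_, ?_⟩,
        ?_, ?_⟩⟩
  · rwa [h.core.right.names_eq]
  · rfl
  · intro _ _ h'
    cases h'
  -- The callee is ready at once: the function belongs to it, so the caller does not define it.
  · intro _ _ _ _ h'
    cases h'
    exact hM
  · rintro ((h' | h') | h')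
    · exact hσ h'
    · exact hne' h'
    · simp at h'
  · rintro (h' | h')
    · exact hN h'
    · exact hne' h'

/-- A component that has control and that is about to return to the other component, or to call
it, does so until the component in control makes the next move of the linked module. -/
theorem Ctl.normalize {k₀ : ℕ} {S : Set ℕ} {κ κ' : ℕ → Option (Stack × ℕ)} {k : ℕ}
    (hU : Unf S κ κ' k T K) : ∀ {M M' : Mod} {X X' : Set Name} {p : ProgCfg} {σ : SysCfg}
    {aux : LStore}, Linked L M M' X X' → κ = p.s.cont.get → κ' = σ.s.cont.get → k = p.k →
    S = Q.polS → Ctl X X' NA sA T K p σ Q aux → Name.cont k₀ ∉ p.N → Name.cont k₀ ∉ σ.N →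
    ∃ C, (semComp M M').TauStar (⟨.prog p, .sys σ, Q, aux⟩ : Comp) C ∧
      (ReadyAt M' X X' k₀ (.prog ⟨NA, Q.names, sA, p.t ++ T, p.e, K⟩) C ∨
        ReadyAt M X' X k₀ (.prog ⟨NA, Q.names, sA, p.t ++ T, p.e, K⟩) C.swap) := by
  induction hU with
  | base hS =>
    rintro M M' X X' p σ aux hL rfl rfl rfl rfl h hN hσ
    exact h.normalize_call hL (fun _ _ _ => ⟨rfl, rfl, hS⟩) hN hσ
  | step hk hU ih =>
    rintro M M' X X' p σ aux hL rfl rfl rfl rfl h hN hσ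
    by_cases hret : ∃ v, p.e = .val v ∧ p.t = []
    · obtain ⟨v, he, ht⟩ := hret
      obtain ⟨N, P, s, _, _, k⟩ := p
      dsimp only at he ht
      subst he ht
      have h₂ := h.crossRet hk hU
      -- The partner is now in control with a shorter unfolding, and the roles of the modules are
      -- exchanged.
      obtain ⟨C, hC, hR⟩ := ih hL.symm rfl rfl rfl rfl h₂
        (by rintro (h' | h')
            · exact hσ h'
            · simp at h') hN
      refine ⟨C.swap, .head (Or.inl (.crossRet (.psRet rfl)
        (.spRet hk (h.loc.sysMay h.core h.term)))) (tauStar_swap hC), hR.symm⟩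
    · push Not at hret
      exact h.normalize_call hL (fun v he ht => absurd ht (hret v he)) hN hσ

theorem NLTS.TauStar.weak {N : NLTS} {x y z : N.State} {ℓ : Label} (h : N.TauStar x y)
    (hs : N.step y ℓ z) : N.Weak x ℓ z :=
  ⟨y, z, h, hs, .refl⟩

/-- The label's continuation name must be fixed before the synchronisations, so that the names
exchanged in them can avoid it. -/
theorem Ctl.weak_step (hL : Linked L M M' X X') (h : Ctl X X' NA sA T K p σ Q aux)
    (hs : Step L (.prog ⟨NA, Q.names, sA, p.t ++ T, p.e, K⟩) ℓ A')
    (hd : Disjoint ℓ.names (Comp.bound ⟨.prog p, .sys σ, Q, aux⟩)) :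
    ∃ C', (semComp M M').Weak (⟨.prog p, .sys σ, Q, aux⟩ : Comp) ℓ C' ∧ Rel X X' A' C' := by
  obtain ⟨k₀, hN, hσ, hk₀⟩ : ∃ k₀, Name.cont k₀ ∉ p.N ∧ Name.cont k₀ ∉ σ.N ∧
      ∀ f v k s, ℓ = .ps (.call f v k) s → k = k₀ := by
    by_cases hℓ : ∃ f v k s, ℓ = .ps (.call f v k) s
    · obtain ⟨f, v, k, s, rfl⟩ := hℓ
      have hk : Name.cont k ∉ NA := by
        generalize hA : Cfg.prog ⟨NA, Q.names, sA, p.t ++ T, p.e, K⟩ = A at hs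
        cases hs with
        | psCall hf hk hP =>
          simp only [Cfg.prog.injEq, ProgCfg.mk.injEq] at hA
          rwa [hA.1]
      have hb : Name.cont k ∉ Comp.bound ⟨.prog p, .sys σ, Q, aux⟩ :=
        Set.disjoint_left.1 hd (Or.inl (Or.inl (Or.inr rfl)))
      rw [h.core.contNA, not_or] at hk
      -- A name new to the linked machine but known to a component was exchanged between the
      -- components, hence it is bound, and the label avoids bound names.
      have hb' : Name.cont k ∈ p.N → Name.cont k ∉ σ.N := fun h₁ h₂ =>
        hb ⟨k, rfl, ⟨h.core.left.contPub k h₁, h.core.right.contPub k h₂⟩, hk.1⟩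
      refine ⟨k, fun h' => ?_, fun h' => ?_, fun f v k' s' e => by cases e; rfl⟩
      · rcases h.core.left.split k h' with h₁ | h₁ | h₁
        exacts [hk.1 h₁, hk.2 h₁, hb' h' h₁.1]
      · rcases h.core.right.split k h' with h₁ | h₁ | h₁
        exacts [hk.1 h₁, hk.2 h₁, hb' h₁.1 h']
    · obtain ⟨k₀, h₁, h₂, -⟩ := exists_fresh_cont h.core.left.fin h.core.right.fin ∅
      exact ⟨k₀, h₁, h₂, fun f v k s e => absurd ⟨f, v, k, s, e⟩ hℓ⟩
  obtain ⟨C, hC, hR | hR⟩ := Ctl.normalize h.unf hL rfl rfl rfl rfl h hN hσ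
  · obtain ⟨C', h₁, h₂⟩ := hR.step hL hs hk₀
    exact ⟨C', NLTS.TauStar.weak hC (Or.inl h₁), h₂⟩
  · obtain ⟨C', h₁, h₂⟩ := hR.step hL.symm hs hk₀
    exact ⟨C'.swap, NLTS.TauStar.weak hC (Or.inr h₁), h₂.swap⟩

theorem Rel.weak_step (hL : Linked L M M' X X') (hr : Rel X X' A C) (hs : Step L A ℓ A')
    (hd : Disjoint ℓ.names C.bound) :
    ∃ C', (semComp M M').Weak C ℓ C' ∧ Rel X X' A' C' := by
  cases hr with
  | left h => exact h.weak_step hL hs hd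
  | right h =>
    rw [← Comp.bound_swap] at hd
    obtain ⟨C', ⟨x, y, h₁, h₂, h₃⟩, hR⟩ := h.weak_step hL.symm hs hd
    exact ⟨C'.swap, ⟨_, _, tauStar_swap h₁, CompStep.swap (C := Comp.swap x) h₂,
      tauStar_swap h₃⟩, hR.swap⟩
  | idle hc hl =>
    obtain ⟨C', h₁, h₂⟩ := Rel.idle_step hL hc hl hs hd
    exact ⟨C', NLTS.TauStar.weak .refl h₁, h₂⟩

theorem Rel.isBisimulation (hL : Linked L M M' X X') :
    NLTS.IsBisimulation (sem L) (semComp M M') (Rel X X') := by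
  constructor
  · refine fun A C hr => ⟨hr.pub_eq, fun A' hs => ?_, fun ℓ A' _ hs hd => hr.weak_step hL hs hd⟩
    cases (show Step L A .tau A' from hs)
  · refine fun C A hr => ⟨hr.pub_eq.symm, fun C' hs => ?_, fun ℓ C' hℓ hs _ => ?_⟩
    · rcases hr.compStep hL hs with ⟨-, h⟩ | ⟨A', h, -⟩
      · exact ⟨A, .refl, h⟩
      · cases h
    · rcases hr.compStep hL hs with ⟨h, -⟩ | ⟨A', h₁, h₂⟩
      · exact absurd h hℓ
      · exact ⟨A', ⟨A, A', .refl, h₁, .refl⟩, h₂⟩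

end

/-! ## Linked modules -/

namespace Mod

variable {M M' : Mod}

theorem fun?_append (M M' : Mod) (f : ℕ) : (M.append M').fun? f = (M.fun? f).or (M'.fun? f) := by
  simp [fun?, append, List.findSome?_append]

theorem var?_append (M M' : Mod) (x : ℕ) : (M.append M').var? x = (M.var? x).or (M'.var? x) := by
  simp [var?, append, List.findSome?_append]

theorem mem_decls_of_fun? {f : ℕ} {d : Func} (h : M.fun? f = some d) :
    Dcl.func f d ∈ M.decls := by
  obtain ⟨D, hD, h⟩ := List.exists_of_findSome?_eq_some h
  cases D with
  | var => cases h
  | func g d' =>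
    dsimp only at h
    split at h
    · next hg =>
      cases h
      exact hg ▸ hD
    · cases h

theorem mem_decls_of_var? {x : ℕ} {n : ℤ} (h : M.var? x = some n) : Dcl.var x n ∈ M.decls := by
  obtain ⟨D, hD, h⟩ := List.exists_of_findSome?_eq_some h
  cases D with
  | func => cases h
  | var y m =>
    dsimp only at h
    split at h
    · next hg =>
      cases h
      exact hg ▸ hD
    · cases h

theorem var?_ne_none {x : ℕ} (h : Ident.loc x ∈ M.declared) : M.var? x ≠ none := by
  obtain ⟨D, hD, hx⟩ := h
  cases D with
  | func => cases hx
  | var y m =>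
    cases hx
    intro h
    rw [var?, List.findSome?_eq_none_iff] at h
    simpa using h _ hD

theorem header_append (M M' : Mod) : (M.append M').header = M.header ∪ M'.header := by
  ext i
  simp only [header, append, Finset.mem_union, Set.mem_ofPred_eq, Set.mem_union]
  tauto

theorem declared_append (M M' : Mod) : (M.append M').declared = M.declared ∪ M'.declared := by
  ext i
  simp only [declared, append, List.mem_append, Set.mem_ofPred_eq, Set.mem_union]
  constructor
  · rintro ⟨D, h | h, hi⟩
    · exact Or.inl ⟨D, h, hi⟩
    · exact Or.inr ⟨D, h, hi⟩
  · rintro (⟨D, h, hi⟩ | ⟨D, h, hi⟩)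
    · exact ⟨D, Or.inl h, hi⟩
    · exact ⟨D, Or.inr h, hi⟩

theorem scope_append (M M' : Mod) : (M.append M').scope = M.scope ∪ M'.scope := by
  unfold scope
  rw [header_append, declared_append, Set.union_union_union_comm]

theorem mem_declared_of_fun? {f : ℕ} {d : Func} (h : M.fun? f = some d) :
    Ident.fn f ∈ M.declared :=
  ⟨_, mem_decls_of_fun? h, rfl⟩

theorem mem_header_of_mem_scope {i : Ident} (h : Disjoint M.hidden M'.scope) (hi : i ∈ M.scope)
    (hi' : i ∈ M'.scope) : i ∈ M.header := by
  by_contra hh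
  exact Set.disjoint_left.1 h ⟨hi.resolve_left hh, hh⟩ hi'

/-- A name in both scopes is hidden in neither module, so it lies in both headers, where linkability
forbids a double declaration. -/
theorem notMem_declared (hlink : Linkable M M') (h : Disjoint M.hidden M'.scope)
    (h' : Disjoint M'.hidden M.scope) {i : Ident} (hi : i ∈ M.declared) : i ∉ M'.declared :=
  fun hi' => hlink i ⟨mem_header_of_mem_scope h (Or.inr hi) (Or.inr hi'),
    mem_header_of_mem_scope h' (Or.inr hi') (Or.inr hi)⟩ ⟨hi, hi'⟩

theorem linked_append (hM : M.WellFormed) (hM' : M'.WellFormed) (hlink : Linkable M M')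
    (h : Disjoint M.hidden M'.scope) (h' : Disjoint M'.hidden M.scope) :
    Linked (M.append M') M M' (Name.ident '' M.scope) (Name.ident '' M'.scope) := by
  have hdisj : ∀ f, M.fun? f = none ∨ M'.fun? f = none := by
    intro f
    by_contra hc
    rw [not_or, ← ne_eq, ← ne_eq, Option.ne_none_iff_exists', Option.ne_none_iff_exists'] at hc
    obtain ⟨⟨d, hd⟩, d', hd'⟩ := hc
    exact notMem_declared hlink h h' (mem_declared_of_fun? hd) (mem_declared_of_fun? hd')
  refine ⟨fun f d => ?_, hdisj, ?_, ?_⟩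
  · rw [fun?_append]
    rcases hdisj f with h | h <;> simp [h]
  · exact fun f d hd =>
      ⟨⟨_, Or.inr (mem_declared_of_fun? hd), rfl⟩, hM.2 _ _ (mem_decls_of_fun? hd)⟩
  · exact fun f d hd =>
      ⟨⟨_, Or.inr (mem_declared_of_fun? hd), rfl⟩, hM'.2 _ _ (mem_decls_of_fun? hd)⟩

theorem get_initStore_of_mem {X : Set Ident} {a : ℕ} (h : Ident.loc a ∈ X) :
    (M.initStore X).get a = (M.var? a).map Atom.int :=
  FinPMap.get_restrict_of_mem _ h

theorem get_initStore_of_notMem {X : Set Ident} {a : ℕ} (h : Ident.loc a ∉ X) :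
    (M.initStore X).get a = none :=
  FinPMap.get_restrict_of_notMem _ h

theorem names_initStore (M : Mod) (X : Set Ident) :
    LStore.names (M.initStore X) ⊆ Name.ident '' (X ∩ M.declared) := by
  rintro n ⟨a, b, hb, hn⟩
  by_cases ha : Ident.loc a ∈ X
  · rw [get_initStore_of_mem ha] at hb
    obtain ⟨m, hm, rfl⟩ := Option.map_eq_some_iff.1 hb
    rcases hn with rfl | hn
    · exact ⟨_, ⟨ha, _, mem_decls_of_var? hm, rfl⟩, rfl⟩
    · cases hn
  · rw [get_initStore_of_notMem ha] at hb
    cases hb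

theorem half_init (cA : FinPMap (Stack × ℕ)) (h : Disjoint M.hidden M'.scope) :
    Half (Name.ident '' M.scope) ∅ cA M.init M'.init where
  scope := subset_rfl
  pub := Set.image_mono Set.subset_union_left
  store := by
    rintro n (hn | ⟨k, t, k', hk, -⟩)
    · exact Set.image_mono (Set.inter_subset_right.trans Set.subset_union_right)
        (names_initStore _ _ hn)
    · cases hk
  contPub k hk := by simp [init] at hk
  locDom := by
    rintro a ⟨i, hi, hia⟩
    cases hia
    rcases hi with hi | hi
    · exact Or.inl ⟨_, hi, rfl⟩
    · right
      simpa [init, get_initStore_of_mem] using var?_ne_none hi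
  share := by
    rintro _ ⟨i, hi, rfl⟩ ⟨j, hj, hji⟩
    cases hji
    exact ⟨_, mem_header_of_mem_scope h hi hj, rfl⟩
  pol k hk := rfl
  fin := by simp [init]
  split k hk := by simp [init] at hk
  conts k t k₁ hk := by cases hk

theorem core_init (h : Disjoint M.hidden M'.scope) (h' : Disjoint M'.hidden M.scope) :
    Core (Name.ident '' M.scope) (Name.ident '' M'.scope) ∅ (M.append M').init.N FinPMap.empty
      (Name.ident '' (M.header ∪ M'.header)) M.init M'.init where
  left := half_init _ h
  right := half_init _ h'
  pubSub := by rw [Set.image_union]; rfl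
  ident i := by simp [init, scope_append]
  contUsed k hk := by simp [init] at hk
  contNA k := by simp [init, FinPMap.empty]
  saved k hk := absurd rfl hk

/-- The initial auxiliary store mentions header names only, all of which are in `Q`. Outside `Q` the
linked store is therefore just the union of the two initial stores. -/
theorem idleLoc_init (h : Disjoint M.hidden M'.scope) (h' : Disjoint M'.hidden M.scope) :
    IdleLoc M.init M'.init ((M.append M').initStore Set.univ)
      (Name.ident '' (M.header ∪ M'.header)) (compInit M M').aux := by
  have haux : LStore.names (compInit M M').aux ⊆ Name.ident '' (M.header ∪ M'.header) := by
    refine (LStore.names_override _ _).trans (Set.union_subset ?_ ?_)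
    · exact (names_initStore _ _).trans
        (Set.image_mono (Set.inter_subset_left.trans Set.subset_union_left))
    · exact (names_initStore _ _).trans
        (Set.image_mono (Set.inter_subset_left.trans Set.subset_union_right))
  refine ⟨?_, ?_, ?_, ?_, ?_, ?_, ?_⟩
  · refine haux.trans ?_
    rw [Set.image_union]
    exact Set.union_subset_union (Set.image_mono Set.subset_union_left)
      (Set.image_mono Set.subset_union_left)
  · rintro n hn ⟨i, hi, rfl⟩
    obtain ⟨j, hj, hji⟩ := haux hn
    cases hji
    exact ⟨_, hj.elim id fun hj => mem_header_of_mem_scope h hi (Or.inl hj), rfl⟩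
  · rintro n hn ⟨i, hi, rfl⟩
    obtain ⟨j, hj, hji⟩ := haux hn
    cases hji
    exact ⟨_, hj.elim (fun hj => mem_header_of_mem_scope h' hi (Or.inl hj)) id, rfl⟩
  · exact fun a ha => Or.inl (Set.image_mono Set.subset_union_left ha)
  · exact fun a ha => Or.inl (Set.image_mono Set.subset_union_right ha)
  · exact fun a ha => Or.inl (haux ha)
  · intro a ha
    have h₀ : (compInit M M').aux.get a = none := by
      by_contra hc
      exact ha (haux (LStore.loc_mem_names hc))
    simp only [h₀, Option.none_or, init, get_initStore_of_mem (Set.mem_univ _), var?_append]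
    cases M.var? a <;> rfl

/-- Functional composition for modules whose hidden names do not clash. -/
theorem bisimilar_append (hM : M.WellFormed) (hM' : M'.WellFormed) (hlink : Linkable M M')
    (h : Disjoint M.hidden M'.scope) (h' : Disjoint M'.hidden M.scope) :
    NLTS.Bisimilar (sem (M.append M')) (semComp M M') := by
  refine ⟨_, Rel.isBisimulation (linked_append hM hM' hlink h h'), ?_⟩
  change Rel _ _ (.sys (M.append M').init) (compInit M M')
  have : (M.append M').init = ⟨(M.append M').init.N, Name.ident '' (M.header ∪ M'.header),
      ⟨(M.append M').initStore Set.univ, FinPMap.empty⟩⟩ := by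
    rw [← header_append]
    rfl
  rw [this]
  exact .idle (Q := (compInit M M').pub) (core_init h h') (idleLoc_init h h')

end Mod

/-! ## Renaming -/

theorem Ren.ident_injective (ρ : Ren) : Function.Injective ρ.ident := by
  intro i j h
  cases i <;> cases j <;> simp_all [Ren.ident]

theorem Value.names_rename (ρ : Ren) (v : Value) {Y : Set Ident} (hv : v.names ⊆ Name.ident '' Y) :
    Value.names (v.map (Atom.rename ρ)) ⊆ Name.ident '' (ρ.ident '' Y) := by
  rintro n ⟨a, ha, hn⟩
  obtain ⟨b, hb, rfl⟩ := List.mem_map.1 ha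
  cases b with
  | int z => cases hn
  | ident i =>
    obtain ⟨j, hj, hji⟩ := hv ⟨.ident i, hb, rfl⟩
    cases hji
    cases hn
    exact ⟨_, ⟨i, hj, rfl⟩, rfl⟩

theorem Term.names_rename (ρ : Ren) (e : Term) {Y : Set Ident} (he : e.names ⊆ Name.ident '' Y) :
    (e.rename ρ).names ⊆ Name.ident '' (ρ.ident '' Y) := by
  induction e with
  | var x => exact Set.empty_subset _
  | val v => exact v.names_rename ρ he
  | new => exact Set.empty_subset _
  | localVar y e ih => exact ih he
  | deref e ih => exact ih he
  | ret e ih => exact ih he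
  | ite e e' e'' ih ih' ih'' =>
    obtain ⟨h, h''⟩ := Set.union_subset_iff.1 he
    obtain ⟨h, h'⟩ := Set.union_subset_iff.1 h
    exact Set.union_subset (Set.union_subset (ih h) (ih' h')) (ih'' h'')
  | binop _ e e' ih ih' | assign e e' ih ih' | seq e e' ih ih' | app e e' ih ih'
  | pair e e' ih ih' =>
    obtain ⟨h, h'⟩ := Set.union_subset_iff.1 he
    exact Set.union_subset (ih h) (ih' h')

theorem Func.term_rename (ρ : Ren) (d : Func) : (d.rename ρ).term = d.term.rename ρ := by
  unfold Func.term Func.rename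
  dsimp only
  induction d.locals with
  | nil => rfl
  | cons x l ih => simp [ih, Term.rename]

theorem Dcl.ident_rename (ρ : Ren) (D : Dcl) : (D.rename ρ).ident = ρ.ident D.ident := by
  cases D <;> rfl

namespace Mod

variable {M M' : Mod}

theorem header_rename (ρ : Ren) (M : Mod) : (M.rename ρ).header = ρ.ident '' M.header := by
  ext i
  simp only [header, rename, Finset.mem_image, Set.mem_ofPred_eq, Set.mem_image]
  grind

theorem declared_rename (ρ : Ren) (M : Mod) : (M.rename ρ).declared = ρ.ident '' M.declared := by
  ext i
  simp only [declared, rename, List.mem_map, Set.mem_ofPred_eq, Set.mem_image]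
  constructor
  · rintro ⟨_, ⟨D, hD, rfl⟩, rfl⟩
    exact ⟨_, ⟨D, hD, rfl⟩, (D.ident_rename ρ).symm⟩
  · rintro ⟨_, ⟨D, hD, rfl⟩, rfl⟩
    exact ⟨_, ⟨D, hD, rfl⟩, D.ident_rename ρ⟩

theorem scope_rename (ρ : Ren) (M : Mod) : (M.rename ρ).scope = ρ.ident '' M.scope := by
  simp only [scope, header_rename, declared_rename, Set.image_union]

theorem hidden_rename (ρ : Ren) (M : Mod) : (M.rename ρ).hidden = ρ.ident '' M.hidden := by
  simp only [hidden, header_rename, declared_rename, Set.image_sdiff ρ.ident_injective]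

theorem WellFormed.rename (ρ : Ren) (hM : M.WellFormed) : (M.rename ρ).WellFormed := by
  constructor
  · have : (M.rename ρ).decls.map Dcl.ident = (M.decls.map Dcl.ident).map ρ.ident := by
      simp [Mod.rename, Dcl.ident_rename]
    rw [this]
    exact hM.1.map ρ.ident_injective
  · intro f d h
    obtain ⟨D, hD, h⟩ := List.mem_map.1 h
    cases D with
    | var => cases h
    | func g d' =>
      cases h
      rw [Func.term_rename, scope_rename]
      exact Term.names_rename ρ _ (hM.2 _ _ hD)

theorem mem_declared_rename {ρ : Ren} (hρ : ∀ i ∈ M.header, ρ.ident i = i) {i : Ident}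
    (hi : i ∈ M.header) (h : i ∈ (M.rename ρ).declared) : i ∈ M.declared := by
  rw [declared_rename] at h
  obtain ⟨j, hj, hji⟩ := h
  rwa [← ρ.ident_injective (hji.trans (hρ i hi).symm)]

theorem mem_header_rename {ρ : Ren} (hρ : ∀ i ∈ M.header, ρ.ident i = i) {i : Ident}
    (hi : i ∈ (M.rename ρ).header) : i ∈ M.header := by
  rw [header_rename] at hi
  obtain ⟨j, hj, rfl⟩ := hi
  rwa [hρ j hj]

end Mod

theorem Linkable.rename {M M' : Mod} {ρ ρ' : Ren} (h : Linkable M M')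
    (hρ : ∀ i ∈ M.header, ρ.ident i = i) (hρ' : ∀ i ∈ M'.header, ρ'.ident i = i) :
    Linkable (M.rename ρ) (M'.rename ρ') := by
  rintro i ⟨hi, hi'⟩ ⟨hd, hd'⟩
  have hi := Mod.mem_header_rename hρ hi
  have hi' := Mod.mem_header_rename hρ' hi'
  exact h i ⟨hi, hi'⟩ ⟨Mod.mem_declared_rename hρ hi hd, Mod.mem_declared_rename hρ' hi' hd'⟩

/-! ## Existence of renamings -/

open Classical in
/-- The permutation that exchanges `x` and `x + c` for `x ∈ H`, where `H` lies below `c`. -/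
noncomputable def shiftPerm (H : Set ℕ) (c : ℕ) (h : ∀ x ∈ H, x < c) : Equiv.Perm ℕ :=
  Function.Involutive.toPerm
    (fun x => if x ∈ H then x + c else if c ≤ x ∧ x - c ∈ H then x - c else x) (by
      intro x
      -- Since `H` lies below `c`, it is disjoint from its translate, so the exchange is an
      -- involution.
      have h₁ : ∀ y, y + c ∉ H := fun y hy => by have := h _ hy; omega
      by_cases hx : x ∈ H
      · simp [hx, h₁]
      · by_cases hx' : c ≤ x ∧ x - c ∈ H
        · simp [hx, hx']
        · simp [hx, hx'])

theorem shiftPerm_of_mem {H : Set ℕ} {c : ℕ} (h : ∀ x ∈ H, x < c) {x : ℕ} (hx : x ∈ H) :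
    shiftPerm H c h x = x + c :=
  if_pos hx

theorem shiftPerm_of_notMem {H : Set ℕ} {c : ℕ} (h : ∀ x ∈ H, x < c) {x : ℕ} (hx : x ∉ H)
    (hc : x < c) : shiftPerm H c h x = x :=
  (if_neg hx).trans (if_neg fun h' => absurd h'.1 (not_le.2 hc))

/-- The index of an identifier. -/
def Ident.index : Ident → ℕ
  | .loc n => n
  | .fn n => n

/-- The renaming that shifts the identifiers in `H` by `c`. -/
noncomputable def shiftRen (H : Set Ident) (c : ℕ) (h : ∀ i ∈ H, i.index < c) : Ren where
  loc := shiftPerm {n | Ident.loc n ∈ H} c fun _ hn => h _ hn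
  fn := shiftPerm {n | Ident.fn n ∈ H} c fun _ hn => h _ hn

theorem index_shiftRen {H : Set Ident} {c : ℕ} (h : ∀ i ∈ H, i.index < c) {i : Ident}
    (hi : i ∈ H) : ((shiftRen H c h).ident i).index = i.index + c := by
  cases i with
  | loc n => exact shiftPerm_of_mem (H := {n | Ident.loc n ∈ H}) (fun _ hn => h _ hn) hi
  | fn n => exact shiftPerm_of_mem (H := {n | Ident.fn n ∈ H}) (fun _ hn => h _ hn) hi

theorem shiftRen_of_notMem {H : Set Ident} {c : ℕ} (h : ∀ i ∈ H, i.index < c) {i : Ident}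
    (hi : i ∉ H) (hc : i.index < c) : (shiftRen H c h).ident i = i := by
  cases i with
  | loc n =>
    exact congrArg Ident.loc
      (shiftPerm_of_notMem (H := {n | Ident.loc n ∈ H}) (fun _ hn => h _ hn) hi hc)
  | fn n =>
    exact congrArg Ident.fn
      (shiftPerm_of_notMem (H := {n | Ident.fn n ∈ H}) (fun _ hn => h _ hn) hi hc)

theorem Mod.finite_scope (M : Mod) : M.scope.Finite := by
  refine Set.Finite.union ?_ ?_
  · refine (M.exports ∪ M.imports).finite_toSet.subset ?_
    intro i hi
    simpa [Mod.header] using hi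
  · refine (M.decls.map Dcl.ident).finite_toSet.subset ?_
    rintro i ⟨D, hD, rfl⟩
    exact List.mem_map.2 ⟨D, hD, rfl⟩

/-- With `b` above all indices in use, hidden names of `M` move into `[b, 2b)` and those of `M'`
into `[2b, 3b)`, while header names stay below `b`. -/
theorem exists_preventsClashes (M M' : Mod) : ∃ ρ ρ' : Ren, PreventsClashes M M' ρ ρ' := by
  obtain ⟨b, hb⟩ : ∃ b, ∀ i ∈ M.scope ∪ M'.scope, i.index < b := by
    obtain ⟨b, hb⟩ := ((M.finite_scope.union M'.finite_scope).image Ident.index).bddAbove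
    exact ⟨b + 1, fun i hi => Nat.lt_succ_of_le (hb ⟨i, hi, rfl⟩)⟩
  have hs : ∀ i ∈ M.scope, i.index < b := fun i hi => hb i (Or.inl hi)
  have hs' : ∀ i ∈ M'.scope, i.index < b := fun i hi => hb i (Or.inr hi)
  have hh : ∀ i ∈ M.hidden, i.index < b := fun i hi => hs i (Or.inr hi.1)
  have hh' : ∀ i ∈ M'.hidden, i.index < 2 * b := fun i hi => by
    have := hs' i (Or.inr hi.1)
    omega
  refine ⟨shiftRen _ b hh, shiftRen _ (2 * b) hh', ?_, ?_, ?_, ?_⟩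
  · exact fun i hi => shiftRen_of_notMem _ (fun h => h.2 hi) (hs i (Or.inl hi))
  · intro i hi
    have := hs' i (Or.inl hi)
    exact shiftRen_of_notMem _ (fun h => h.2 hi) (by omega)
  · rw [Mod.hidden_rename, Mod.scope_rename, Set.disjoint_left]
    rintro _ ⟨i, hi, rfl⟩ ⟨j, hj, hji⟩
    have h₁ := congrArg Ident.index hji
    have h₂ := hh i hi
    have h₃ := hs' j hj
    rw [index_shiftRen _ hi] at h₁
    by_cases hj' : j ∈ M'.hidden
    · rw [index_shiftRen _ hj'] at h₁
      omega
    · rw [shiftRen_of_notMem _ hj' (by omega)] at h₁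
      omega
  · rw [Mod.hidden_rename, Mod.scope_rename, Set.disjoint_left]
    rintro _ ⟨i, hi, rfl⟩ ⟨j, hj, hji⟩
    have h₁ := congrArg Ident.index hji
    have h₂ := hh' i hi
    have h₃ := hs j hj
    rw [index_shiftRen _ hi] at h₁
    by_cases hj' : j ∈ M.hidden
    · rw [index_shiftRen _ hj'] at h₁
      omega
    · rw [shiftRen_of_notMem _ hj' h₃] at h₁
      omega

end SLS

theorem mainTheorem1 (M M' : SLS.Mod) (hM : M.WellFormed) (hM' : M'.WellFormed)
    (hlink : SLS.Linkable M M') :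
    (∃ ρ ρ' : SLS.Ren, SLS.PreventsClashes M M' ρ ρ') ∧
    ∀ ρ ρ' : SLS.Ren, SLS.PreventsClashes M M' ρ ρ' →
      SLS.NLTS.Bisimilar (SLS.sem ((M.rename ρ).append (M'.rename ρ')))
        (SLS.semComp (M.rename ρ) (M'.rename ρ')) :=
  ⟨SLS.exists_preventsClashes M M', fun ρ ρ' ⟨hρ, hρ', h, h'⟩ =>
    SLS.Mod.bisimilar_append (hM.rename ρ) (hM'.rename ρ') (hlink.rename hρ hρ') h h'⟩
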